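/- **Setting.** Let $\theta>0$, $\mu\in\mathbb R$, $A=2+\mu^2\theta/4$. For $m=(m_1,m_2)\in\mathbb N^2$ put $|m|=m_1+m_2$. Consider, at the self-dual point $\Omega=1$ and in the matrix base, either the real model with action $$S_r=\tfrac{(4\pi)^2\theta}{2}\sum_{m,n}\phi_{mn}(A+|m|+|n|)\phi_{nm}+\tfrac{\lambda}{4}4\pi^2\theta^2\sum_{m,n,k,l}\phi_{mn}\phi_{nk}\phi_{kl}\phi_{lm},$$ or the complex model with action $$S_c=(4\pi)^2\theta\sum_{m,n}\bar\phi_{mn}(A+|m|+|n|)\phi_{nm}+\tfrac{\lambda}{2}4\pi^2\theta^2\sum_{m,n,k,l}\bar\phi_{mn}\phi_{nk}\bar\phi_{kl}\phi_{lm},$$ with indices in $\mathbb N^2$. Put $\tilde\lambda=\lambda/16\pi^2$; all series below are formal power series in $\tilde\lambda$. For cutoffs $i\le\Lambda$ let $\Gamma_4(0,0,0,0)$ and $\Sigma(m,n)$ be the sums over the amputated one-particle irreducible planar ribbon graphs with a single broken face (all Wick contractions, with weights $\frac1{n!}(-\frac\lambda4 4\pi^2\theta^2)^n$, resp. $\frac1{n!}(-\frac\lambda2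 4\pi^2\theta^2)^n$) with four, resp. two, external legs, where every internal face carries an index $p\in\mathbb N^2$ with $i\le|p|\le\Lambda$ that is summed over. A line between faces $m,n$ carries the propagator $\big((4\pi)^2\theta\,(B+|m|+|n|)\big)^{-1}$, where $B=A+O(\tilde\lambda)$ contains the counterterms described below. $\Sigma$ depends on $m,n$ through $|m|,|n|$, which are extended to real values. Put $$Z=1-\tfrac1{(4\pi)^2\theta}\,\partial_{m_1}\Sigma(m,n)|_{m=n=0},\qquad \lambda_r=-\frac1{4\pi^2\theta^2}\frac{\Gamma_4(0,0,0,0)}{Z^2}.$$ *Subtractions.* Under *mass subtraction*, $B=A+\frac{1}{(4\pi)^2\theta}\Sigma(0,0)$: the mass counterterm cancels $\Sigma(0,0)$. Under *mass and useful wave-function subtraction*, $B$ depends on the scale $j$ of the line, namely the larger of the values $|p|$ of its two adjacent faces, external faces counting as $0$: $$B_j=Z_{>j}\,A+\tfrac{1}{(4\pi)^2\theta}\Sigma(0,0),$$ where $Z_{>j}$ is $Z$ computed with the internal faces restricted to $|p|>j$ (and $i\le |p|\le\Lambda$). Thus only the wave-function contributions of internal faces higher than the line are subtracted, and after field rescaling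 the propagator is $1/(A+|m|+|n|)$ at every scale. **Theorem.** For both models the following holds. Sums over $p,q,r$ are over $\mathbb N^2$, and $A+p$ stands for $A+|p|$, $A+p+q$ for $A+|p|+|q|$, and $r>p$ for $|r|>|p|$. (a) *Mass subtraction only* ($i=0$). For every $\Lambda$ there is exactly one such $B$, and $$\lambda_r=\lambda\left(1+\gamma_2^\Lambda\tilde\lambda^2-\gamma_3^\Lambda\tilde\lambda^3+O(\tilde\lambda^4)\right).$$ The first-order coefficient vanishes identically, $$\gamma_2^\Lambda=\frac A{16}\sum_{|p|,|q|\le\Lambda}\frac1{(A+p)^2(A+q)^2(A+p+q)},$$ and $\gamma_3^\Lambda=\sum_{|p|,|q|,|r|\le\Lambda}f_0(p,q,r)$, where $$f_w=\frac1{32}\Big[\Big(\frac{2A^2}{(A+p)^3(A+q)^2(A+p+q)}+\frac{A^2}{(A+p)^2(A+q)^2(A+p+q)^2}\Big)\Big(\frac1{(A+r)(A+p+r)}-w\Big)-\frac{A}{(A+p)^2(A+q)(A+p+q)^2}\Big(\frac1{(A+r)(A+q+r)}-w\Big)\Big].$$ With the useful wave-function subtraction $w=(A+r)^{-2}$ if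 $r>p$ and $r>q$, and $w=0$ otherwise, the sum of $f_w(p,q,r)$ over all $p,q,r$ converges absolutely. (b) *Mass and useful wave-function subtractions.* For all $i,\Lambda$ there is exactly one family $(B_j)_j$, and $$\lambda_r=\lambda\left(1+\gamma_2^{(i,\Lambda)}\tilde\lambda^2-\gamma_3^{(i,\Lambda)}\tilde\lambda^3+O(\tilde\lambda^4)\right),$$ again with no first-order term. For every $i$ the limits $\gamma_k^{(i)}=\lim_{\Lambda\to\infty}\gamma_k^{(i,\Lambda)}$, $k=2,3$, exist and are finite. Without infrared cutoff, $$\gamma_2=\gamma_2^{(0)}=\frac A{16}\sum_{p,q}\frac1{(A+p)^2(A+q)^2(A+p+q)}>0 .$$ (c) *Vanishing of the beta function up to three loops.* For $k=2,3$, $\gamma_k^{(i)}\to0$ as $i\to\infty$, and for every strictly increasing sequence $s_0<s_1<\cdots$ of scales (for example $s_i=M^i$ with an integer $M\ge2$) the changes $\gamma_k^{(s_i)}-\gamma_k^{(s_{i+1})}$ are absolutely summable over $i$. -/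

import Mathlib

open Filter Topology
open scoped PowerSeries

noncomputable section

namespace GrosseWulkenhaar

/-- The two models: the real field with interaction `φ⋆φ⋆φ⋆φ`, and the complex field with
interaction `φ̄⋆φ⋆φ̄⋆φ`. -/
inductive Model
  | real
  | complex

/-! ### Ribbon graphs as Wick contractions -/

/-- The half-edges of a graph with `n` four-valent vertices and `N` external legs: `inl (v, k)` is
the `k`-th field (in cyclic order) of the vertex `v`, and `inr k` is the `k`-th external field of
the correlation function. -/
abbrev HalfEdge (n N : ℕ) : Type := (Fin n × Fin 4) ⊕ Fin N

/-- The cyclic order of the fields at the vertices. The `N` external fields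
`φ_{m₀ m₁} φ_{m₁ m₂} ⋯ φ_{m_{N-1} m₀}` are cyclically ordered too: they are treated as the fields
of one additional `N`-valent vertex, which closes the graph. -/
def rotation (n N : ℕ) : Equiv.Perm (HalfEdge n N) :=
  Equiv.sumCongr (Equiv.prodCongr (Equiv.refl (Fin n)) (finRotate 4)) (finRotate N)

/-- In the complex model the fields `φ̄, φ` alternate at every vertex and in the correlation
function; `IsBar h` says that the half-edge `h` carries a `φ̄`. -/
def IsBar {n N : ℕ} : HalfEdge n N → Prop
  | Sum.inl (_, k) => Even (k : ℕ)
  | Sum.inr k => Even (k : ℕ)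

/-- Amputated Wick contractions: `σ` pairs the half-edges, no two external legs are paired with
each other, and in the complex model every `φ̄` is paired with a `φ`. -/
structure IsContraction (κ : Model) {n N : ℕ} (σ : Equiv.Perm (HalfEdge n N)) : Prop where
  involutive : ∀ h, σ (σ h) = h
  no_fixed_point : ∀ h, σ h ≠ h
  amputated : ∀ k l : Fin N, σ (Sum.inr k) ≠ Sum.inr l
  charge : κ = Model.complex → ∀ h, (IsBar (σ h) ↔ ¬ IsBar h)

/-- The graph whose vertices are the `n` interaction vertices, and whose edges are the internal
lines, except those with an end in `D`. -/
def lineGraph {n N : ℕ} (σ : Equiv.Perm (HalfEdge n N)) (D : Set (Fin n × Fin 4)) :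
    SimpleGraph (Fin n) :=
  SimpleGraph.fromRel fun v w => ∃ k l : Fin 4,
    σ (Sum.inl (v, k)) = Sum.inl (w, l) ∧ (v, k) ∉ D ∧ (w, l) ∉ D

/-- One-particle irreducible: connected, and still connected after any internal line is cut. -/
def IsOnePI {n N : ℕ} (σ : Equiv.Perm (HalfEdge n N)) : Prop :=
  (lineGraph σ ∅).Connected ∧
    ∀ h h' : Fin n × Fin 4, σ (Sum.inl h) = Sum.inl h' → (lineGraph σ {h}).Connected

/-- The faces of the closed ribbon graph: the cycles of `rotation * σ`. -/
def Face {n N : ℕ} (σ : Equiv.Perm (HalfEdge n N)) : Type :=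
  Quotient (Equiv.Perm.SameCycle.setoid (rotation n N * σ))

instance {n N : ℕ} (σ : Equiv.Perm (HalfEdge n N)) : Finite (Face σ) :=
  inferInstanceAs (Finite (Quotient (Equiv.Perm.SameCycle.setoid (rotation n N * σ))))

instance {n N : ℕ} (σ : Equiv.Perm (HalfEdge n N)) : Fintype (Face σ) := Fintype.ofFinite _

/-- The face that runs along the half-edge `h`; the two sides of the line `{h, σ h}` are the faces
of `h` and of `σ h`. -/
def faceOf {n N : ℕ} (σ : Equiv.Perm (HalfEdge n N)) (h : HalfEdge n N) : Face σ :=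
  Quotient.mk (Equiv.Perm.SameCycle.setoid (rotation n N * σ)) h

/-- Planar regular graphs: Euler's formula `V - E + F = 2` for the closed graph, which has `n + 1`
vertices and `(4 n + N) / 2` lines. For a connected graph this says that the graph with `N` open
legs has genus `0` and a single broken face, along which the external legs occur in the cyclic
order of the correlation function. -/
def IsPlanarRegular {n N : ℕ} (σ : Equiv.Perm (HalfEdge n N)) : Prop :=
  2 * ((n : ℤ) + 1) - (4 * n + N) + 2 * (Nat.card (Face σ) : ℤ) = 4

open scoped Classical in
/-- The contractions that contribute to the `N`-point function at order `n`. -/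
def contractions (κ : Model) (n N : ℕ) : Finset (Equiv.Perm (HalfEdge n N)) :=
  Finset.univ.filter fun σ => IsContraction κ σ ∧ IsOnePI σ ∧ IsPlanarRegular σ

/-! ### Amplitudes

All series are formal power series over `ℝ` in the variable `X = λ̃ = λ / (16 π²)`. -/

/-- `|m| = m₁ + m₂`. -/
def size (m : ℕ × ℕ) : ℕ := m.1 + m.2

/-- The values `m ∈ ℕ²` of an internal face, with infrared cutoff `lo` and ultraviolet cutoff `hi`:
`lo ≤ |m| ≤ hi`. -/
def indices (lo hi : ℕ) : Finset (ℕ × ℕ) :=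
  (Finset.range (hi + 1) ×ˢ Finset.range (hi + 1)).filter fun m => lo ≤ size m ∧ size m ≤ hi

/-- A face is internal if no external leg runs along it. -/
def IsInternal {n N : ℕ} (σ : Equiv.Perm (HalfEdge n N)) (F : Face σ) : Prop :=
  ∀ k : Fin N, F ≠ faceOf σ (Sum.inr k)

open scoped Classical in
instance {n N : ℕ} (σ : Equiv.Perm (HalfEdge n N)) : Fintype {F : Face σ // IsInternal σ F} :=
  Fintype.ofFinite _

open scoped Classical in
/-- The scale of a face: `|m|` for an internal face with value `m`, and `0` for an external face
(the renormalization point). -/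
def scale {n N : ℕ} (σ : Equiv.Perm (HalfEdge n N))
    (m : {F : Face σ // IsInternal σ F} → ℕ × ℕ) (F : Face σ) : ℕ :=
  if hF : IsInternal σ F then size (m ⟨F, hF⟩) else 0

open scoped Classical in
/-- The number that a face contributes to the adjacent propagators: `|m|` for an internal face, and
the external variable `x k` for the external face of the `k`-th leg. -/
def faceValue {n N : ℕ} (σ : Equiv.Perm (HalfEdge n N)) (x : Fin N → ℝ)
    (m : {F : Face σ // IsInternal σ F} → ℕ × ℕ) (F : Face σ) : ℝ :=
  (scale σ m F : ℝ) + ∑ k : Fin N, if F = faceOf σ (Sum.inr k) then x k else 0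

/-- The propagator `1 / ((4π)² θ (B + m + n))` of a line between the faces `F` and `F'`. The mass
parameter `B` is a power series in the coupling (it contains the counterterms), and may depend on
the scale of the line, the larger one of the scales of its two faces. -/
def propagator {n N : ℕ} (θ : ℝ) (B : ℕ → ℝ⟦X⟧) (σ : Equiv.Perm (HalfEdge n N)) (x : Fin N → ℝ)
    (m : {F : Face σ // IsInternal σ F} → ℕ × ℕ) (F F' : Face σ) : ℝ⟦X⟧ :=
  PowerSeries.C (1 / ((4 * Real.pi) ^ 2 * θ)) *
    (B (max (scale σ m F) (scale σ m F')) +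
      PowerSeries.C (faceValue σ x m F + faceValue σ x m F'))⁻¹

/-- The product of the propagators of all internal lines (each of them is counted once, at its
smaller half-edge in the lexicographic order). -/
def amplitude {n N : ℕ} (θ : ℝ) (B : ℕ → ℝ⟦X⟧) (σ : Equiv.Perm (HalfEdge n N)) (x : Fin N → ℝ)
    (m : {F : Face σ // IsInternal σ F} → ℕ × ℕ) : ℝ⟦X⟧ :=
  ∏ h : Fin n × Fin 4,
    match σ (Sum.inl h) with
    | Sum.inl h' =>
        if toLex h < toLex h' then
          propagator θ B σ x m (faceOf σ (Sum.inl h)) (faceOf σ (Sum.inl h'))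
        else 1
    | Sum.inr _ => 1

/-- The bare coupling `λ = 16 π² λ̃`. -/
def bareCoupling : ℝ⟦X⟧ := PowerSeries.C (16 * Real.pi ^ 2) * PowerSeries.X

/-- The factor of a vertex: minus the coefficient of the interaction in the action, which is
`(λ / 4) 4π²θ²` in the real and `(λ / 2) 4π²θ²` in the complex model. -/
def vertexFactor (κ : Model) (θ : ℝ) : ℝ⟦X⟧ :=
  match κ with
  | Model.real => - (PowerSeries.C (1 / 4 * (4 * Real.pi ^ 2 * θ ^ 2)) * bareCoupling)
  | Model.complex => - (PowerSeries.C (1 / 2 * (4 * Real.pi ^ 2 * θ ^ 2)) * bareCoupling)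

open scoped Classical in
/-- The contribution of the graphs with `n` vertices to the amputated one-particle irreducible
`N`-point function with external variables `x`; it is a multiple of `X ^ n`. -/
def orderTerm (κ : Model) (θ : ℝ) (lo hi : ℕ) (B : ℕ → ℝ⟦X⟧) (n N : ℕ) (x : Fin N → ℝ) : ℝ⟦X⟧ :=
  PowerSeries.C (1 / (n.factorial : ℝ)) * vertexFactor κ θ ^ n *
    ∑ σ ∈ contractions κ n N,
      ∑ m ∈ Fintype.piFinset fun _ : {F : Face σ // IsInternal σ F} => indices lo hi,
        amplitude θ B σ x m

/-- The amputated one-particle irreducible `N`-point function: the sum of `orderTerm` over all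
`n`. -/
def onePIFunction (κ : Model) (θ : ℝ) (lo hi : ℕ) (B : ℕ → ℝ⟦X⟧) (N : ℕ) (x : Fin N → ℝ) : ℝ⟦X⟧ :=
  PowerSeries.mk fun d =>
    ∑ n ∈ Finset.range (d + 1), PowerSeries.coeff d (orderTerm κ θ lo hi B n N x)

/-- The four-point function `Γ₄(0,0,0,0)`. -/
def Gamma4 (κ : Model) (θ : ℝ) (lo hi : ℕ) (B : ℕ → ℝ⟦X⟧) : ℝ⟦X⟧ :=
  onePIFunction κ θ lo hi B 4 fun _ => 0

/-- The self-energy `Σ(m,n)`; it depends on `m, n ∈ ℕ²` through `m₁ + m₂` and `n₁ + n₂` only, which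
are extended to real variables. -/
def selfEnergy (κ : Model) (θ : ℝ) (lo hi : ℕ) (B : ℕ → ℝ⟦X⟧) (m n : ℝ) : ℝ⟦X⟧ :=
  onePIFunction κ θ lo hi B 2 ![m, n]

/-- The wave function normalization `Z = 1 - ∂_{m₁} Σ(m,n)|_{m=n=0} / ((4π)² θ)`. -/
def waveFunction (κ : Model) (θ : ℝ) (lo hi : ℕ) (B : ℕ → ℝ⟦X⟧) : ℝ⟦X⟧ :=
  1 - PowerSeries.C (1 / ((4 * Real.pi) ^ 2 * θ)) *
    PowerSeries.mk fun d =>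
      deriv (fun m : ℝ => PowerSeries.coeff d (selfEnergy κ θ lo hi B m 0)) 0

/-- The effective coupling `λ_r = - Γ₄(0,0,0,0) / (4π²θ² Z²)`. -/
def effectiveCoupling (κ : Model) (θ : ℝ) (lo hi : ℕ) (B : ℕ → ℝ⟦X⟧) : ℝ⟦X⟧ :=
  - (PowerSeries.C (1 / (4 * Real.pi ^ 2 * θ ^ 2)) * Gamma4 κ θ lo hi B *
    (waveFunction κ θ lo hi B ^ 2)⁻¹)

/-! ### Subtractions -/

/-- Mass subtraction: the mass counterterm cancels `Σ(0,0)`, so that the inverse dressed propagator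
`(4π)² θ (B + m + n) - Σ(m,n)` equals `(4π)² θ A` at `m = n = 0`. -/
def IsMassSubtracted (κ : Model) (θ A : ℝ) (lo hi : ℕ) (B : ℕ → ℝ⟦X⟧) : Prop :=
  ∀ j, B j = PowerSeries.C A +
    PowerSeries.C (1 / ((4 * Real.pi) ^ 2 * θ)) * selfEnergy κ θ lo hi B 0 0

/-- Mass subtraction together with the useful wave function subtractions. For a line of scale `j`,
the useful wave function counterterm is the one of the two-point subgraphs all of whose internal
faces are higher than `j`; they multiply `m + n` by `Z_{>j}`. After the corresponding rescaling of
the field (which is what `Z²` in `effectiveCoupling` accounts for) the propagator has to be the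
fixed one, `1 / (A + m + n)`, at every scale; so the mass-subtracted parameter of the line is
`Z_{>j} A` in place of `A`. Mass subtractions are made irrespective of scales. -/
def IsUsefullySubtracted (κ : Model) (θ A : ℝ) (lo hi : ℕ) (B : ℕ → ℝ⟦X⟧) : Prop :=
  ∀ j, B j = PowerSeries.C A * waveFunction κ θ (max lo (j + 1)) hi B +
    PowerSeries.C (1 / ((4 * Real.pi) ^ 2 * θ)) * selfEnergy κ θ lo hi B 0 0

/-- `λ_r = λ (1 + γ₂ λ̃² - γ₃ λ̃³ + O(λ̃⁴))`. -/
def HasExpansion (lam : ℝ⟦X⟧) (γ₂ γ₃ : ℝ) : Prop :=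
  (PowerSeries.X : ℝ⟦X⟧) ^ 5 ∣ lam - bareCoupling *
    (1 + PowerSeries.C γ₂ * PowerSeries.X ^ 2 - PowerSeries.C γ₃ * PowerSeries.X ^ 3)

/-! ### Lattice sums -/

/-- The summand of `γ₂`. -/
def gammaTwoTerm (A : ℝ) (p q : ℕ × ℕ) : ℝ :=
  A / 16 * (1 / ((A + size p) ^ 2 * (A + size q) ^ 2 * (A + size p + size q)))

/-- The summand of `γ₃`; the number `w` is subtracted from the tadpole factors
`1 / ((A + r) (A + p + r))` and `1 / ((A + r) (A + q + r))`. -/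
def gammaThreeTerm (A : ℝ) (w : ℝ) (p q r : ℕ × ℕ) : ℝ :=
  1 / 32 *
    ((2 * A ^ 2 / ((A + size p) ^ 3 * (A + size q) ^ 2 * (A + size p + size q)) +
        A ^ 2 / ((A + size p) ^ 2 * (A + size q) ^ 2 * (A + size p + size q) ^ 2)) *
          (1 / ((A + size r) * (A + size p + size r)) - w) -
      A / ((A + size p) ^ 2 * (A + size q) * (A + size p + size q) ^ 2) *
          (1 / ((A + size r) * (A + size q + size r)) - w))

/-- The useful wave function subtraction of a tadpole: `1 / (A + r)²` if `r > p, q`, and `0`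
otherwise. -/
def usefulSubtraction (A : ℝ) (p q r : ℕ × ℕ) : ℝ :=
  if size p < size r ∧ size q < size r then 1 / (A + size r) ^ 2 else 0

end GrosseWulkenhaar

end

open GrosseWulkenhaar

noncomputable section

namespace GrosseWulkenhaar

/-! ### The number of cycles of a permutation -/

section Cycles

variable {α : Type*}

/-! The expansion of λ_r up to λ̃³ is a finite computation once three things are known: which graphs
occur, with which weights, and how the mass parameter `B` depends on the coupling to first order.
The limits are then a matter of power counting.

Graphs. The faces of a contraction are the cycles of `rotation * σ`, and adding one pair multiplies
this permutation by a transposition. Counting cycles along the construction gives the genus bound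
`numCycles_le`. It forces a planar contraction, built pair by pair from a chosen open half-edge, to
join that half-edge either to an entry of the same boundary word or to a fresh vertex
(`IsState.partner`). Hence `explore` finds all planar contractions up to relabelling, and each leaf
stands for `positions ^ n * n!` of them (`extSum_eq_explore`). This multiplicity cancels the `1 /
n!` and makes the two vertex factors equal, so both models have the same expansion. The lists of
irreducible graphs are obtained by kernel evaluation and certified by
`contribution_gluing_of_leafCheck`.

Algebra. With x = X/4, the quotient λ_r/λ is (1 - x G₂ + x² G₃ - x³ G₄) / (1 - x s₁ + x² s₂ - x³
s₃)², where the G are sums over four-point graphs and the s are minus the derivatives of two-point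
graphs. G₂ = 2 s₁ removes the first order. For a = 1/(A+p), b = 1/(A+q), d = 1/(A+p+q) one has
ab(a+b)d = a²b²(1+Ad). After symmetrization in the summation indices this relation makes the
contributions without a factor A cancel, and what remains is `gammaTwoTerm` and `gammaThreeTerm`
(`sum_gammaTwoTerm_eq`, `sum_triple_eq`). The mass parameter itself is the fixed point of an X-adic
contraction (`existsUnique_fixedPoint`), and its first coefficient enters the third order through
`coeff_one_eq`.

Analysis. The sum of (A+p)⁻² over ℕ² diverges only logarithmically, so one further inverse power of
an upper bound for the denominators makes the double and triple sums converge (`inv_le_rpow_mul`).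
In γ₃ the region where r is largest gains this power only through the useful subtraction
(`abs_gammaThreeTerm_le`). The coefficients with infrared cutoff are tails of absolutely convergent
series, so they tend to 0, and their increments are summable by telescoping
(`summable_abs_tailSum_sub`). -/

/-- The number of cycles of a permutation, fixed points included. -/
def numCycles (τ : Equiv.Perm α) : ℕ :=
  Nat.card (Quotient (Equiv.Perm.SameCycle.setoid τ))

/-- On a finite type a cycle is exhausted by forward iteration, so nothing has to be assumed about
`τ⁻¹`. -/
theorem sameCycle_of_invariant [Finite α] {τ : Equiv.Perm α} {Q : α → Prop}
    (hQ : ∀ z, Q z → Q (τ z)) {x y : α} (h : τ.SameCycle x y) (hx : Q x) : Q y := by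
  obtain ⟨k, -, rfl⟩ := h.exists_pow_eq'
  clear h
  induction k with
  | zero => simpa using hx
  | succ k ih => rw [pow_succ', Equiv.Perm.mul_apply]; exact hQ _ ih

theorem apply_eq_of_sameCycle [Finite α] {β : Type*} {τ : Equiv.Perm α} {φ : α → β}
    (hφ : ∀ z, φ (τ z) = φ z) {x y : α} (h : τ.SameCycle x y) : φ y = φ x :=
  sameCycle_of_invariant (Q := fun z => φ z = φ x) (fun z hz => (hφ z).trans hz) h rfl

variable [DecidableEq α]

/-- Identifying the new cycles through `a` and `b` makes the new cycle map invariant under `τ`; only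
one cycle can be lost by this identification. -/
theorem numCycles_mul_swap_le [Finite α] (τ : Equiv.Perm α) (a b : α) :
    numCycles (τ * Equiv.swap a b) ≤ numCycles τ + 1 := by
  classical
  set τ' := τ * Equiv.swap a b with hτ'
  have h1 : ∀ x, x ≠ a → x ≠ b → τ x = τ' x := fun x ha hb => by
    simp [hτ', Equiv.swap_apply_of_ne_of_ne ha hb]
  have h2 : τ a = τ' b := by simp [hτ']
  have h3 : τ b = τ' a := by simp [hτ']
  -- `φ` sends the `τ'`-cycle of `b` to that of `a`, so it does not see the transposition. The extra
  -- point `none` below restores the cycle of `b`.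
  let φ : α → Quotient (Equiv.Perm.SameCycle.setoid τ') := fun x =>
    if τ'.SameCycle x b then Quotient.mk _ a else Quotient.mk _ x
  have hφ : ∀ x, φ (τ x) = φ x := by
    intro x
    by_cases ha : x = a
    · subst ha
      have e1 : τ'.SameCycle (τ x) b := by
        rw [h2]; exact Equiv.Perm.sameCycle_apply_left.2 (Equiv.Perm.SameCycle.refl _ _)
      simp only [φ, if_pos e1]
      split_ifs <;> rfl
    by_cases hb : x = b
    · subst hb
      simp only [φ, if_pos (Equiv.Perm.SameCycle.refl τ' x), h3]
      split_ifs with h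
      · rfl
      · exact Quotient.sound
          (Equiv.Perm.sameCycle_apply_left.2 (Equiv.Perm.SameCycle.refl _ _))
    · simp only [φ, h1 x ha hb, Equiv.Perm.sameCycle_apply_left]
      split_ifs
      · rfl
      · exact Quotient.sound
          (Equiv.Perm.sameCycle_apply_left.2 (Equiv.Perm.SameCycle.refl _ _))
  let Φ : Option (Quotient (Equiv.Perm.SameCycle.setoid τ)) →
      Quotient (Equiv.Perm.SameCycle.setoid τ') := fun o =>
    o.elim (Quotient.mk _ b) (Quotient.lift φ fun x y h => (apply_eq_of_sameCycle hφ h).symm)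
  have hΦ : Function.Surjective Φ := by
    intro y
    induction y using Quotient.inductionOn with
    | h x =>
      by_cases hx : τ'.SameCycle x b
      · exact ⟨none, (Quotient.sound hx).symm⟩
      · refine ⟨some (Quotient.mk _ x), ?_⟩
        change φ x = _
        simp only [φ, if_neg hx]
  have := Nat.card_le_card_of_surjective Φ hΦ
  rwa [Finite.card_option] at this

/-- A transposition of points on different cycles merges these cycles and leaves the others alone,
so the cycle map is onto but not injective. -/
theorem numCycles_mul_swap_lt [Finite α] {τ : Equiv.Perm α} {a b : α} (h : ¬ τ.SameCycle a b) :
    numCycles (τ * Equiv.swap a b) + 1 ≤ numCycles τ := by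
  classical
  -- From `τ a` on, `τ'` follows `τ` until `a` or `b` is met; `b` is never met because it lies on
  -- another cycle, so the path comes back to `a`.
  have key : ∀ {a b : α}, ¬ τ.SameCycle a b →
      (τ * Equiv.swap a b).SameCycle (τ a) a := by
    intro a b h
    set τ' := τ * Equiv.swap a b with hτ'
    have main : ∀ k : ℕ, τ'.SameCycle (τ a) ((τ ^ k) (τ a)) ∨ τ'.SameCycle (τ a) a := by
      intro k
      induction k with
      | zero => exact Or.inl (Equiv.Perm.SameCycle.refl _ _)
      | succ k ih =>
        rcases ih with ih | ih
        · by_cases ha : (τ ^ k) (τ a) = a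
          · right; rwa [ha] at ih
          by_cases hb : (τ ^ k) (τ a) = b
          · exfalso
            apply h
            rw [← hb]
            refine ⟨(k : ℤ) + 1, ?_⟩
            rw [zpow_add, zpow_one, zpow_natCast, Equiv.Perm.mul_apply]
          · left
            rw [pow_succ', Equiv.Perm.mul_apply]
            have : τ ((τ ^ k) (τ a)) = τ' ((τ ^ k) (τ a)) := by
              simp only [hτ', Equiv.Perm.mul_apply, Equiv.swap_apply_of_ne_of_ne ha hb]
            rw [this]
            exact Equiv.Perm.sameCycle_apply_right.2 ih
        · exact Or.inr ih
    obtain ⟨k, -, hk⟩ :=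
      (Equiv.Perm.sameCycle_apply_left.2 (Equiv.Perm.SameCycle.refl τ a)).exists_pow_eq'
    rcases main k with h1 | h1
    · rwa [hk] at h1
    · exact h1
  set τ' := τ * Equiv.swap a b with hτ'
  have ka : τ'.SameCycle (τ a) a := key h
  have kb : τ'.SameCycle (τ b) b := by
    have := key (a := b) (b := a) fun h' => h h'.symm
    rwa [Equiv.swap_comm] at this
  have hab : τ'.SameCycle a b := by
    have : τ' b = τ a := by simp [hτ']
    exact (ka.symm.trans (this ▸ Equiv.Perm.sameCycle_apply_left.2 (Equiv.Perm.SameCycle.refl _ _)))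
  have hle : ∀ x y, τ.SameCycle x y → τ'.SameCycle x y := by
    intro x y hxy
    refine sameCycle_of_invariant (Q := fun z => τ'.SameCycle x z) (fun z hz => hz.trans ?_) hxy
      (Equiv.Perm.SameCycle.refl _ _)
    by_cases ha : z = a
    · subst ha; exact ka.symm
    by_cases hb : z = b
    · subst hb; exact kb.symm
    have : τ z = τ' z := by simp [hτ', Equiv.swap_apply_of_ne_of_ne ha hb]
    rw [this]
    exact Equiv.Perm.sameCycle_apply_right.2 (Equiv.Perm.SameCycle.refl _ _)
  let Φ : Quotient (Equiv.Perm.SameCycle.setoid τ) → Quotient (Equiv.Perm.SameCycle.setoid τ') :=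
    Quotient.map id hle
  have hs : Function.Surjective Φ := by
    intro y
    induction y using Quotient.inductionOn with
    | h x => exact ⟨Quotient.mk _ x, rfl⟩
  have hni : ¬ Function.Injective Φ := fun hi =>
    h (Quotient.exact (hi (a₁ := Quotient.mk _ a) (a₂ := Quotient.mk _ b) (Quotient.sound hab)))
  have := Fintype.ofFinite (Quotient (Equiv.Perm.SameCycle.setoid τ))
  have := Fintype.ofFinite (Quotient (Equiv.Perm.SameCycle.setoid τ'))
  have := Fintype.card_lt_of_surjective_not_injective Φ hs hni
  simpa only [numCycles, Nat.card_eq_fintype_card] using Nat.succ_le_of_lt this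

end Cycles

/-! ### Partial contractions -/

section Partial

variable {n N : ℕ}

/-- The involution that exchanges the two entries of each pair of a list. -/
def gluing : List (HalfEdge n N × HalfEdge n N) → Equiv.Perm (HalfEdge n N)
  | [] => 1
  | p :: L => gluing L * Equiv.swap p.1 p.2

/-- The entries of the pairs of a list. -/
def ends (L : List (HalfEdge n N × HalfEdge n N)) : List (HalfEdge n N) :=
  L.flatMap fun p => [p.1, p.2]

@[simp] theorem ends_nil : ends ([] : List (HalfEdge n N × HalfEdge n N)) = [] := rfl

@[simp] theorem ends_cons (p : HalfEdge n N × HalfEdge n N)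
    (L : List (HalfEdge n N × HalfEdge n N)) : ends (p :: L) = p.1 :: p.2 :: ends L := rfl

theorem length_ends (L : List (HalfEdge n N × HalfEdge n N)) : (ends L).length = 2 * L.length := by
  induction L with
  | nil => rfl
  | cons p L ih => simp [ih]; ring

theorem mem_ends {L : List (HalfEdge n N × HalfEdge n N)} {x : HalfEdge n N} :
    x ∈ ends L ↔ ∃ p ∈ L, x = p.1 ∨ x = p.2 := by
  simp [ends, List.mem_flatMap]

theorem gluing_apply_of_notMem {L : List (HalfEdge n N × HalfEdge n N)} {x : HalfEdge n N}
    (hx : x ∉ ends L) : gluing L x = x := by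
  induction L with
  | nil => rfl
  | cons p L ih =>
    simp only [ends_cons, List.mem_cons, not_or] at hx
    rw [gluing, Equiv.Perm.mul_apply, Equiv.swap_apply_of_ne_of_ne hx.1 hx.2.1, ih hx.2.2]

theorem gluing_apply {L : List (HalfEdge n N × HalfEdge n N)} (hL : (ends L).Nodup)
    {p : HalfEdge n N × HalfEdge n N} (hp : p ∈ L) :
    gluing L p.1 = p.2 ∧ gluing L p.2 = p.1 := by
  induction L with
  | nil => simp at hp
  | cons q L ih =>
    simp only [ends_cons, List.nodup_cons, List.mem_cons, not_or] at hL
    obtain ⟨⟨h12, h1⟩, h2, hL⟩ := hL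
    rcases List.mem_cons.1 hp with rfl | hp
    · simp [gluing, gluing_apply_of_notMem h1, gluing_apply_of_notMem h2]
    · have m1 : p.1 ∈ ends L := mem_ends.2 ⟨p, hp, Or.inl rfl⟩
      have m2 : p.2 ∈ ends L := mem_ends.2 ⟨p, hp, Or.inr rfl⟩
      rw [gluing, Equiv.Perm.mul_apply, Equiv.Perm.mul_apply,
        Equiv.swap_apply_of_ne_of_ne (fun h => h1 (by rw [← h]; exact m1))
          (fun h => h2 (by rw [← h]; exact m1)),
        Equiv.swap_apply_of_ne_of_ne (fun h => h1 (by rw [← h]; exact m2))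
          (fun h => h2 (by rw [← h]; exact m2))]
      exact ih hL hp

/-- `σ` extends the partial contraction `L`. -/
def Extends (σ : Equiv.Perm (HalfEdge n N)) (L : List (HalfEdge n N × HalfEdge n N)) : Prop :=
  ∀ p ∈ L, σ p.1 = p.2

theorem Extends.apply_eq {σ : Equiv.Perm (HalfEdge n N)}
    {L : List (HalfEdge n N × HalfEdge n N)} (h : Extends σ L) (hσ : ∀ x, σ (σ x) = x)
    (hL : (ends L).Nodup) {x : HalfEdge n N} (hx : x ∈ ends L) : σ x = gluing L x := by
  obtain ⟨p, hp, rfl | rfl⟩ := mem_ends.1 hx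
  · rw [h p hp, (gluing_apply hL hp).1]
  · rw [(gluing_apply hL hp).2, ← h p hp, hσ]

theorem gluing_mem_ends {L : List (HalfEdge n N × HalfEdge n N)} (hL : (ends L).Nodup)
    {x : HalfEdge n N} (hx : x ∈ ends L) : gluing L x ∈ ends L := by
  obtain ⟨p, hp, rfl | rfl⟩ := mem_ends.1 hx
  · rw [(gluing_apply hL hp).1]; exact mem_ends.2 ⟨p, hp, Or.inr rfl⟩
  · rw [(gluing_apply hL hp).2]; exact mem_ends.2 ⟨p, hp, Or.inl rfl⟩

theorem Extends.apply_notMem {σ : Equiv.Perm (HalfEdge n N)}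
    {L : List (HalfEdge n N × HalfEdge n N)} (h : Extends σ L) (hσ : ∀ x, σ (σ x) = x)
    (hL : (ends L).Nodup) {x : HalfEdge n N} (hx : x ∉ ends L) : σ x ∉ ends L := fun hm => by
  apply hx
  have := gluing_mem_ends hL hm
  rwa [← h.apply_eq hσ hL hm, hσ] at this

theorem Extends.eq_gluing {σ : Equiv.Perm (HalfEdge n N)}
    {L : List (HalfEdge n N × HalfEdge n N)} (h : Extends σ L) (hσ : ∀ x, σ (σ x) = x)
    (hL : (ends L).Nodup) (hall : ∀ x, x ∈ ends L) : σ = gluing L :=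
  Equiv.ext fun x => h.apply_eq hσ hL (hall x)

/-- Connectedness in terms of cuts. This form is the one that transports along relabellings and that
can be decided by counting lines. -/
theorem exists_crossing_of_connected {σ : Equiv.Perm (HalfEdge n N)} (hσ : ∀ x, σ (σ x) = x)
    {D : Set (Fin n × Fin 4)} (hc : (lineGraph σ D).Connected) {S : Set (Fin n)} {v w : Fin n}
    (hv : v ∈ S) (hw : w ∉ S) :
    ∃ h h' : Fin n × Fin 4, h.1 ∈ S ∧ h'.1 ∉ S ∧ σ (Sum.inl h) = Sum.inl h' ∧ h ∉ D ∧ h' ∉ D := by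
  by_contra hcon
  push Not at hcon
  obtain ⟨walk⟩ := hc.preconnected v w
  have : ∀ {a b : Fin n}, (lineGraph σ D).Walk a b → a ∈ S → b ∈ S := by
    intro a b p
    induction p with
    | nil => exact id
    | @cons a b c hab p ih =>
      intro ha
      refine ih ?_
      by_contra hb
      simp only [lineGraph, SimpleGraph.fromRel_adj] at hab
      rcases hab.2 with ⟨k, l, h1, h2, h3⟩ | ⟨k, l, h1, h2, h3⟩
      · exact h3 (hcon (a, k) (b, l) ha hb h1 h2)
      · refine h2 (hcon (a, l) (b, k) ha hb ?_ h3)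
        rw [← h1, hσ]
  exact hw (this walk hv)

/-- A line leaving the connected component of a vertex would enlarge that component. -/
theorem connected_of_exists_crossing {σ : Equiv.Perm (HalfEdge n N)} (hn : 0 < n)
    {D : Set (Fin n × Fin 4)}
    (hc : ∀ S : Set (Fin n), S.Nonempty → Sᶜ.Nonempty → ∃ h h' : Fin n × Fin 4,
      h.1 ∈ S ∧ h'.1 ∉ S ∧ σ (Sum.inl h) = Sum.inl h' ∧ h ∉ D ∧ h' ∉ D) :
    (lineGraph σ D).Connected := by
  have : Nonempty (Fin n) := ⟨⟨0, hn⟩⟩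
  refine { preconnected := fun v w => ?_ }
  by_contra hvw
  obtain ⟨h, h', h1, h2, h3, h4, h5⟩ :=
    hc {u | (lineGraph σ D).Reachable v u} ⟨v, SimpleGraph.Reachable.refl _⟩ ⟨w, hvw⟩
  apply h2
  refine SimpleGraph.Reachable.trans h1 (SimpleGraph.Adj.reachable ?_)
  simp only [lineGraph, SimpleGraph.fromRel_adj]
  refine ⟨fun he => h2 (he ▸ h1), Or.inl ⟨h.2, h'.2, h3, h4, h5⟩⟩

/-- The half-edges of the external legs and of the vertices in `V`. -/
def Visible (V : Finset (Fin n)) : HalfEdge n N → Prop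
  | Sum.inl h => h.1 ∈ V
  | Sum.inr _ => True

theorem rotation_inl (v : Fin n) (k : Fin 4) :
    rotation n N (Sum.inl (v, k)) = Sum.inl (v, k + 1) := by
  simp only [rotation, Equiv.sumCongr_apply, Sum.map_inl, Equiv.prodCongr_apply, Prod.map,
    Equiv.refl_apply, finRotate_apply]

/-- As long as nothing is attached to `v`, its four half-edges are closed under the face
permutation. -/
theorem not_sameCycle_of_unmatched {L : List (HalfEdge n N × HalfEdge n N)} {v : Fin n}
    (hv : ∀ k, Sum.inl (v, k) ∉ ends L) {e : HalfEdge n N} (he : ∀ k, e ≠ Sum.inl (v, k))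
    (k : Fin 4) : ¬ (rotation n N * gluing L).SameCycle e (Sum.inl (v, k)) := by
  intro h
  obtain ⟨j, hj⟩ := sameCycle_of_invariant (Q := fun z => ∃ j, z = Sum.inl (v, j))
    (fun z hz => by
      obtain ⟨j, rfl⟩ := hz
      exact ⟨j + 1, by rw [Equiv.Perm.mul_apply, gluing_apply_of_notMem (hv j), rotation_inl]⟩)
    h.symm ⟨k, rfl⟩
  exact he j hj

/-- If nothing visible is open, `σ` preserves the visible half-edges. Amputation joins a leg to some
vertex, so `V` is nonempty, and connectedness then leaves no line by which a further vertex could be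
attached. -/
theorem all_matched {κ : Model} {σ : Equiv.Perm (HalfEdge n N)} (hN : 0 < N)
    (hσ : IsContraction κ σ) (hc : (lineGraph σ ∅).Connected) {V : Finset (Fin n)}
    {L : List (HalfEdge n N × HalfEdge n N)} (hL : (ends L).Nodup)
    (hV : ∀ x ∈ ends L, Visible V x) (hext : Extends σ L)
    (hall : ∀ x, Visible V x → x ∈ ends L) : V = Finset.univ := by
  have hmem : ∀ x, Visible V x → Visible V (σ x) := fun x hx =>
    hV _ (by rw [hext.apply_eq hσ.involutive hL (hall x hx)]; exact gluing_mem_ends hL (hall x hx))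
  have hne : ∃ v, v ∈ V := by
    have h0 := hmem (Sum.inr ⟨0, hN⟩) trivial
    rcases h : σ (Sum.inr ⟨0, hN⟩) with ⟨v, k⟩ | k
    · rw [h] at h0; exact ⟨v, h0⟩
    · exact (hσ.amputated _ _ h).elim
  obtain ⟨v, hv⟩ := hne
  by_contra hV'
  obtain ⟨w, hw⟩ : ∃ w, w ∉ V := by
    by_contra! hcon
    exact hV' (Finset.eq_univ_iff_forall.2 hcon)
  obtain ⟨h, h', h1, h2, h3, -, -⟩ :=
    exists_crossing_of_connected hσ.involutive hc (S := {u | u ∈ V}) hv hw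
  have := hmem (Sum.inl h) h1
  rw [h3] at this
  exact h2 this

/-- There are `4 * n + N` half-edges in all, so two open ones leave room for at least one more pair.
-/
theorem two_mul_length_le {L : List (HalfEdge n N × HalfEdge n N)} {k : ℕ}
    (hk : 2 * (k + L.length) = 4 * n + N) (hL : (ends L).Nodup) {e f : HalfEdge n N}
    (he : e ∉ ends L) (hf : f ∉ ends L) (hef : e ≠ f) : 1 ≤ k := by
  have h1 : (e :: f :: ends L).Nodup := by simp [he, hf, hef, hL]
  have h2 := h1.length_le_card
  simp [length_ends] at h2
  omega

/-- A bound on the number of faces of a connected contraction in terms of a partial contraction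
which it extends. -/
theorem numCycles_le {κ : Model} {σ : Equiv.Perm (HalfEdge n N)} (hN : 0 < N)
    (hσ : IsContraction κ σ) (hc : (lineGraph σ ∅).Connected) (k : ℕ) :
    ∀ (V : Finset (Fin n)) (L : List (HalfEdge n N × HalfEdge n N)),
      2 * (k + L.length) = 4 * n + N → (ends L).Nodup → (∀ x ∈ ends L, Visible V x) →
      Extends σ L →
      numCycles (rotation n N * σ) + 2 * (n - V.card) ≤
        numCycles (rotation n N * gluing L) + k := by
  induction k with
  | zero =>
    intro V L hk hL hV hext
    have hall : ∀ x, x ∈ ends L := by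
      by_contra! hcon
      obtain ⟨e, he⟩ := hcon
      have := two_mul_length_le hk hL he (hext.apply_notMem hσ.involutive hL he)
        (hσ.no_fixed_point e).symm
      omega
    have hV' := all_matched hN hσ hc hL hV hext fun x _ => hall x
    rw [hext.eq_gluing hσ.involutive hL hall, hV']
    simp
  | succ k ih =>
    intro V L hk hL hV hext
    by_cases hall : ∀ x, Visible V x → x ∈ ends L
    · have hV' := all_matched hN hσ hc hL hV hext hall
      have hall' : ∀ x, x ∈ ends L := fun x => hall x (by
        rw [hV']; rcases x with x | x <;> simp [Visible])
      rw [hext.eq_gluing hσ.involutive hL hall', hV']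
      simp
    · push Not at hall
      obtain ⟨e, hev, he⟩ := hall
      have hf := hext.apply_notMem hσ.involutive hL he
      have hne := hσ.no_fixed_point e
      have hL' : (ends ((e, σ e) :: L)).Nodup := by
        simp [he, hf, hL, hne.symm]
      have hext' : Extends σ ((e, σ e) :: L) := by
        intro p hp
        rcases List.mem_cons.1 hp with rfl | hp
        · rfl
        · exact hext p hp
      have hk' : 2 * (k + ((e, σ e) :: L).length) = 4 * n + N := by
        simp only [List.length_cons]; omega
      have hglue : rotation n N * gluing ((e, σ e) :: L) =
          rotation n N * gluing L * Equiv.swap e (σ e) := by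
        rw [gluing, mul_assoc]
      -- A pair of visible half-edges creates at most one face. A pair that reaches a new vertex
      -- merges two faces instead; the loss of two against that bound is the term `2 * (n -
      -- V.card)`.
      by_cases hfv : Visible V (σ e)
      · have := ih V _ hk' hL' (by
          intro x hx
          simp only [ends_cons, List.mem_cons] at hx
          rcases hx with rfl | rfl | hx
          · exact hev
          · exact hfv
          · exact hV x hx) hext'
        have h2 := numCycles_mul_swap_le (rotation n N * gluing L) e (σ e)
        rw [hglue] at this
        omega
      · rcases hfe : σ e with ⟨v, j⟩ | j
        · rw [hfe] at hfv
          have hv : v ∉ V := hfv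
          have := ih (insert v V) _ hk' hL' (by
            have mono : ∀ x : HalfEdge n N, Visible V x → Visible (insert v V) x := by
              rintro (x | x) hx
              · exact Finset.mem_insert_of_mem hx
              · trivial
            intro x hx
            simp only [ends_cons, List.mem_cons] at hx
            rcases hx with rfl | rfl | hx
            · exact mono _ hev
            · rw [hfe]; exact Finset.mem_insert_self _ _
            · exact mono _ (hV x hx)) hext'
          have h2 := numCycles_mul_swap_lt (not_sameCycle_of_unmatched (L := L) (v := v) (e := e)
            (fun k hk => hv (hV _ hk)) (fun k hk => hv (by rw [hk] at hev; exact hev)) j)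
          rw [hglue, hfe] at this
          rw [Finset.card_insert_of_notMem hv] at this
          have hcard : V.card < n := by
            have := Finset.card_lt_univ_of_notMem hv
            simpa using this
          omega
        · rw [hfe] at hfv; exact (hfv trivial).elim

end Partial

/-! ### Boundary words -/

section Words

variable {α : Type*}

/-- `Follows τ E x y`: iterating `τ` leads from `x` to `y`, through elements of `E` only. -/
inductive Follows (τ : Equiv.Perm α) (E : α → Prop) : α → α → Prop
  | one (x : α) : Follows τ E x (τ x)
  | cons (x y : α) : E (τ x) → Follows τ E (τ x) y → Follows τ E x y

theorem Follows.trans {τ : Equiv.Perm α} {E : α → Prop} {x y z : α} (h : Follows τ E x y)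
    (hy : E y) (h' : Follows τ E y z) : Follows τ E x z := by
  induction h with
  | one x => exact Follows.cons _ _ hy h'
  | cons x y hx _ ih => exact Follows.cons _ _ hx (ih hy h')

/-- The elements of a list follow one another cyclically with respect to `R`. -/
def IsCyclicWord (R : α → α → Prop) : List α → Prop
  | [] => True
  | x :: w => List.IsChain R (x :: w ++ [x])

theorem exists_next_of_isChain {R : α → α → Prop} {w : List α} {z : α}
    (h : List.IsChain R (w ++ [z])) {x : α} (hx : x ∈ w) : ∃ y, (y ∈ w ∨ y = z) ∧ R x y := by
  induction w with
  | nil => simp at hx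
  | cons a w ih =>
    cases w with
    | nil =>
      simp only [List.mem_singleton] at hx
      subst hx
      refine ⟨z, Or.inr rfl, ?_⟩
      simpa using h
    | cons b w =>
      have h' : R a b ∧ List.IsChain R (b :: w ++ [z]) := by
        simpa [List.isChain_cons_cons] using h
      rcases List.mem_cons.1 hx with rfl | hx
      · exact ⟨b, Or.inl (by simp), h'.1⟩
      · obtain ⟨y, hy, hR⟩ := ih h'.2 hx
        exact ⟨y, hy.imp_left (List.mem_cons_of_mem _), hR⟩

theorem IsCyclicWord.exists_next {R : α → α → Prop} {w : List α} (h : IsCyclicWord R w) {x : α}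
    (hx : x ∈ w) : ∃ y ∈ w, R x y := by
  cases w with
  | nil => simp at hx
  | cons a w =>
    obtain ⟨y, hy, hR⟩ := exists_next_of_isChain h hx
    exact ⟨y, hy.elim id fun h => by simp [h], hR⟩

theorem isChain_map_init {R R' : α → α → Prop} {w : List α} {z : α}
    (h : List.IsChain R (w ++ [z])) (hR : ∀ x ∈ w, ∀ y, R x y → R' x y) :
    List.IsChain R' (w ++ [z]) := by
  induction w with
  | nil => simp
  | cons a w ih =>
    have hw : List.IsChain R' (w ++ [z]) :=
      ih (by simpa using h.tail) fun x hx => hR x (List.mem_cons_of_mem _ hx)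
    cases w with
    | nil =>
      have h' : R a z := by simpa using h
      simpa using hR a (by simp) _ h'
    | cons b w =>
      have h' : R a b ∧ List.IsChain R (b :: w ++ [z]) := by
        simpa [List.isChain_cons_cons] using h
      have : List.IsChain R' (a :: b :: (w ++ [z])) :=
        List.isChain_cons_cons.2 ⟨hR a (by simp) _ h'.1, by simpa using hw⟩
      simpa using this

theorem isChain_replace_last {R : α → α → Prop} {w : List α} {z z' : α}
    (h : List.IsChain R (w ++ [z])) (hz : ∀ x ∈ w, R x z → R x z') :
    List.IsChain R (w ++ [z']) := by
  induction w with
  | nil => simp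
  | cons a w ih =>
    have hw : List.IsChain R (w ++ [z']) :=
      ih (by simpa using h.tail) fun x hx => hz x (List.mem_cons_of_mem _ hx)
    cases w with
    | nil =>
      have h' : R a z := by simpa using h
      simpa using hz a (by simp) h'
    | cons b w =>
      have h' : R a b ∧ List.IsChain R (b :: w ++ [z]) := by
        simpa [List.isChain_cons_cons] using h
      have : List.IsChain R (a :: b :: (w ++ [z'])) :=
        List.isChain_cons_cons.2 ⟨h'.1, by simpa using hw⟩
      simpa using this

/-- The invariant under iteration: the current point is in `w`, or it is in `E` and on its way to an
entry of `w`. A point outside `E` must be of the first kind. -/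
theorem mem_word_of_sameCycle [Finite α] {τ : Equiv.Perm α} {E : α → Prop} {w : List α}
    (hw : IsCyclicWord (Follows τ E) w) {x y : α} (hx : x ∈ w) (hy : ¬ E y)
    (h : τ.SameCycle x y) : y ∈ w := by
  have := sameCycle_of_invariant (Q := fun z => z ∈ w ∨ (E z ∧ ∃ t ∈ w, Follows τ E z t))
    (fun z hz => by
      have hz' : ∃ t ∈ w, Follows τ E z t := by
        rcases hz with hz | ⟨-, hz⟩
        · exact hw.exists_next hz
        · exact hz
      obtain ⟨t, ht, hf⟩ := hz'
      cases hf with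
      | one => exact Or.inl ht
      | cons _ _ h1 h2 => exact Or.inr ⟨h1, t, ht, h2⟩) h (Or.inl hx)
  rcases this with h | ⟨h, -⟩
  · exact h
  · exact (hy h).elim

/-! ### How boundary words change when one pair is added -/

section Swap

variable {τ τ' : Equiv.Perm α} {E E' : α → Prop} {e f : α}

/-- The intermediate points of a path lie in `E`, hence avoid `e` and `f`, the only points where the
two permutations may differ. -/
theorem Follows.mono_swap (hE : ∀ x, E x → E' x) (he : ¬ E e) (hf : ¬ E f)
    (hτ : ∀ x, x ≠ e → x ≠ f → τ' x = τ x) {x y : α} (h : Follows τ E x y) (hxe : x ≠ e)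
    (hxf : x ≠ f) : Follows τ' E' x y := by
  induction h with
  | one x => rw [← hτ x hxe hxf]; exact Follows.one _
  | cons x y hx h ih =>
    have := ih (fun h => he (h ▸ hx)) (fun h => hf (h ▸ hx))
    rw [← hτ x hxe hxf] at this hx
    exact Follows.cons _ _ (hE _ hx) this

/-- Once `e` and `f` are joined, a path arriving at `f` continues as the path that used to leave
`e`. -/
theorem Follows.of_swapped (hE : ∀ x, E x → E' x) (he : ¬ E e) (hf : ¬ E f)
    (hτ : ∀ x, x ≠ e → x ≠ f → τ' x = τ x) (hfe : τ' f = τ e) {y : α}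
    (h : Follows τ E e y) : Follows τ' E' f y := by
  cases h with
  | one => rw [← hfe]; exact Follows.one _
  | cons _ _ hx h =>
    have := h.mono_swap hE he hf hτ (fun h => he (h ▸ hx)) (fun h => hf (h ▸ hx))
    rw [← hfe] at this hx
    exact Follows.cons _ _ (hE _ hx) this

/-- Joining `e` to `f` closes the stretch between them into a face of its own: the last letter runs
to `f` and from there, as from `e` before, to the first letter. -/
theorem isCyclicWord_split (hE : ∀ x, E x → E' x) (he : ¬ E e) (hf : ¬ E f) (hf' : E' f)
    (hτ : ∀ x, x ≠ e → x ≠ f → τ' x = τ x) (hfe : τ' f = τ e) {a : List α}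
    (hae : e ∉ a) (haf : f ∉ a) (h : List.IsChain (Follows τ E) (e :: a ++ [f])) :
    IsCyclicWord (Follows τ' E') a := by
  cases a with
  | nil => trivial
  | cons x a =>
    have h' : Follows τ E e x ∧ List.IsChain (Follows τ E) (x :: a ++ [f]) := by
      simpa [List.isChain_cons_cons] using h
    refine isChain_replace_last (z := f) (isChain_map_init h'.2 fun y hy z hz => ?_) ?_
    · exact hz.mono_swap hE he hf hτ (fun h => hae (h ▸ hy)) (fun h => haf (h ▸ hy))
    · intro y hy hyf
      exact hyf.trans hf' (h'.1.of_swapped hE he hf hτ hfe)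

theorem isCyclicWord_mono (hE : ∀ x, E x → E' x) (he : ¬ E e) (hf : ¬ E f)
    (hτ : ∀ x, x ≠ e → x ≠ f → τ' x = τ x) {a : List α}
    (hae : e ∉ a) (haf : f ∉ a) (h : IsCyclicWord (Follows τ E) a) :
    IsCyclicWord (Follows τ' E') a := by
  cases a with
  | nil => trivial
  | cons x a =>
    refine isChain_map_init h fun y hy z hz => ?_
    exact hz.mono_swap hE he hf hτ (fun h => hae (h ▸ hy)) (fun h => haf (h ▸ hy))

/-- Joining `e` to the half-edge `f` of a new vertex replaces `e`, in its word, by the other three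
half-edges of that vertex. -/
theorem isCyclicWord_discover (hE : ∀ x, E x → E' x) (he : ¬ E e) (hf : ¬ E f) (he' : E' e)
    (hf' : E' f) (hτ : ∀ x, x ≠ e → x ≠ f → τ' x = τ x) (hfe : τ' f = τ e) (hef : τ' e = τ f)
    {r₁ r₂ r₃ : α} {w : List α} (hwe : e ∉ w) (hwf : f ∉ w)
    (h₁ : τ f = r₁) (h₂ : τ r₁ = r₂) (h₃ : τ r₂ = r₃) (h₄ : τ r₃ = f)
    (hr₁ : r₁ ≠ e ∧ r₁ ≠ f) (hr₂ : r₂ ≠ e ∧ r₂ ≠ f) (hr₃ : r₃ ≠ e ∧ r₃ ≠ f)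
    (h : IsCyclicWord (Follows τ E) (e :: w)) :
    IsCyclicWord (Follows τ' E') (r₁ :: r₂ :: r₃ :: w) := by
  have f1 : Follows τ' E' r₁ r₂ := by rw [← h₂, ← hτ r₁ hr₁.1 hr₁.2]; exact Follows.one _
  have f2 : Follows τ' E' r₂ r₃ := by rw [← h₃, ← hτ r₂ hr₂.1 hr₂.2]; exact Follows.one _
  have f3 : Follows τ' E' r₃ f := by rw [← h₄, ← hτ r₃ hr₃.1 hr₃.2]; exact Follows.one _
  have f4 : Follows τ' E' e r₁ := by rw [← h₁, ← hef]; exact Follows.one _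
  have key : List.IsChain (Follows τ' E') (r₃ :: w ++ [r₁]) := by
    refine isChain_replace_last (z := e) ?_ fun y _ hy => hy.trans he' f4
    have h' : List.IsChain (Follows τ E) (e :: (w ++ [e])) := h
    cases w with
    | nil =>
      have h' : Follows τ E e e := by simpa [IsCyclicWord] using h
      simpa using f3.trans hf' (h'.of_swapped hE he hf hτ hfe)
    | cons x w =>
      have h' : Follows τ E e x ∧ List.IsChain (Follows τ E) (x :: w ++ [e]) := by
        simpa [IsCyclicWord, List.isChain_cons_cons] using h
      have hc : List.IsChain (Follows τ' E') (x :: w ++ [e]) :=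
        isChain_map_init h'.2 fun y hy z hz =>
          hz.mono_swap hE he hf hτ (fun h => hwe (h ▸ hy)) (fun h => hwf (h ▸ hy))
      exact List.isChain_cons_cons.2 ⟨f3.trans hf' (h'.1.of_swapped hE he hf hτ hfe), hc⟩
  exact List.isChain_cons_cons.2 ⟨f1, List.isChain_cons_cons.2 ⟨f2, key⟩⟩

end Swap

end Words

/-! ### Enumeration of planar contractions -/

section Explore

variable {n N : ℕ}

/-- All ways to split a list at one of its entries; `a` is what precedes the list. -/
def splits {α : Type*} (a : List α) : List α → List (List α × α × List α)
  | [] => []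
  | f :: b => (a, f, b) :: splits (a ++ [f]) b

theorem splits_map {α : Type*} (a w : List α) : (splits a w).map (fun t => t.2.1) = w := by
  induction w generalizing a with
  | nil => rfl
  | cons f b ih => simp [splits, ih]

theorem eq_of_mem_splits {α : Type*} {a w : List α} {t : List α × α × List α}
    (ht : t ∈ splits a w) : a ++ w = t.1 ++ t.2.1 :: t.2.2 := by
  induction w generalizing a with
  | nil => simp [splits] at ht
  | cons f b ih =>
    rcases List.mem_cons.1 ht with rfl | ht
    · rfl
    · rw [← ih ht]; simp

/-- Adds a word to a list of words, unless it is empty. -/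
def consWord {α : Type*} : List α → List (List α) → List (List α)
  | [], W => W
  | x :: w, W => (x :: w) :: W

theorem flatten_consWord {α : Type*} (w : List α) (W : List (List α)) :
    (consWord w W).flatten = w ++ W.flatten := by
  cases w <;> rfl

theorem mem_of_mem_consWord {α : Type*} {w x : List α} {W : List (List α)}
    (h : x ∈ consWord w W) : (x = w ∧ w ≠ []) ∨ x ∈ W := by
  cases w with
  | nil => exact Or.inr h
  | cons a w => exact (List.mem_cons.1 h).imp_left fun h => ⟨h, by simp⟩

/-- Position, at a new vertex, of the half-edge to which `e` is joined. -/
def slot : HalfEdge n N → Fin 4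
  | Sum.inl (_, k) => if (k : ℕ) % 2 = 0 then 1 else 0
  | Sum.inr k => if (k : ℕ) % 2 = 0 then 1 else 0

/-- Enumeration, up to relabeling of vertices, of the planar contractions which extend the partial
contraction `L`. Its vertices are the first `u` ones, and its boundary words are those in `W`. -/
def explore : ℕ → ℕ → List (HalfEdge n N × HalfEdge n N) → List (List (HalfEdge n N)) →
    List (List (HalfEdge n N × HalfEdge n N))
  | 0, u, L, W =>
    match W with
    | [] => if u = n then [L] else []
    | _ :: _ => []
  | k + 1, u, L, W =>
    match W with
    | [] => if u = n then [L] else []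
    | [] :: _ => []
    | (e :: w) :: W =>
      -- The partner of `e` is on a fresh vertex, represented by vertex `u` at position `slot e`, or
      -- it is an entry of the same word. A partner in another word would merge two faces and spoil
      -- planarity.
      (if h : u < n then
        explore k (u + 1) ((e, Sum.inl (⟨u, h⟩, slot e)) :: L)
          ((Sum.inl (⟨u, h⟩, slot e + 1) :: Sum.inl (⟨u, h⟩, slot e + 2) ::
            Sum.inl (⟨u, h⟩, slot e + 3) :: w) :: W)
      else []) ++
      (splits [] w).flatMap fun t =>
        if e.isRight && t.2.1.isRight then []
        else explore k u ((e, t.2.1) :: L) (consWord t.1 (consWord t.2.2 W))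

/-- The first `u` vertices. -/
def initial (n u : ℕ) : Finset (Fin n) := Finset.univ.filter fun v => (v : ℕ) < u

theorem mem_initial {u : ℕ} {v : Fin n} : v ∈ initial n u ↔ (v : ℕ) < u := by
  simp [initial]

theorem card_initial {u : ℕ} (h : u ≤ n) : (initial n u).card = u := by
  simp [initial, Fin.card_filter_val_lt, h]

/-- The invariants of the enumeration `explore`. -/
structure IsState (k u : ℕ) (L : List (HalfEdge n N × HalfEdge n N))
    (W : List (List (HalfEdge n N))) : Prop where
  length_eq : 2 * (k + L.length) = 4 * n + N
  used_le : u ≤ n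
  nodup : (ends L).Nodup
  visible : ∀ x ∈ ends L, Visible (initial n u) x
  words_nodup : W.flatten.Nodup
  mem_words : ∀ x, x ∈ W.flatten ↔ Visible (initial n u) x ∧ x ∉ ends L
  cyclic : ∀ w ∈ W, IsCyclicWord (Follows (rotation n N * gluing L) (· ∈ ends L)) w
  count : 2 * (numCycles (rotation n N * gluing L) + k) ≤ 2 * n + 2 + N + 4 * (n - u)
  nil_notMem : [] ∉ W

theorem gluing_cons_apply_fst {L : List (HalfEdge n N × HalfEdge n N)} {e f : HalfEdge n N} :
    (rotation n N * gluing ((e, f) :: L)) e = (rotation n N * gluing L) f := by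
  simp [gluing]

theorem gluing_cons_apply_snd {L : List (HalfEdge n N × HalfEdge n N)} {e f : HalfEdge n N} :
    (rotation n N * gluing ((e, f) :: L)) f = (rotation n N * gluing L) e := by
  simp [gluing]

theorem gluing_cons_apply_of_ne {L : List (HalfEdge n N × HalfEdge n N)} {e f x : HalfEdge n N}
    (hxe : x ≠ e) (hxf : x ≠ f) :
    (rotation n N * gluing ((e, f) :: L)) x = (rotation n N * gluing L) x := by
  simp [gluing, Equiv.swap_apply_of_ne_of_ne hxe hxf]

theorem rotation_mul_gluing_cons {L : List (HalfEdge n N × HalfEdge n N)} {e f : HalfEdge n N} :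
    rotation n N * gluing ((e, f) :: L) = rotation n N * gluing L * Equiv.swap e f := by
  rw [gluing, mul_assoc]

/-- One pair is used up and at most one face is gained, so the bound `count` is preserved; the word
falls apart into the pieces `a` and `b`. -/
theorem IsState.split {k u : ℕ} {L : List (HalfEdge n N × HalfEdge n N)} {e f : HalfEdge n N}
    {a b : List (HalfEdge n N)} {W : List (List (HalfEdge n N))}
    (h : IsState (k + 1) u L ((e :: (a ++ f :: b)) :: W)) :
    IsState k u ((e, f) :: L) (consWord a (consWord b W)) := by
  have hnd := h.words_nodup
  have hmem := h.mem_words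
  simp only [List.flatten_cons, List.cons_append, List.append_assoc, List.nodup_cons,
    List.nodup_append, List.mem_append, List.mem_cons] at hnd hmem
  push Not at hnd
  obtain ⟨⟨hea, hef, heb, heW⟩, ha, ⟨⟨hfb, hfW⟩, hb, hW, hbW⟩, hab⟩ := hnd
  have he := (hmem e).1 (by simp)
  have hf := (hmem f).1 (by simp)
  have hfa : f ∉ a := fun hh => (hab f hh f (Or.inl rfl)) rfl
  have hE : ∀ x, x ∈ ends L → x ∈ ends ((e, f) :: L) := fun x hx => by simp [hx]
  have hτ : ∀ x, x ≠ e → x ≠ f → (rotation n N * gluing ((e, f) :: L)) x =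
      (rotation n N * gluing L) x := fun x => gluing_cons_apply_of_ne
  have hcyc := h.cyclic _ (List.mem_cons_self)
  have hcyc' : List.IsChain (Follows (rotation n N * gluing L) (· ∈ ends L))
      ((e :: a) ++ [f] ++ (b ++ [e])) := by
    simpa [IsCyclicWord] using hcyc
  have c1 : List.IsChain (Follows (rotation n N * gluing L) (· ∈ ends L)) (e :: a ++ [f]) :=
    hcyc'.left_of_append
  have c2 : List.IsChain (Follows (rotation n N * gluing L) (· ∈ ends L)) (f :: b ++ [e]) := by
    have : List.IsChain (Follows (rotation n N * gluing L) (· ∈ ends L))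
      ((e :: a) ++ (f :: b ++ [e])) := by simpa using hcyc'
    exact this.right_of_append
  refine ⟨?_, h.used_le, ?_, ?_, ?_, ?_, ?_, ?_, ?_⟩
  · have := h.length_eq
    simp only [List.length_cons]; omega
  · simp [he.2, hf.2, hef, h.nodup]
  · intro x hx
    simp only [ends_cons, List.mem_cons] at hx
    rcases hx with rfl | rfl | hx
    · exact he.1
    · exact hf.1
    · exact h.visible x hx
  · rw [flatten_consWord, flatten_consWord]
    refine List.nodup_append.2 ⟨ha, List.nodup_append.2 ⟨hb, hW, fun x hx y hy => hbW x hx y hy⟩,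
      fun x hx y hy => hab x hx y (Or.inr (List.mem_append.1 hy))⟩
  · intro x
    rw [flatten_consWord, flatten_consWord]
    simp only [List.mem_append, ends_cons, List.mem_cons, not_or]
    have hx := hmem x
    constructor
    · intro hx'
      have := hx.1 (by tauto)
      refine ⟨this.1, ?_, ?_, this.2⟩
      · rintro rfl; tauto
      · rintro rfl; tauto
    · rintro ⟨h1, h2, h3, h4⟩
      have := hx.2 ⟨h1, h4⟩
      tauto
  · intro w hw
    rcases mem_of_mem_consWord hw with ⟨rfl, -⟩ | hw
    · exact isCyclicWord_split hE he.2 hf.2 (by simp) hτ gluing_cons_apply_snd hea hfa c1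
    · rcases mem_of_mem_consWord hw with ⟨rfl, -⟩ | hw
      · exact isCyclicWord_split (e := f) (f := e) hE hf.2 he.2 (by simp)
          (fun x h1 h2 => hτ x h2 h1) gluing_cons_apply_fst hfb heb c2
      · refine isCyclicWord_mono hE he.2 hf.2 hτ (fun hh => heW ?_) (fun hh => hfW ?_)
          (h.cyclic w (List.mem_cons_of_mem _ hw))
        · exact List.mem_flatten.2 ⟨w, hw, hh⟩
        · exact List.mem_flatten.2 ⟨w, hw, hh⟩
  · have h1 := h.count
    have h2 := numCycles_mul_swap_le (rotation n N * gluing L) e f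
    rw [rotation_mul_gluing_cons]
    omega
  · intro hw
    rcases mem_of_mem_consWord hw with ⟨h1, h2⟩ | hw
    · exact h2 h1.symm
    · rcases mem_of_mem_consWord hw with ⟨h1, h2⟩ | hw
      · exact h2 h1.symm
      · exact h.nil_notMem (List.mem_cons_of_mem _ hw)

theorem fin_four_add (j : Fin 4) :
    (∀ i, i = j ∨ i = j + 1 ∨ i = j + 2 ∨ i = j + 3) ∧ j + 1 ≠ j ∧ j + 2 ≠ j ∧ j + 3 ≠ j ∧
      j + 1 + 1 = j + 2 ∧ j + 2 + 1 = j + 3 ∧ j + 3 + 1 = j ∧ j + 1 ≠ j + 2 ∧ j + 1 ≠ j + 3 ∧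
      j + 2 ≠ j + 3 := by
  revert j; decide

/-- The new vertex was a face by itself and is merged, so the left side of `count` drops by 4,
exactly as `4 * (n - u)` does. -/
theorem IsState.discover {k u : ℕ} {L : List (HalfEdge n N × HalfEdge n N)} {e : HalfEdge n N}
    {w : List (HalfEdge n N)} {W : List (List (HalfEdge n N))}
    (h : IsState (k + 1) u L ((e :: w) :: W)) (hu : u < n) (j : Fin 4) :
    IsState k (u + 1) ((e, Sum.inl (⟨u, hu⟩, j)) :: L)
      ((Sum.inl (⟨u, hu⟩, j + 1) :: Sum.inl (⟨u, hu⟩, j + 2) ::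
        Sum.inl (⟨u, hu⟩, j + 3) :: w) :: W) := by
  have hnd := h.words_nodup
  have hmem := h.mem_words
  have hnv : ∀ i, ¬ Visible (N := N) (initial n u) (Sum.inl (⟨u, hu⟩, i)) := fun i hi => by
    have := mem_initial.1 hi
    simp at this
  have hne : ∀ x i, Visible (initial n u) x → x ≠ Sum.inl (⟨u, hu⟩, i) := fun x i hx hxi =>
    hnv i (hxi ▸ hx)
  have mono : ∀ x : HalfEdge n N, Visible (initial n u) x → Visible (initial n (u + 1)) x := by
    rintro (x | x) hx
    · exact mem_initial.2 (Nat.lt_succ_of_lt (mem_initial.1 hx))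
    · trivial
  have hnew : ∀ i, Visible (N := N) (initial n (u + 1)) (Sum.inl (⟨u, hu⟩, i)) := fun i =>
    mem_initial.2 (by simp)
  have hvis : ∀ x : HalfEdge n N, Visible (initial n (u + 1)) x →
      Visible (initial n u) x ∨ ∃ i, x = Sum.inl (⟨u, hu⟩, i) := by
    rintro (⟨v, i⟩ | x) hx
    · have h1 : (v : ℕ) < u + 1 := mem_initial.1 hx
      rcases Nat.lt_succ_iff_lt_or_eq.1 h1 with h2 | h2
      · exact Or.inl (mem_initial.2 h2)
      · exact Or.inr ⟨i, by simp [← h2]⟩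
    · exact Or.inl trivial
  have hend : ∀ i, (Sum.inl (⟨u, hu⟩, i) : HalfEdge n N) ∉ ends L := fun i hi =>
    hnv i (h.visible _ hi)
  have hword : ∀ i, (Sum.inl (⟨u, hu⟩, i) : HalfEdge n N) ∉ ((e :: w) :: W).flatten := fun i hi =>
    hnv i ((hmem _).1 hi).1
  have hstep : ∀ i, (rotation n N * gluing L) (Sum.inl (⟨u, hu⟩, i)) =
      Sum.inl (⟨u, hu⟩, i + 1) := fun i => by
    rw [Equiv.Perm.mul_apply, gluing_apply_of_notMem (hend i), rotation_inl]
  simp only [List.flatten_cons, List.cons_append, List.nodup_cons,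
    List.nodup_append, List.mem_append, List.mem_cons] at hnd hmem hword
  push Not at hnd hword
  obtain ⟨⟨hew, heW⟩, hw, hW, hwW⟩ := hnd
  have he := (hmem e).1 (by simp)
  set f : HalfEdge n N := Sum.inl (⟨u, hu⟩, j) with hf
  have hE : ∀ x, x ∈ ends L → x ∈ ends ((e, f) :: L) := fun x hx => by simp [hx]
  have hτ : ∀ x, x ≠ e → x ≠ f → (rotation n N * gluing ((e, f) :: L)) x =
      (rotation n N * gluing L) x := fun x => gluing_cons_apply_of_ne
  have hmem' : ∀ x, (x ∈ w ∨ x ∈ W.flatten) →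
      Visible (initial n u) x ∧ x ∉ ends L ∧ x ≠ e := fun x hx => by
    have h1 := (hmem x).1 (Or.inr hx)
    refine ⟨h1.1, h1.2, ?_⟩
    rintro rfl
    exact hx.elim hew heW
  have hfj : ∀ i, i ≠ j → (Sum.inl (⟨u, hu⟩, i) : HalfEdge n N) ≠ f := fun i hi hif =>
    hi (Prod.ext_iff.1 (Sum.inl.inj hif)).2
  obtain ⟨hj, j1, j2, j3, j4, j5, j6, j7, j8, j9⟩ := fin_four_add j
  refine ⟨?_, hu, ?_, ?_, ?_, ?_, ?_, ?_, ?_⟩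
  · have := h.length_eq
    simp only [List.length_cons]; omega
  · simp [he.2, hend, hne e j he.1, h.nodup, hf]
  · intro x hx
    simp only [ends_cons, List.mem_cons] at hx
    rcases hx with rfl | rfl | hx
    · exact mono _ he.1
    · exact hnew _
    · exact mono _ (h.visible x hx)
  · simp only [List.flatten_cons, List.cons_append, List.nodup_cons, List.mem_cons,
      List.mem_append, List.nodup_append]
    push Not
    refine ⟨⟨?_, ?_, (hword _).2⟩, ⟨?_, (hword _).2⟩, (hword _).2, hw, hW, hwW⟩
    · simp
    · simp
    · simp
  · intro x
    simp only [List.flatten_cons, List.cons_append, List.mem_cons, List.mem_append, ends_cons,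
      not_or]
    constructor
    · rintro (rfl | rfl | rfl | hx')
      · exact ⟨hnew _, (hne e _ he.1).symm, hfj _ j1, hend _⟩
      · exact ⟨hnew _, (hne e _ he.1).symm, hfj _ j2, hend _⟩
      · exact ⟨hnew _, (hne e _ he.1).symm, hfj _ j3, hend _⟩
      · have := hmem' x hx'
        exact ⟨mono _ this.1, this.2.2, hne x j this.1, this.2.1⟩
    · rintro ⟨h1, h2, h3, h4⟩
      rcases hvis x h1 with h5 | ⟨i, rfl⟩
      · exact Or.inr (Or.inr (Or.inr (((hmem x).2 ⟨h5, h4⟩).resolve_left h2)))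
      · rcases hj i with rfl | rfl | rfl | rfl
        · exact (h3 rfl).elim
        · exact Or.inl rfl
        · exact Or.inr (Or.inl rfl)
        · exact Or.inr (Or.inr (Or.inl rfl))
  · intro w' hw'
    rcases List.mem_cons.1 hw' with rfl | hw'
    · refine isCyclicWord_discover (f := f) hE he.2 (hend j) (by simp) (by simp) hτ
        gluing_cons_apply_snd
        gluing_cons_apply_fst hew (fun hh => (hword j).2.1 hh) (hstep _) ?_ ?_ ?_ ?_ ?_ ?_
        (h.cyclic _ List.mem_cons_self)
      · rw [hstep, j4]
      · rw [hstep, j5]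
      · rw [hstep, j6]
      · exact ⟨(hne e _ he.1).symm, hfj _ j1⟩
      · exact ⟨(hne e _ he.1).symm, hfj _ j2⟩
      · exact ⟨(hne e _ he.1).symm, hfj _ j3⟩
    · refine isCyclicWord_mono (f := f) hE he.2 (hend j) hτ (fun hh => heW ?_)
        (fun hh => (hword j).2.2 ?_)
        (h.cyclic w' (List.mem_cons_of_mem _ hw'))
      · exact List.mem_flatten.2 ⟨w', hw', hh⟩
      · exact List.mem_flatten.2 ⟨w', hw', hh⟩
  · have h1 := h.count
    have h2 := numCycles_mul_swap_lt (not_sameCycle_of_unmatched (L := L) hend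
      (fun i => hne e i he.1) j)
    rw [rotation_mul_gluing_cons]
    rw [← hf] at h2
    omega
  · intro hw'
    rcases List.mem_cons.1 hw' with h1 | h1
    · exact List.cons_ne_nil _ _ h1.symm
    · exact h.nil_notMem (List.mem_cons_of_mem _ h1)

end Explore

/-! ### Relabelling of vertices and sums over the extensions of a partial contraction -/

section Relabel

variable {n N : ℕ}

/-- Permutes the vertices by `s` and rotates each vertex `v` by `r v`. -/
def relabel (s : Equiv.Perm (Fin n)) (r : Fin n → Fin 4) : Equiv.Perm (HalfEdge n N) :=
  Equiv.sumCongr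
    { toFun := fun h => (s h.1, h.2 + r h.1)
      invFun := fun h => (s.symm h.1, h.2 - r (s.symm h.1))
      left_inv := fun h => by simp
      right_inv := fun h => by simp }
    (Equiv.refl _)

@[simp] theorem relabel_inl (s : Equiv.Perm (Fin n)) (r : Fin n → Fin 4) (h : Fin n × Fin 4) :
    relabel (N := N) s r (Sum.inl h) = Sum.inl (s h.1, h.2 + r h.1) := rfl

@[simp] theorem relabel_inr (s : Equiv.Perm (Fin n)) (r : Fin n → Fin 4) (k : Fin N) :
    relabel s r (Sum.inr k) = Sum.inr k := rfl

/-- `g` does not depend on the labels of the vertices, nor on the choice of the first half-edge at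
each vertex (among those of the same charge, in the complex model). -/
def IsRelabelInvariant {M : Type*} (κ : Model) (g : Equiv.Perm (HalfEdge n N) → M) : Prop :=
  ∀ (s : Equiv.Perm (Fin n)) (r : Fin n → Fin 4),
    (κ = Model.complex → ∀ v, Even (r v : ℕ)) →
      ∀ σ, g (relabel s r * σ * (relabel s r)⁻¹) = g σ

/-- The number of possible positions of the first half-edge of a vertex. -/
def Model.positions : Model → ℕ
  | Model.real => 4
  | Model.complex => 2

variable {M : Type*} [AddCommMonoid M]

open scoped Classical in
/-- The sum of `g` over all permutations which extend a partial contraction. -/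
def extSum (g : Equiv.Perm (HalfEdge n N) → M) (L : List (HalfEdge n N × HalfEdge n N)) : M :=
  ∑ σ ∈ Finset.univ.filter fun σ => Extends σ L, g σ

/-- All unused vertices, and all admissible positions at them, are equivalent: a relabelling that
fixes the visible part carries one choice of partner into the other. -/
theorem extSum_relabel {κ : Model} {g : Equiv.Perm (HalfEdge n N) → M}
    (hg : IsRelabelInvariant κ g) {u : ℕ} {L : List (HalfEdge n N × HalfEdge n N)}
    (hV : ∀ x ∈ ends L, Visible (initial n u) x) {e : HalfEdge n N}
    (he : Visible (initial n u) e) {v w : Fin n} (hv : u ≤ v) (hw : u ≤ w) {j i : Fin 4}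
    (hij : κ = Model.complex → Even ((i - j : Fin 4) : ℕ)) :
    extSum g ((e, Sum.inl (v, j)) :: L) = extSum g ((e, Sum.inl (w, i)) :: L) := by
  classical
  -- Exchange `v` and `w` and turn `v` by `i - j`; visible half-edges belong to legs or to vertices
  -- below `u`, so they stay fixed.
  set s : Equiv.Perm (Fin n) := Equiv.swap v w with hs
  set r : Fin n → Fin 4 := Pi.single v (i - j) with hr
  have hfix : ∀ x : HalfEdge n N, Visible (initial n u) x → relabel s r x = x := by
    rintro (⟨a, b⟩ | x) hx
    · have ha : (a : ℕ) < u := mem_initial.1 hx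
      have h1 : a ≠ v := fun h => by subst h; omega
      have h2 : a ≠ w := fun h => by subst h; omega
      simp [hs, hr, h1, Equiv.swap_apply_of_ne_of_ne h1 h2]
    · rfl
  have hmove : relabel s r (Sum.inl (v, j)) = (Sum.inl (w, i) : HalfEdge n N) := by
    simp [hs, hr]
  refine Finset.sum_equiv (MulAut.conj (relabel s r)).toEquiv (fun σ => ?_) (fun σ _ => ?_)
  · simp only [Finset.mem_filter, Finset.mem_univ, true_and, MulEquiv.toEquiv_eq_coe,
      EquivLike.coe_coe, MulAut.conj_apply, Extends, List.mem_cons, forall_eq_or_imp,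
      Equiv.Perm.mul_apply]
    have hinv : ∀ x : HalfEdge n N, Visible (initial n u) x → (relabel s r)⁻¹ x = x :=
      fun x hx => by rw [Equiv.Perm.inv_eq_iff_eq, hfix x hx]
    rw [hinv e he]
    refine and_congr ?_ (forall₂_congr fun p hp => ?_)
    · rw [← hmove, (relabel s r).apply_eq_iff_eq]
    · rw [hinv _ (hV _ (mem_ends.2 ⟨p, hp, Or.inl rfl⟩))]
      nth_rewrite 2 [← hfix _ (hV _ (mem_ends.2 ⟨p, hp, Or.inr rfl⟩))]
      rw [(relabel s r).apply_eq_iff_eq]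
  · refine (hg s r (fun hκ a => ?_) σ).symm
    by_cases ha : a = v
    · subst ha; simpa [hr] using hij hκ
    · simp [hr, ha]

theorem extSum_eq_zero {g : Equiv.Perm (HalfEdge n N) → M}
    {L : List (HalfEdge n N × HalfEdge n N)} (h : ∀ σ, Extends σ L → g σ = 0) :
    extSum g L = 0 := by
  classical
  exact Finset.sum_eq_zero fun σ hσ => h σ (Finset.mem_filter.1 hσ).2

theorem extends_cons {σ : Equiv.Perm (HalfEdge n N)} {L : List (HalfEdge n N × HalfEdge n N)}
    {e f : HalfEdge n N} : Extends σ ((e, f) :: L) ↔ σ e = f ∧ Extends σ L := by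
  simp [Extends]

theorem extSum_eq_sum_cons (g : Equiv.Perm (HalfEdge n N) → M)
    (L : List (HalfEdge n N × HalfEdge n N)) (e : HalfEdge n N) :
    extSum g L = ∑ f, extSum g ((e, f) :: L) := by
  classical
  simp only [extSum, Finset.sum_filter]
  rw [Finset.sum_comm]
  refine Finset.sum_congr rfl fun σ _ => ?_
  rw [Finset.sum_eq_single (σ e)]
  · exact if_congr (by simp [extends_cons]) rfl rfl
  · intro f _ hf
    exact if_neg fun h => hf (extends_cons.1 h).1.symm
  · simp

theorem numCycles_of_isPlanarRegular {σ : Equiv.Perm (HalfEdge n N)} (h : IsPlanarRegular σ) :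
    2 * numCycles (rotation n N * σ) = 2 * n + 2 + N := by
  unfold IsPlanarRegular at h
  have : (Nat.card (Face σ) : ℤ) = (numCycles (rotation n N * σ) : ℤ) := rfl
  rw [this] at h
  omega

theorem mem_contractions {κ : Model} {σ : Equiv.Perm (HalfEdge n N)} :
    σ ∈ contractions κ n N ↔ IsContraction κ σ ∧ IsOnePI σ ∧ IsPlanarRegular σ := by
  simp [contractions]

/-- A planar contraction joins the first half-edge of a boundary word to an entry of the same word
or to a new vertex. -/
theorem IsState.partner {κ : Model} (hN : 0 < N) {k u : ℕ}
    {L : List (HalfEdge n N × HalfEdge n N)} {e : HalfEdge n N} {w : List (HalfEdge n N)}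
    {W : List (List (HalfEdge n N))} (h : IsState (k + 1) u L ((e :: w) :: W))
    {σ : Equiv.Perm (HalfEdge n N)} (hσ : σ ∈ contractions κ n N) (hext : Extends σ L)
    (hv : Visible (initial n u) (σ e)) : σ e ∈ w := by
  obtain ⟨hc, hp, hpl⟩ := mem_contractions.1 hσ
  have hmem := h.mem_words
  have he := (hmem e).1 (by simp)
  have hf := hext.apply_notMem hc.involutive h.nodup he.2
  have hne := hc.no_fixed_point e
  by_contra hcon
  have hns : ¬ (rotation n N * gluing L).SameCycle e (σ e) := fun hs => by
    have := mem_word_of_sameCycle (h.cyclic _ List.mem_cons_self) List.mem_cons_self hf hs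
    rcases List.mem_cons.1 this with h1 | h1
    · exact hne h1
    · exact hcon h1
  -- A partner in another word would merge two faces. The bound `numCycles_le` for the remaining
  -- pairs then falls short of the number of faces that planarity requires.
  have h1 := numCycles_mul_swap_lt hns
  have h2 := numCycles_le hN hc hp.1 k (initial n u) ((e, σ e) :: L)
    (by have := h.length_eq; simp only [List.length_cons]; omega)
    (by simp [he.2, hf, hne.symm, h.nodup])
    (by
      intro x hx
      simp only [ends_cons, List.mem_cons] at hx
      rcases hx with rfl | rfl | hx
      · exact he.1
      · exact hv
      · exact h.visible x hx)
    (by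
      intro p hp
      rcases List.mem_cons.1 hp with rfl | hp
      · rfl
      · exact hext p hp)
  rw [rotation_mul_gluing_cons, card_initial h.used_le] at h2
  have h3 := h.count
  have h4 := numCycles_of_isPlanarRegular hpl
  omega

/-- Each of the `n - u` unused vertices offers four equivalent positions in the real model; in the
complex model two are equivalent and the other two vanish by charge. -/
theorem sum_slots {κ : Model} (g : Fin n × Fin 4 → M) {u : ℕ} (hu : u < n) (i : Fin 4)
    (hg : ∀ (v : Fin n) (j : Fin 4), u ≤ (v : ℕ) →
      (κ = Model.complex → Even ((i - j : Fin 4) : ℕ)) →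
      g (v, j) = g (⟨u, hu⟩, i))
    (hg0 : ∀ (v : Fin n) (j : Fin 4), u ≤ (v : ℕ) → κ = Model.complex →
      ¬ Even ((i - j : Fin 4) : ℕ) → g (v, j) = 0) :
    ∑ h ∈ Finset.univ.filter fun h : Fin n × Fin 4 => u ≤ (h.1 : ℕ), g h =
      (κ.positions * (n - u)) • g (⟨u, hu⟩, i) := by
  have hprod : (Finset.univ.filter fun h : Fin n × Fin 4 => u ≤ (h.1 : ℕ)) =
      (Finset.univ.filter fun v : Fin n => u ≤ (v : ℕ)) ×ˢ (Finset.univ : Finset (Fin 4)) := by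
    ext h; simp
  have hcard : (Finset.univ.filter fun v : Fin n => u ≤ (v : ℕ)).card = n - u := by
    have h1 := Finset.card_filter_add_card_filter_not (s := (Finset.univ : Finset (Fin n)))
      (fun v : Fin n => (v : ℕ) < u)
    have h2 := card_initial hu.le
    simp only [initial] at h2
    simp only [not_lt, Finset.card_univ, Fintype.card_fin] at h1
    omega
  rw [hprod, Finset.sum_product]
  have hin : ∀ v ∈ Finset.univ.filter fun v : Fin n => u ≤ (v : ℕ),
      ∑ j, g (v, j) = κ.positions • g (⟨u, hu⟩, i) := by
    intro v hv
    have hv' : u ≤ (v : ℕ) := (Finset.mem_filter.1 hv).2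
    cases κ with
    | real =>
      rw [Finset.sum_congr rfl fun j _ => hg v j hv' (by simp)]
      simp [Model.positions]
    | complex =>
      have : ∀ j, g (v, j) = if Even ((i - j : Fin 4) : ℕ) then g (⟨u, hu⟩, i) else 0 := by
        intro j
        split_ifs with hj
        · exact hg v j hv' fun _ => hj
        · exact hg0 v j hv' rfl hj
      simp_rw [this]
      rw [← Finset.sum_filter, Finset.sum_const]
      have hc : ∀ i : Fin 4,
          (Finset.univ.filter fun j : Fin 4 => Even ((i - j : Fin 4) : ℕ)).card = 2 := by decide
      rw [hc i]
      rfl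
  rw [Finset.sum_congr rfl hin, Finset.sum_const, hcard, smul_smul, mul_comm]

end Relabel

/-! ### The enumeration computes sums over planar contractions -/

section ExploreSum

variable {n N : ℕ} {M : Type*} [AddCommMonoid M]

/-- Without open words the visible part is a closed graph: either it is everything, or its
extensions are disconnected and do not count. -/
theorem extSum_of_no_words {κ : Model} (hN : 0 < N) {g : Equiv.Perm (HalfEdge n N) → M}
    (hg0 : ∀ σ, σ ∉ contractions κ n N → g σ = 0) {k u : ℕ}
    {L : List (HalfEdge n N × HalfEdge n N)} (h : IsState k u L []) :
    extSum g L = if u = n then g (gluing L) else 0 := by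
  classical
  have hmem : ∀ x, Visible (initial n u) x → x ∈ ends L := fun x hx => by
    by_contra hcon
    simpa using (h.mem_words x).2 ⟨hx, hcon⟩
  split_ifs with hu
  · subst hu
    have hall : ∀ x, x ∈ ends L := fun x => hmem x (by
      rcases x with x | x
      · exact mem_initial.2 x.1.2
      · trivial)
    rw [extSum, Finset.sum_eq_single (gluing L)]
    · intro σ hσ hne
      refine hg0 σ fun hc => hne ?_
      exact (Finset.mem_filter.1 hσ).2.eq_gluing (mem_contractions.1 hc).1.involutive h.nodup hall
    · intro hL
      exact (hL (Finset.mem_filter.2 ⟨Finset.mem_univ _, fun p hp =>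
        (gluing_apply h.nodup hp).1⟩)).elim
  · refine extSum_eq_zero fun σ hσ => hg0 σ fun hc => hu ?_
    obtain ⟨hc, hp, -⟩ := mem_contractions.1 hc
    have := all_matched hN hc hp.1 h.nodup h.visible hσ hmem
    have h2 := card_initial h.used_le
    rw [this] at h2
    simpa using h2.symm

theorem sum_map_flatMap {α β : Type*} (l : List α) (F : α → List β) (φ : β → M) :
    ((l.flatMap F).map φ).sum = (l.map fun t => ((F t).map φ).sum).sum := by
  induction l with
  | nil => rfl
  | cons a l ih => simp [ih]

/-- `slot e` has the parity opposite to the position of `e`, hence the charge that the partner of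
`e` must carry. -/
theorem even_val_sub_slot {κ : Model} (hκ : κ = Model.complex)
    {σ : Equiv.Perm (HalfEdge n N)} (hσ : IsContraction κ σ) {e : HalfEdge n N} {v : Fin n}
    {j : Fin 4} (he : σ e = Sum.inl (v, j)) : Even ((slot e - j : Fin 4) : ℕ) := by
  have h1 := hσ.charge hκ e
  rw [he] at h1
  have h2 : ∀ j : Fin 4, ¬ Even (j : ℕ) → Even ((1 - j : Fin 4) : ℕ) := by decide
  have h3 : ∀ j : Fin 4, Even (j : ℕ) → Even ((0 - j : Fin 4) : ℕ) := by decide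
  rcases e with ⟨a, b⟩ | b <;> simp only [IsBar, slot] at h1 ⊢ <;> split_ifs with hb
  · exact h2 j fun hj => h1.1 hj (Nat.even_iff.2 hb)
  · exact h3 j (h1.2 fun hb' => hb (Nat.even_iff.1 hb'))
  · exact h2 j fun hj => h1.1 hj (Nat.even_iff.2 hb)
  · exact h3 j (h1.2 fun hb' => hb (Nat.even_iff.1 hb'))

/-- The sum of an invariant function over the planar contractions, in terms of the enumeration
`explore`. -/
theorem extSum_eq_explore {κ : Model} (hN : 0 < N) {g : Equiv.Perm (HalfEdge n N) → M}
    (hg0 : ∀ σ, σ ∉ contractions κ n N → g σ = 0) (hg : IsRelabelInvariant κ g) (k : ℕ) :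
    ∀ (u : ℕ) (L : List (HalfEdge n N × HalfEdge n N)) (W : List (List (HalfEdge n N))),
      IsState k u L W → extSum g L = (κ.positions ^ (n - u) * (n - u).factorial) •
        ((explore k u L W).map fun L' => g (gluing L')).sum := by
  have base : ∀ (k u : ℕ) (L : List (HalfEdge n N × HalfEdge n N)), IsState k u L [] →
      extSum g L = (κ.positions ^ (n - u) * (n - u).factorial) •
        ((if u = n then [L] else []).map fun L' => g (gluing L')).sum := by
    intro k u L h
    rw [extSum_of_no_words hN hg0 h]
    split_ifs with hu
    · subst hu; simp
    · simp
  induction k with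
  | zero =>
    intro u L W h
    match W with
    | [] => exact base 0 u L h
    | [] :: W => exact (h.nil_notMem List.mem_cons_self).elim
    | (e :: w) :: W =>
      refine extSum_eq_zero (fun σ hσ => hg0 σ fun hc => ?_) |>.trans (by simp [explore])
      have he := ((h.mem_words e).1 (by simp)).2
      have hc' := (mem_contractions.1 hc).1
      have := two_mul_length_le h.length_eq h.nodup he
        (hσ.apply_notMem hc'.involutive h.nodup he) (hc'.no_fixed_point e).symm
      omega
  | succ k ih =>
    intro u L W h
    match W with
    | [] => exact base (k + 1) u L h
    | [] :: W => exact (h.nil_notMem List.mem_cons_self).elim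
    | (e :: w) :: W =>
      classical
      have he := (h.mem_words e).1 (by simp)
      have hnd := h.words_nodup
      simp only [List.flatten_cons, List.cons_append, List.nodup_cons,
        List.nodup_append] at hnd
      have hwvis : ∀ f ∈ w, Visible (initial n u) f := fun f hf =>
        ((h.mem_words f).1 (by simp [hf])).1
      have hzero : ∀ f, Visible (initial n u) f → f ∉ w → extSum g ((e, f) :: L) = 0 := by
        intro f hf hfw
        refine extSum_eq_zero fun σ hσ => hg0 σ fun hc => hfw ?_
        obtain ⟨h1, h2⟩ := extends_cons.1 hσ
        rw [← h1]
        exact h.partner hN hc h2 (h1 ▸ hf)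
      have hlegs : ∀ f, e.isRight = true → f.isRight = true → extSum g ((e, f) :: L) = 0 := by
        rintro f h1 h2
        refine extSum_eq_zero fun σ hσ => hg0 σ fun hc => ?_
        obtain ⟨k, rfl⟩ := Sum.isRight_iff.1 h1
        obtain ⟨l, rfl⟩ := Sum.isRight_iff.1 h2
        exact (mem_contractions.1 hc).1.amputated k l (extends_cons.1 hσ).1
      -- Visible partners outside the word contribute nothing, by `IsState.partner`; what remains is
      -- the word itself and the unused vertices.
      have hsplit : extSum g L = (∑ f ∈ w.toFinset, extSum g ((e, f) :: L)) +
          ∑ h ∈ Finset.univ.filter fun h : Fin n × Fin 4 => u ≤ (h.1 : ℕ),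
            extSum g ((e, Sum.inl h) :: L) := by
        have hset : (Finset.univ.filter fun h : Fin n × Fin 4 => u ≤ (h.1 : ℕ)).map
            ⟨(Sum.inl : Fin n × Fin 4 → HalfEdge n N), Sum.inl_injective⟩ =
            Finset.univ.filter fun f => ¬ Visible (initial n u) f := by
          ext f
          rcases f with f | f <;> simp [Visible, mem_initial]
        have hmap : ∑ h ∈ Finset.univ.filter fun h : Fin n × Fin 4 => u ≤ (h.1 : ℕ),
            extSum g ((e, Sum.inl h) :: L) =
            ∑ f ∈ Finset.univ.filter fun f => ¬ Visible (initial n u) f,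
              extSum g ((e, f) :: L) := by
          rw [← hset, Finset.sum_map]
          rfl
        rw [extSum_eq_sum_cons g L e, hmap,
          ← Finset.sum_filter_add_sum_filter_not Finset.univ (Visible (initial n u))]
        congr 1
        refine (Finset.sum_subset (fun f hf => ?_) fun f hf hf' => ?_).symm
        · exact Finset.mem_filter.2 ⟨Finset.mem_univ _, hwvis f (List.mem_toFinset.1 hf)⟩
        · exact hzero f (Finset.mem_filter.1 hf).2 fun hw => hf' (List.mem_toFinset.2 hw)
      have hw : ∑ f ∈ w.toFinset, extSum g ((e, f) :: L) =
          (κ.positions ^ (n - u) * (n - u).factorial) •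
            (((splits [] w).flatMap fun t =>
              if e.isRight && t.2.1.isRight then []
              else explore k u ((e, t.2.1) :: L) (consWord t.1 (consWord t.2.2 W))).map
                fun L' => g (gluing L')).sum := by
        have hwn : w.Nodup := hnd.2.1
        have e1 : ∑ f ∈ w.toFinset, extSum g ((e, f) :: L) =
            ((splits [] w).map fun t => extSum g ((e, t.2.1) :: L)).sum := by
          rw [List.sum_toFinset _ hwn]
          conv_lhs => rw [← splits_map [] w]
          rw [List.map_map]
          rfl
        rw [e1, sum_map_flatMap, List.smul_sum, List.map_map]
        congr 1
        refine List.map_congr_left fun t ht => ?_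
        simp only [Function.comp]
        split_ifs with hr
        · rw [Bool.and_eq_true] at hr
          rw [hlegs _ hr.1 hr.2]; simp
        · have hwt : w = t.1 ++ t.2.1 :: t.2.2 := by simpa using eq_of_mem_splits ht
          exact ih u _ _ (IsState.split (by rw [← hwt]; exact h))
      rw [hsplit, hw, explore, List.map_append, List.sum_append, smul_add, add_comm]
      congr 1
      split_ifs with hu
      -- The multiplicity `positions * (n - u)` of this step is the new factor in `positions ^ (n -
      -- u) * (n - u)!`.
      · rw [sum_slots (κ := κ) (fun h => extSum g ((e, Sum.inl h) :: L)) hu (slot e),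
          ih (u + 1) _ _ (h.discover hu (slot e)), smul_smul]
        · congr 1
          obtain ⟨m, hm⟩ : ∃ m, n - u = m + 1 := ⟨n - u - 1, by omega⟩
          have hm' : n - (u + 1) = m := by omega
          rw [hm, hm', Nat.factorial_succ, pow_succ]
          ring
        · intro v j hv hj
          exact extSum_relabel hg h.visible he.1 hv le_rfl hj
        · intro v j hv hκ hj
          refine extSum_eq_zero fun σ hσ => hg0 σ fun hc => hj ?_
          exact even_val_sub_slot hκ (mem_contractions.1 hc).1 (extends_cons.1 hσ).1
      · rw [Finset.sum_eq_zero]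
        · simp
        · intro x hx
          have := (Finset.mem_filter.1 hx).2
          have := x.1.2
          omega

end ExploreSum

/-! ### The enumeration from the start -/

section Initial

variable {n N : ℕ}

/-- The external legs, in cyclic order. -/
def legs (n N : ℕ) : List (HalfEdge n N) := (List.finRange N).map Sum.inr

theorem rotation_inr [NeZero N] (k : Fin N) :
    rotation n N (Sum.inr k) = Sum.inr (k + 1) := by
  simp only [rotation, Equiv.sumCongr_apply, Sum.map_inr, finRotate_apply]

/-- Before any gluing the cycles are the vertices and the circle of legs; only the upper bound
matters, so representatives suffice. -/
theorem numCycles_rotation_le (hN : N = 2 ∨ N = 4) : numCycles (rotation n N) ≤ n + 1 := by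
  have : NeZero N := ⟨by omega⟩
  have hleg : ∀ k : Fin N, (rotation n N).SameCycle (Sum.inr 0) (Sum.inr k) := by
    have h1 : ∀ k : Fin N, (rotation n N).SameCycle (Sum.inr 0) (Sum.inr k) →
        (rotation n N).SameCycle (Sum.inr 0) (Sum.inr (k + 1)) := fun k hk => by
      rw [← rotation_inr]; exact Equiv.Perm.sameCycle_apply_right.2 hk
    have h0 := Equiv.Perm.SameCycle.refl (rotation n N) (Sum.inr 0)
    rcases hN with rfl | rfl
    · intro k; fin_cases k
      · exact h0
      · exact h1 _ h0
    · intro k; fin_cases k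
      · exact h0
      · exact h1 _ h0
      · exact h1 _ (h1 _ h0)
      · exact h1 _ (h1 _ (h1 _ h0))
  have hvert : ∀ (v : Fin n) (k : Fin 4),
      (rotation n N).SameCycle (Sum.inl (v, 0)) (Sum.inl (v, k)) := by
    intro v
    have h1 : ∀ k : Fin 4, (rotation n N).SameCycle (Sum.inl (v, 0)) (Sum.inl (v, k)) →
        (rotation n N).SameCycle (Sum.inl (v, 0)) (Sum.inl (v, k + 1)) := fun k hk => by
      rw [← rotation_inl]; exact Equiv.Perm.sameCycle_apply_right.2 hk
    have h0 := Equiv.Perm.SameCycle.refl (rotation n N) (Sum.inl (v, 0))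
    intro k; fin_cases k
    · exact h0
    · exact h1 _ h0
    · exact h1 _ (h1 _ h0)
    · exact h1 _ (h1 _ (h1 _ h0))
  let Φ : Option (Fin n) → Quotient (Equiv.Perm.SameCycle.setoid (rotation n N)) := fun o =>
    o.elim (Quotient.mk _ (Sum.inr 0)) fun v => Quotient.mk _ (Sum.inl (v, 0))
  have hΦ : Function.Surjective Φ := by
    intro y
    induction y using Quotient.inductionOn with
    | h x =>
      rcases x with ⟨v, k⟩ | k
      · exact ⟨some v, Quotient.sound (hvert v k)⟩
      · exact ⟨none, Quotient.sound (hleg k)⟩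
  simpa [numCycles] using Nat.card_le_card_of_surjective Φ hΦ

/-- The number of missing pairs is half of `4 * n + N`, and the only boundary word is the circle of
legs. -/
theorem isState_initial (hN : N = 2 ∨ N = 4) :
    IsState (2 * n + N / 2) 0 [] [legs n N] := by
  have : NeZero N := ⟨by omega⟩
  refine ⟨by simp; omega, Nat.zero_le _, by simp, by simp, ?_, ?_, ?_, ?_, ?_⟩
  · simpa [legs] using (List.nodup_finRange N).map Sum.inr_injective
  · rintro (x | x) <;> simp [legs, Visible, mem_initial]
  · intro w hw
    have hw' : w = legs n N := by simpa using hw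
    subst hw'
    have hf : ∀ k : Fin N, Follows (rotation n N * gluing []) (· ∈ ends [])
        (Sum.inr k : HalfEdge n N) (Sum.inr (k + 1)) := fun k => by
      have := Follows.one (τ := rotation n N * gluing []) (E := (· ∈ ends []))
        (Sum.inr k : HalfEdge n N)
      rwa [gluing, mul_one, rotation_inr, ← mul_one (rotation n N)] at this
    rcases hN with rfl | rfl
    · simpa [legs, List.finRange_succ, IsCyclicWord] using And.intro (hf 0) (hf 1)
    · simpa [legs, List.finRange_succ, IsCyclicWord] using
        And.intro (hf 0) (And.intro (hf 1) (And.intro (hf 2) (hf 3)))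
  · have := numCycles_rotation_le (n := n) hN
    simp only [gluing, mul_one]
    omega
  · rcases hN with rfl | rfl <;> simp [legs, List.finRange_succ]

/-- The planar contractions, up to relabeling of vertices. -/
def leaves (n N : ℕ) : List (List (HalfEdge n N × HalfEdge n N)) :=
  explore (2 * n + N / 2) 0 [] [legs n N]

theorem sum_contractions_eq_leaves {M : Type*} [AddCommMonoid M] {κ : Model}
    (hN : N = 2 ∨ N = 4) {g : Equiv.Perm (HalfEdge n N) → M}
    (hg0 : ∀ σ, σ ∉ contractions κ n N → g σ = 0) (hg : IsRelabelInvariant κ g) :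
    ∑ σ ∈ contractions κ n N, g σ =
      (κ.positions ^ n * n.factorial) • ((leaves n N).map fun L => g (gluing L)).sum := by
  classical
  have h := extSum_eq_explore (by omega) hg0 hg _ 0 [] [legs n N] (isState_initial hN)
  rw [Nat.sub_zero] at h
  rw [leaves, ← h, extSum]
  refine Finset.sum_subset (fun σ _ => ?_) fun σ _ hσ => hg0 σ hσ
  simp [Extends]

end Initial

/-! ### Amplitudes in terms of a labelling of the faces -/

section Labels

variable {n N : ℕ}

theorem faceOf_eq_iff {σ : Equiv.Perm (HalfEdge n N)} {h h' : HalfEdge n N} :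
    faceOf σ h = faceOf σ h' ↔ (rotation n N * σ).SameCycle h h' :=
  Quotient.eq

/-- `h` belongs to an internal line of `σ`. -/
def OnLine (σ : Equiv.Perm (HalfEdge n N)) (h : HalfEdge n N) : Prop :=
  h.isLeft = true ∧ (σ h).isLeft = true

/-- `h` is the smaller half-edge of an internal line. -/
def IsSmaller (σ : Equiv.Perm (HalfEdge n N)) (h : HalfEdge n N) : Prop :=
  ∃ a b : Fin n × Fin 4, h = Sum.inl a ∧ σ h = Sum.inl b ∧ toLex a < toLex b

/-- `T` contains exactly one half-edge of each internal line. -/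
def IsTransversal (σ : Equiv.Perm (HalfEdge n N)) (T : HalfEdge n N → Prop) : Prop :=
  ∀ h, OnLine σ h → (T (σ h) ↔ ¬ T h)

theorem isTransversal_isSmaller {κ : Model} {σ : Equiv.Perm (HalfEdge n N)}
    (hσ : IsContraction κ σ) : IsTransversal σ (IsSmaller σ) := by
  rintro h ⟨h1, h2⟩
  obtain ⟨a, rfl⟩ := Sum.isLeft_iff.1 h1
  obtain ⟨b, hb⟩ := Sum.isLeft_iff.1 h2
  have hba : σ (Sum.inl b) = Sum.inl a := by rw [← hb, hσ.involutive]
  have hne : a ≠ b := fun h => hσ.no_fixed_point (Sum.inl a) (by rw [hb, h])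
  have e1 : IsSmaller σ (Sum.inl a) ↔ toLex a < toLex b := by
    constructor
    · rintro ⟨a', b', h3, h4, h5⟩
      rw [hb] at h4
      rwa [Sum.inl.inj h3, Sum.inl.inj h4]
    · exact fun h => ⟨a, b, rfl, hb, h⟩
  have e2 : IsSmaller σ (Sum.inl b) ↔ toLex b < toLex a := by
    constructor
    · rintro ⟨a', b', h3, h4, h5⟩
      rw [hba] at h4
      rwa [Sum.inl.inj h3, Sum.inl.inj h4]
    · exact fun h => ⟨b, a, rfl, hba, h⟩
  rw [hb, e1, e2, not_lt]
  exact ⟨fun h => h.le, fun h => lt_of_le_of_ne h fun h' => hne (toLex.injective h').symm⟩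

-- Which end represents a line is irrelevant for a function that agrees at both ends: the bijection
-- switches to the other end where necessary.
open scoped Classical in
theorem prod_transversal {M : Type*} [CommMonoid M] {σ : Equiv.Perm (HalfEdge n N)}
    (hσ : ∀ h, σ (σ h) = h) {T T' : HalfEdge n N → Prop} (hT : IsTransversal σ T)
    (hT' : IsTransversal σ T') {φ : HalfEdge n N → M} (hφ : ∀ h, φ (σ h) = φ h) :
    ∏ h ∈ Finset.univ.filter (fun h => OnLine σ h ∧ T h), φ h =
      ∏ h ∈ Finset.univ.filter (fun h => OnLine σ h ∧ T' h), φ h := by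
  have hon : ∀ h, OnLine σ h → OnLine σ (σ h) := fun h hh => ⟨hh.2, by rw [hσ]; exact hh.1⟩
  refine Finset.prod_bij' (fun h _ => if T' h then h else σ h)
    (fun h _ => if T h then h else σ h) ?_ ?_ ?_ ?_ ?_
  · intro h hh
    simp only [Finset.mem_filter, Finset.mem_univ, true_and] at hh ⊢
    split_ifs with h1
    · exact ⟨hh.1, h1⟩
    · exact ⟨hon h hh.1, (hT' h hh.1).2 h1⟩
  · intro h hh
    simp only [Finset.mem_filter, Finset.mem_univ, true_and] at hh ⊢
    split_ifs with h1
    · exact ⟨hh.1, h1⟩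
    · exact ⟨hon h hh.1, (hT h hh.1).2 h1⟩
  · intro h hh
    simp only [Finset.mem_filter, Finset.mem_univ, true_and] at hh
    have h1 := hT h hh.1
    by_cases h2 : T' h
    · simp only [h2, if_true, hh.2]
    · simp only [h2, if_false, h1.not.2 (not_not.2 hh.2), hσ]
  · intro h hh
    simp only [Finset.mem_filter, Finset.mem_univ, true_and] at hh
    have h1 := hT' h hh.1
    by_cases h2 : T h
    · simp only [h2, if_true, hh.2]
    · simp only [h2, if_false, h1.not.2 (not_not.2 hh.2), hσ]
  · intro h _
    split_ifs
    · rfl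
    · exact (hφ h).symm

open scoped Classical in
theorem amplitude_eq (θ : ℝ) (B : ℕ → ℝ⟦X⟧) (σ : Equiv.Perm (HalfEdge n N)) (x : Fin N → ℝ)
    (m : {F : Face σ // IsInternal σ F} → ℕ × ℕ) :
    amplitude θ B σ x m = ∏ h ∈ Finset.univ.filter (fun h => OnLine σ h ∧ IsSmaller σ h),
      propagator θ B σ x m (faceOf σ h) (faceOf σ (σ h)) := by
  rw [Finset.prod_filter, Fintype.prod_sum_type]
  have : ∀ k : Fin N, (if OnLine σ (Sum.inr k) ∧ IsSmaller σ (Sum.inr k) then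
      propagator θ B σ x m (faceOf σ (Sum.inr k)) (faceOf σ (σ (Sum.inr k))) else 1) = 1 :=
    fun k => if_neg fun h => by simpa [OnLine] using h.1.1
  rw [Finset.prod_congr rfl fun k _ => this k, Finset.prod_const_one, mul_one]
  refine Finset.prod_congr rfl fun h _ => ?_
  rcases hs : σ (Sum.inl h) with h' | k
  · simp only
    refine if_congr ?_ rfl rfl
    constructor
    · exact fun hlt => ⟨⟨rfl, by rw [hs]; rfl⟩, h, h', rfl, hs, hlt⟩
    · rintro ⟨-, a, b, h1, h2, h3⟩
      rw [hs] at h2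
      rwa [Sum.inl.inj h1, Sum.inl.inj h2]
  · simp only
    rw [if_neg]
    rintro ⟨h1, -⟩
    rw [OnLine, hs] at h1
    simpa using h1.2

/-- The propagator of a line between two faces with internal values `s, s'` and external values
`y, y'`. -/
def lineFactor (θ : ℝ) (B : ℕ → ℝ⟦X⟧) (s s' : ℕ) (y y' : ℝ) : ℝ⟦X⟧ :=
  PowerSeries.C (1 / ((4 * Real.pi) ^ 2 * θ)) *
    (B (max s s') + PowerSeries.C ((s + y) + (s' + y')))⁻¹

theorem lineFactor_comm (θ : ℝ) (B : ℕ → ℝ⟦X⟧) (s s' : ℕ) (y y' : ℝ) :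
    lineFactor θ B s s' y y' = lineFactor θ B s' s y' y := by
  rw [lineFactor, lineFactor, max_comm, add_comm ((s : ℝ) + y)]

open scoped Classical in
/-- The sum of the amplitudes of a contraction over the values of its internal faces, in terms of a
labelling `ℓ` of the faces by elements of a type `Λ` and of a labelling `ι` of the internal faces
by elements of a type `J`. -/
theorem sum_amplitude_eq {κ : Model} {σ : Equiv.Perm (HalfEdge n N)} (hσ : IsContraction κ σ)
    (θ : ℝ) (lo hi : ℕ) (B : ℕ → ℝ⟦X⟧) (x : Fin N → ℝ) {Λ J : Type*} [Fintype J]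
    [DecidableEq J]
    (ℓ : HalfEdge n N → Λ) (hℓ : ∀ h h', ℓ h = ℓ h' ↔ faceOf σ h = faceOf σ h')
    (ι : J → Λ) (hι : Function.Injective ι) (hιr : ∀ j, ∃ h, ℓ h = ι j)
    (hιi : ∀ h, (∃ j, ι j = ℓ h) ↔ ∀ k, ℓ h ≠ ℓ (Sum.inr k))
    {T : HalfEdge n N → Prop} (hT : IsTransversal σ T) (S : (J → ℕ × ℕ) → Λ → ℕ)
    (hS : ∀ m j, S m (ι j) = size (m j)) (hS0 : ∀ m k, S m (ℓ (Sum.inr k)) = 0)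
    (V : Λ → ℝ) (hV : ∀ h, V (ℓ h) = ∑ k, if ℓ h = ℓ (Sum.inr k) then x k else 0) :
    ∑ m ∈ Fintype.piFinset fun _ : {F : Face σ // IsInternal σ F} => indices lo hi,
        amplitude θ B σ x m =
      ∑ m ∈ Fintype.piFinset fun _ : J => indices lo hi,
        ∏ h ∈ Finset.univ.filter (fun h => OnLine σ h ∧ T h),
          lineFactor θ B (S m (ℓ h)) (S m (ℓ (σ h))) (V (ℓ h)) (V (ℓ (σ h))) := by
  have hrep : ∀ F : Face σ, ∃ h, faceOf σ h = F := fun F => Quotient.exists_rep F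
  choose rep hrep using hrep
  have hint : ∀ F : Face σ, IsInternal σ F ↔ ∃ j, ι j = ℓ (rep F) := by
    intro F
    rw [hιi]
    refine forall_congr' fun k => not_congr ?_
    rw [hℓ, hrep]
  -- `ψ` names the internal faces by `J`; as a bijection it turns the sum over values of faces into
  -- the sum over functions on `J`.
  choose ψ hψ using fun F : {F : Face σ // IsInternal σ F} => (hint F.1).1 F.2
  have hψb : Function.Bijective ψ := by
    constructor
    · intro F F' h
      have h1 : ℓ (rep F.1) = ℓ (rep F'.1) := by rw [← hψ, ← hψ, h]
      rw [hℓ, hrep, hrep] at h1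
      exact Subtype.ext h1
    · intro j
      obtain ⟨h, hh⟩ := hιr j
      have h1 : ℓ (rep (faceOf σ h)) = ℓ h := (hℓ _ _).2 (hrep _)
      refine ⟨⟨faceOf σ h, (hint _).2 ⟨j, by rw [h1, hh]⟩⟩, hι ?_⟩
      rw [hψ, h1, hh]
  let e := Equiv.ofBijective ψ hψb
  refine Finset.sum_equiv (Equiv.arrowCongr e (Equiv.refl _)) (fun m => ?_) (fun m _ => ?_)
  · simp only [Fintype.mem_piFinset, Equiv.arrowCongr_apply, Function.comp, Equiv.refl_apply]
    exact ⟨fun h j => h _, fun h F => by simpa using h (e F)⟩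
  · set m' := Equiv.arrowCongr e (Equiv.refl _) m with hm'
    have hscale : ∀ h, scale σ m (faceOf σ h) = S m' (ℓ h) := by
      intro h
      have h1 : ℓ (rep (faceOf σ h)) = ℓ h := (hℓ _ _).2 (hrep _)
      unfold scale
      split_ifs with hF
      · rw [← h1, ← hψ ⟨faceOf σ h, hF⟩, hS]
        have : m' (ψ ⟨faceOf σ h, hF⟩) = m ⟨faceOf σ h, hF⟩ := by
          simp only [hm', Equiv.arrowCongr_apply, Function.comp, Equiv.refl_apply]
          congr 1
          exact e.symm_apply_apply _
        rw [this]
      · rw [hint, h1, hιi] at hF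
        push Not at hF
        obtain ⟨k, hk⟩ := hF
        rw [hk, hS0]
    have hvalue : ∀ h, faceValue σ x m (faceOf σ h) = S m' (ℓ h) + V (ℓ h) := by
      intro h
      rw [faceValue, hscale, hV]
      congr 1
      refine Finset.sum_congr rfl fun k _ => if_congr (hℓ _ _).symm rfl rfl
    have hprop : ∀ h, propagator θ B σ x m (faceOf σ h) (faceOf σ (σ h)) =
        lineFactor θ B (S m' (ℓ h)) (S m' (ℓ (σ h))) (V (ℓ h)) (V (ℓ (σ h))) := by
      intro h
      rw [propagator, lineFactor, hscale, hscale, hvalue, hvalue]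
    rw [amplitude_eq, prod_transversal hσ.involutive (isTransversal_isSmaller hσ) hT]
    · exact Finset.prod_congr rfl fun h _ => hprop h
    · intro h
      rw [hprop, hprop, hσ.involutive, lineFactor_comm]

end Labels

/-! ### Invariance under relabeling -/

section Invariance

variable {n N : ℕ}

/-- `π` is a symmetry of the vertices, with underlying permutation `s`, which fixes the legs. -/
structure IsVertexSymmetry (κ : Model) (π : Equiv.Perm (HalfEdge n N))
    (s : Equiv.Perm (Fin n)) : Prop where
  leg : ∀ k, π (Sum.inr k) = Sum.inr k
  rot : ∀ h, π (rotation n N h) = rotation n N (π h)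
  vertex : ∀ h : Fin n × Fin 4, ∃ l, π (Sum.inl h) = Sum.inl (s h.1, l)
  charge : κ = Model.complex → ∀ h, IsBar (π h) ↔ IsBar h

theorem IsVertexSymmetry.inv {κ : Model} {π : Equiv.Perm (HalfEdge n N)}
    {s : Equiv.Perm (Fin n)} (h : IsVertexSymmetry κ π s) : IsVertexSymmetry κ π⁻¹ s⁻¹ := by
  refine ⟨fun k => ?_, fun x => ?_, fun x => ?_, fun hκ x => ?_⟩
  · rw [Equiv.Perm.inv_eq_iff_eq, h.leg]
  · rw [Equiv.Perm.inv_eq_iff_eq, h.rot]; simp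
  · rcases hx : π⁻¹ (Sum.inl x) with y | k
    · obtain ⟨l, hl⟩ := h.vertex y
      rw [Equiv.Perm.inv_eq_iff_eq, hl] at hx
      have := Sum.inl.inj hx
      refine ⟨y.2, ?_⟩
      rw [this]
      simp
    · rw [Equiv.Perm.inv_eq_iff_eq, h.leg] at hx
      simp at hx
  · rw [← h.charge hκ]; simp

theorem isVertexSymmetry_relabel {κ : Model} {s : Equiv.Perm (Fin n)} {r : Fin n → Fin 4}
    (hr : κ = Model.complex → ∀ v, Even (r v : ℕ)) :
    IsVertexSymmetry κ (relabel (N := N) s r) s := by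
  refine ⟨fun k => rfl, fun x => ?_, fun x => ⟨_, rfl⟩, fun hκ x => ?_⟩
  · rcases x with ⟨v, k⟩ | k
    · rw [rotation_inl, relabel_inl, relabel_inl, rotation_inl]
      simp only
      rw [add_right_comm]
    · simp [rotation]
  · rcases x with ⟨v, k⟩ | k
    · have : ∀ k i : Fin 4, Even (i : ℕ) → (Even ((k + i : Fin 4) : ℕ) ↔ Even (k : ℕ)) := by
        decide
      exact this k _ (hr hκ v)
    · rfl

variable {κ : Model} {π : Equiv.Perm (HalfEdge n N)} {s : Equiv.Perm (Fin n)}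

theorem conj_apply_apply (π σ : Equiv.Perm (HalfEdge n N)) (h : HalfEdge n N) :
    (π * σ * π⁻¹) (π h) = π (σ h) := by
  simp

/-- `π` commutes with the rotation, so conjugating `σ` conjugates the whole face permutation. -/
theorem IsVertexSymmetry.sameCycle_iff (hπ : IsVertexSymmetry κ π s)
    (σ : Equiv.Perm (HalfEdge n N)) (h h' : HalfEdge n N) :
    (rotation n N * (π * σ * π⁻¹)).SameCycle (π h) (π h') ↔
      (rotation n N * σ).SameCycle h h' := by
  have : rotation n N * (π * σ * π⁻¹) = π * (rotation n N * σ) * π⁻¹ := by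
    have hc : π * rotation n N = rotation n N * π := Equiv.ext fun x => hπ.rot x
    rw [← mul_assoc, ← mul_assoc, ← mul_assoc, hc]
  rw [this, Equiv.Perm.sameCycle_conj]
  simp

theorem IsVertexSymmetry.isContraction (hπ : IsVertexSymmetry κ π s)
    {σ : Equiv.Perm (HalfEdge n N)} (hσ : IsContraction κ σ) :
    IsContraction κ (π * σ * π⁻¹) := by
  refine ⟨fun h => ?_, fun h => ?_, fun k l => ?_, fun hκ h => ?_⟩
  · simp [hσ.involutive]
  · obtain ⟨h, rfl⟩ := π.surjective h
    rw [conj_apply_apply]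
    exact fun he => hσ.no_fixed_point h (π.injective he)
  · rw [← hπ.leg k, ← hπ.leg l, conj_apply_apply]
    exact fun he => hσ.amputated k l (π.injective he)
  · obtain ⟨h, rfl⟩ := π.surjective h
    rw [conj_apply_apply, hπ.charge hκ, hπ.charge hκ, hσ.charge hκ]

theorem IsVertexSymmetry.isOnePI (hπ : IsVertexSymmetry κ π s)
    {σ : Equiv.Perm (HalfEdge n N)} (hσ : ∀ h, σ (σ h) = h) (hp : IsOnePI σ) :
    IsOnePI (π * σ * π⁻¹) := by
  have hn : 0 < n := by
    obtain ⟨v⟩ := hp.1.nonempty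
    exact v.pos
  choose ρ hρ using hπ.vertex
  -- A set of vertices is pulled back by `s`, where connectedness supplies a crossing line, and this
  -- line is pushed forward by `π`.
  have key : ∀ {D D' : Set (Fin n × Fin 4)},
      (∀ h, (s h.1, ρ h) ∈ D' → h ∈ D) → (lineGraph σ D).Connected →
      (lineGraph (π * σ * π⁻¹) D').Connected := by
    intro D D' hD hc
    refine connected_of_exists_crossing hn fun S hS hS' => ?_
    obtain ⟨v, hv⟩ := hS
    obtain ⟨w, hw⟩ := hS'
    obtain ⟨h, h', h1, h2, h3, h4, h5⟩ := exists_crossing_of_connected hσ hc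
      (S := {u | s u ∈ S}) (v := s⁻¹ v) (w := s⁻¹ w) (by simpa using hv) (by simpa using hw)
    refine ⟨(s h.1, ρ h), (s h'.1, ρ h'), h1, h2, ?_, fun hh => h4 (hD _ hh),
      fun hh => h5 (hD _ hh)⟩
    rw [← hρ, ← hρ, conj_apply_apply, h3]
  refine ⟨key (fun h hh => hh) hp.1, fun a b hab => ?_⟩
  obtain ⟨l, hl⟩ := hπ.inv.vertex a
  obtain ⟨l', hl'⟩ := hπ.inv.vertex b
  have h1 : σ (Sum.inl (s⁻¹ a.1, l)) = Sum.inl (s⁻¹ b.1, l') := by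
    rw [← hl, ← hl', ← hab]
    simp
  refine key (fun h hh => ?_) (hp.2 _ _ h1)
  have h2 : π (Sum.inl h) = Sum.inl a := by rw [hρ, Set.mem_singleton_iff.1 hh]
  have h3 : (Sum.inl h : HalfEdge n N) = Sum.inl (s⁻¹ a.1, l) := by
    rw [← hl, ← h2]; simp
  exact Sum.inl.inj h3

theorem IsVertexSymmetry.isPlanarRegular (hπ : IsVertexSymmetry κ π s)
    {σ : Equiv.Perm (HalfEdge n N)} (hσ : IsPlanarRegular σ) :
    IsPlanarRegular (π * σ * π⁻¹) := by
  have : Nat.card (Face σ) = Nat.card (Face (π * σ * π⁻¹)) :=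
    Nat.card_congr (Quotient.congr π fun h h' => (hπ.sameCycle_iff σ h h').symm)
  unfold IsPlanarRegular at hσ ⊢
  rw [← this]
  exact hσ

theorem IsVertexSymmetry.mem_contractions_conj (hπ : IsVertexSymmetry κ π s)
    {σ : Equiv.Perm (HalfEdge n N)} :
    π * σ * π⁻¹ ∈ contractions κ n N ↔ σ ∈ contractions κ n N := by
  have key : ∀ {π : Equiv.Perm (HalfEdge n N)} {s : Equiv.Perm (Fin n)}
      (_ : IsVertexSymmetry κ π s) {σ : Equiv.Perm (HalfEdge n N)},
      σ ∈ contractions κ n N → π * σ * π⁻¹ ∈ contractions κ n N := by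
    intro π s hπ σ hσ
    obtain ⟨h1, h2, h3⟩ := mem_contractions.1 hσ
    exact mem_contractions.2
      ⟨hπ.isContraction h1, hπ.isOnePI h1.involutive h2, hπ.isPlanarRegular h3⟩
  refine ⟨fun h => ?_, key hπ⟩
  have := key hπ.inv h
  simpa [mul_assoc] using this

-- The faces of `σ` can be labelled by those of its conjugate, by way of `π`; `sum_amplitude_eq`
-- then gives the amplitudes of the conjugate. The legs are fixed, so the external variables agree.
open scoped Classical in
theorem IsVertexSymmetry.sum_amplitude (hπ : IsVertexSymmetry κ π s)
    {σ : Equiv.Perm (HalfEdge n N)} (hσ : IsContraction κ σ) (θ : ℝ) (lo hi : ℕ)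
    (B : ℕ → ℝ⟦X⟧) (x : Fin N → ℝ) :
    ∑ m ∈ Fintype.piFinset fun _ : {F : Face (π * σ * π⁻¹) // IsInternal (π * σ * π⁻¹) F} =>
        indices lo hi, amplitude θ B (π * σ * π⁻¹) x m =
      ∑ m ∈ Fintype.piFinset fun _ : {F : Face σ // IsInternal σ F} => indices lo hi,
        amplitude θ B σ x m := by
  set σ' := π * σ * π⁻¹ with hσ'
  have hσ'c : IsContraction κ σ' := hπ.isContraction hσ
  have hconj : ∀ h, σ' (π h) = π (σ h) := conj_apply_apply π σ
  have hleft : ∀ h, (π h).isLeft = h.isLeft := by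
    rintro (h | h)
    · obtain ⟨l, hl⟩ := hπ.vertex h; rw [hl]; rfl
    · rw [hπ.leg]
  have hon : ∀ h, OnLine σ' (π h) ↔ OnLine σ h := fun h => by
    rw [OnLine, OnLine, hconj, hleft, hleft]
  rw [sum_amplitude_eq hσ θ lo hi B x (J := {F : Face σ' // IsInternal σ' F})
    (fun h => faceOf σ' (π h)) ?_ Subtype.val Subtype.val_injective ?_ ?_
    (T := fun h => IsSmaller σ' (π h)) ?_ (scale σ') ?_ ?_
    (fun F => ∑ k : Fin N, if F = faceOf σ' (Sum.inr k) then x k else 0) ?_]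
  · refine Finset.sum_congr rfl fun m _ => ?_
    rw [amplitude_eq]
    refine (Finset.prod_equiv π (fun h => ?_) fun h _ => ?_).symm
    · simp [hon]
    · rw [hconj]
      rfl
  · intro h h'
    rw [faceOf_eq_iff, faceOf_eq_iff]
    exact hπ.sameCycle_iff σ h h'
  · intro F
    obtain ⟨h, hh⟩ := Quotient.exists_rep F.1
    refine ⟨π⁻¹ h, ?_⟩
    simp only [← hh, Equiv.Perm.coe_inv, Equiv.apply_symm_apply]
    rfl
  · intro h
    simp only [hπ.leg]
    exact ⟨fun ⟨F, hF⟩ => hF ▸ F.2, fun hF => ⟨⟨_, hF⟩, rfl⟩⟩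
  · intro h hh
    change IsSmaller σ' (π (σ h)) ↔ _
    rw [← hconj]
    exact isTransversal_isSmaller hσ'c (π h) ((hon h).2 hh)
  · intro m F
    rw [scale, dif_pos F.2]
  · intro m k
    rw [scale, dif_neg]
    rw [hπ.leg]
    exact fun hF => hF k rfl
  · intro h
    simp only [hπ.leg]

open scoped Classical in
/-- The contribution of a permutation of the half-edges to the correlation functions. -/
def contribution (κ : Model) (θ : ℝ) (lo hi : ℕ) (B : ℕ → ℝ⟦X⟧) (x : Fin N → ℝ)
    (σ : Equiv.Perm (HalfEdge n N)) : ℝ⟦X⟧ :=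
  if σ ∈ contractions κ n N then
    ∑ m ∈ Fintype.piFinset fun _ : {F : Face σ // IsInternal σ F} => indices lo hi,
      amplitude θ B σ x m
  else 0

theorem isRelabelInvariant_contribution (κ : Model) (θ : ℝ) (lo hi : ℕ) (B : ℕ → ℝ⟦X⟧)
    (x : Fin N → ℝ) :
    IsRelabelInvariant κ (contribution (n := n) κ θ lo hi B x) := by
  intro s r hr σ
  have hπ := isVertexSymmetry_relabel (N := N) (s := s) hr
  unfold contribution
  by_cases hσ : σ ∈ contractions κ n N
  · rw [if_pos hσ, if_pos (hπ.mem_contractions_conj.2 hσ)]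
    exact hπ.sum_amplitude (mem_contractions.1 hσ).1 θ lo hi B x
  · rw [if_neg hσ, if_neg (hπ.mem_contractions_conj.not.2 hσ)]

open scoped Classical in
theorem sum_contractions_eq {κ : Model} (hN : N = 2 ∨ N = 4) (θ : ℝ) (lo hi : ℕ) (B : ℕ → ℝ⟦X⟧)
    (x : Fin N → ℝ) :
    ∑ σ ∈ contractions κ n N,
      ∑ m ∈ Fintype.piFinset fun _ : {F : Face σ // IsInternal σ F} => indices lo hi,
        amplitude θ B σ x m =
      (κ.positions ^ n * n.factorial) •
        ((leaves n N).map fun L => contribution κ θ lo hi B x (gluing L)).sum := by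
  rw [← sum_contractions_eq_leaves (g := contribution κ θ lo hi B x) hN (fun σ hσ => if_neg hσ)
    (isRelabelInvariant_contribution κ θ lo hi B x)]
  exact Finset.sum_congr rfl fun σ hσ => (if_pos hσ).symm

end Invariance

/-! ### Evaluation of the enumeration -/

section Leaf

variable {n N : ℕ}

/-- All functions `{0, …, m - 1} → Bool`, extended by `false`. -/
def boolFunctions : ℕ → List (ℕ → Bool)
  | 0 => [fun _ => false]
  | m + 1 => (boolFunctions m).flatMap fun f => [f, fun k => k == m || f k]

/-- The line `p` joins a vertex where `f` is true with one where `f` is false. -/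
def crosses (f : ℕ → Bool) : HalfEdge n N × HalfEdge n N → Bool
  | (Sum.inl a, Sum.inl b) => f a.1 != f b.1
  | _ => false

/-- The graph is one-particle irreducible: at least two lines leave each proper set of vertices. -/
def onePICheck (L : List (HalfEdge n N × HalfEdge n N)) : Bool :=
  (boolFunctions n).all fun f => (List.range n).all f || !(List.range n).any f ||
    Nat.ble 2 (L.filter (crosses f)).length

/-- The half-edges, numbered from `0` on. -/
def code : HalfEdge n N → ℕ
  | Sum.inl (v, k) => 4 * v + k
  | Sum.inr k => 4 * n + k

/-- The next half-edge in cyclic order. -/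
def next [NeZero N] : HalfEdge n N → HalfEdge n N
  | Sum.inl (v, k) => Sum.inl (v, k + 1)
  | Sum.inr k => Sum.inr (k + 1)

/-- The cyclic order in terms of `code`. -/
def nextCode (n N c : ℕ) : ℕ :=
  if Nat.blt c (4 * n) then 4 * (c / 4) + (c % 4 + 1) % 4 else 4 * n + (c - 4 * n + 1) % N

/-- The partner of `c` in a list of pairs. -/
def partnerCode : List (ℕ × ℕ) → ℕ → ℕ
  | [], c => c
  | p :: P, c => if p.1 == c then p.2 else if p.2 == c then p.1 else partnerCode P c

/-- Labels the half-edges along the face of `c`. -/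
def markFace (n N : ℕ) (P : List (ℕ × ℕ)) (l : ℕ) : ℕ → ℕ → List ℕ → List ℕ
  | 0, _, labs => labs
  | i + 1, c, labs =>
    if labs.getD c 0 == 0 then
      markFace n N P l i (nextCode n N (partnerCode P c)) (labs.set c l)
    else labs

/-- Labels the faces of the half-edges in a list, from `l` on. -/
def markFaces (n N : ℕ) (P : List (ℕ × ℕ)) : List ℕ → ℕ → List ℕ → List ℕ
  | [], _, labs => labs
  | c :: cs, l, labs =>
    if labs.getD c 0 == 0 then
      markFaces n N P cs (l + 1) (markFace n N P l (4 * n + N) c labs)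
    else markFaces n N P cs l labs

/-- The labels of the faces: the face of the `k`-th leg has the label `k + 1`, the other faces have
larger labels. -/
def faceLabels (L : List (HalfEdge n N × HalfEdge n N)) : List ℕ :=
  markFaces n N (L.map fun p => (code p.1, code p.2))
    ((List.range N).map (4 * n + ·) ++ List.range (4 * n)) 1 (List.replicate (4 * n + N) 0)

/-- The label of a half-edge. -/
def label (labs : List ℕ) (h : HalfEdge n N) : ℕ := labs.getD (code h) 0

/-- Parity of the position of a half-edge. -/
def position : HalfEdge n N → ℕ
  | Sum.inl (_, k) => k
  | Sum.inr k => k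

/-- `labs` is a labelling of the faces by `1, …, N + K`, and the charges are alternating. -/
def leafCheck [NeZero N] (K : ℕ) (labs : List ℕ) (L : List (HalfEdge n N × HalfEdge n N)) : Bool :=
  (L.all fun p => label labs (next p.1) == label labs p.2 &&
    label labs (next p.2) == label labs p.1 &&
    (Nat.ble 1 (label labs p.1) && Nat.ble (label labs p.1) (N + K) &&
      Nat.ble 1 (label labs p.2) && Nat.ble (label labs p.2) (N + K)) &&
    (position p.1 + position p.2) % 2 == 1 && (p.1.isLeft || p.2.isLeft)) &&
  ((List.range (N + K)).all fun j =>
    L.any fun p => label labs p.1 == j + 1 || label labs p.2 == j + 1) &&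
  (List.finRange N).all fun k => label labs (Sum.inr k : HalfEdge n N) == k + 1

/-- The internal lines, as pairs of labels of faces. -/
def internalLines (labs : List ℕ) (L : List (HalfEdge n N × HalfEdge n N)) : List (ℕ × ℕ) :=
  (L.filter fun p => p.1.isLeft && p.2.isLeft).map fun p =>
    (min (label labs p.1) (label labs p.2), max (label labs p.1) (label labs p.2))

/-- The internal lines of a one-particle irreducible leaf; `some none` indicates a failure. -/
def leafData [NeZero N] (K : ℕ) (L : List (HalfEdge n N × HalfEdge n N)) :
    Option (Option (List (ℕ × ℕ))) :=
  if onePICheck L then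
    if leafCheck K (faceLabels L) L then some (some (internalLines (faceLabels L) L))
    else some none
  else none

end Leaf

/-! ### Completeness of the leaves and correctness of the irreducibility test -/

section LeafSpec

variable {n N : ℕ}

theorem mem_explore_spec (k : ℕ) : ∀ (u : ℕ) (L : List (HalfEdge n N × HalfEdge n N))
    (W : List (List (HalfEdge n N))), IsState k u L W → ∀ L' ∈ explore k u L W,
      (ends L').Nodup ∧ ∀ x, x ∈ ends L' := by
  have base : ∀ (k u : ℕ) (L : List (HalfEdge n N × HalfEdge n N)), IsState k u L [] →
      ∀ L' ∈ (if u = n then [L] else []), (ends L').Nodup ∧ ∀ x, x ∈ ends L' := by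
    intro k u L h L' hL'
    split_ifs at hL' with hu
    · rw [List.mem_singleton.1 hL']
      refine ⟨h.nodup, fun x => ?_⟩
      by_contra hx
      have hv : Visible (initial n u) x := by
        rcases x with x | x
        · exact mem_initial.2 (hu ▸ x.1.2)
        · trivial
      simpa using (h.mem_words x).2 ⟨hv, hx⟩
    · simp at hL'
  induction k with
  | zero =>
    intro u L W h L' hL'
    match W with
    | [] => exact base 0 u L h L' hL'
    | _ :: _ => simp [explore] at hL'
  | succ k ih =>
    intro u L W h L' hL'
    match W with
    | [] => exact base (k + 1) u L h L' hL'
    | [] :: W => simp [explore] at hL'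
    | (e :: w) :: W =>
      rw [explore, List.mem_append] at hL'
      rcases hL' with hL' | hL'
      · split_ifs at hL' with hu
        · exact ih _ _ _ (h.discover hu (slot e)) L' hL'
        · simp at hL'
      · obtain ⟨t, ht, hL'⟩ := List.mem_flatMap.1 hL'
        split_ifs at hL' with hr
        · simp at hL'
        · have hwt : w = t.1 ++ t.2.1 :: t.2.2 := by simpa using eq_of_mem_splits ht
          exact ih _ _ _ (IsState.split (by rw [← hwt]; exact h)) L' hL'

theorem exists_mem_boolFunctions (m : ℕ) (S : ℕ → Bool) :
    ∃ f ∈ boolFunctions m, ∀ k < m, f k = S k := by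
  induction m with
  | zero => exact ⟨_, List.mem_singleton_self _, by simp⟩
  | succ m ih =>
    obtain ⟨f, hf, hfS⟩ := ih
    have hfm : ∀ k < m + 1, k ≠ m → f k = S k := fun k hk hkm => hfS k (by omega)
    rcases hS : S m || f m with _ | _
    · rw [Bool.or_eq_false_iff] at hS
      refine ⟨f, List.mem_flatMap.2 ⟨f, hf, by simp⟩, fun k hk => ?_⟩
      by_cases hkm : k = m
      · rw [hkm, hS.1, hS.2]
      · exact hfm k hk hkm
    · rcases hSm : S m with _ | _
      -- Functions in the list vanish beyond their range, so `f m` cannot be true when `S m` is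
      -- false.
      · have hfm' : ∀ (j : ℕ), ∀ f ∈ boolFunctions j, ∀ k, j ≤ k → f k = false := by
          intro j
          induction j with
          | zero => intro f hf k _; rw [List.mem_singleton.1 hf]
          | succ j ihj =>
            intro f hf k hk
            obtain ⟨f', hf', hf⟩ := List.mem_flatMap.1 hf
            have := ihj f' hf' k (by omega)
            rcases List.mem_cons.1 hf with rfl | hf
            · exact this
            · rw [List.mem_singleton.1 hf]
              simp only [this, Bool.or_false, beq_eq_false_iff_ne]
              omega
        rw [hSm, hfm' m f hf m le_rfl] at hS
        simp at hS
      · refine ⟨_, List.mem_flatMap.2 ⟨f, hf, List.mem_cons_of_mem _ (List.mem_singleton_self _)⟩,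
          fun k hk => ?_⟩
        by_cases hkm : k = m
        · simp [hkm, hSm]
        · simp [hkm, hfm k hk hkm]

theorem crosses_iff {f : ℕ → Bool} {p : HalfEdge n N × HalfEdge n N} :
    crosses f p = true ↔ ∃ a b : Fin n × Fin 4, p = (Sum.inl a, Sum.inl b) ∧ f a.1 ≠ f b.1 := by
  constructor
  · intro h
    rcases p with ⟨a | a, b | b⟩
    · exact ⟨a, b, rfl, by simpa [crosses] using h⟩
    all_goals simp [crosses] at h
  · rintro ⟨a, b, rfl, hab⟩
    simpa [crosses] using hab

theorem exists_pair_of_gluing {L : List (HalfEdge n N × HalfEdge n N)} (hL : (ends L).Nodup)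
    (hall : ∀ x, x ∈ ends L) {h h' : HalfEdge n N} (hh : gluing L h = h') :
    (h, h') ∈ L ∨ (h', h) ∈ L := by
  obtain ⟨p, hp, rfl | rfl⟩ := mem_ends.1 (hall h)
  · rw [(gluing_apply hL hp).1] at hh; rw [← hh]; exact Or.inl hp
  · rw [(gluing_apply hL hp).2] at hh; rw [← hh]; exact Or.inr hp

theorem gluing_involutive {L : List (HalfEdge n N × HalfEdge n N)} (hL : (ends L).Nodup)
    (hall : ∀ x, x ∈ ends L) (h : HalfEdge n N) : gluing L (gluing L h) = h := by
  obtain ⟨p, hp, rfl | rfl⟩ := mem_ends.1 (hall h)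
  · rw [(gluing_apply hL hp).1, (gluing_apply hL hp).2]
  · rw [(gluing_apply hL hp).2, (gluing_apply hL hp).1]

theorem nodup_of_nodup_ends {L : List (HalfEdge n N × HalfEdge n N)} (hL : (ends L).Nodup) :
    L.Nodup := by
  induction L with
  | nil => exact List.nodup_nil
  | cons p L ih =>
    simp only [ends_cons, List.nodup_cons, List.mem_cons, not_or] at hL
    exact List.nodup_cons.2
      ⟨fun hp => hL.1.2 (mem_ends.2 ⟨p, hp, Or.inl rfl⟩), ih hL.2.2⟩

theorem eq_of_common_end {L : List (HalfEdge n N × HalfEdge n N)} (hL : (ends L).Nodup)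
    {p q : HalfEdge n N × HalfEdge n N} (hp : p ∈ L) (hq : q ∈ L) {h : HalfEdge n N}
    (h1 : h = p.1 ∨ h = p.2) (h2 : h = q.1 ∨ h = q.2) : p = q := by
  induction L with
  | nil => simp at hp
  | cons r L ih =>
    simp only [ends_cons, List.nodup_cons, List.mem_cons, not_or] at hL
    have key : ∀ s ∈ L, (h = s.1 ∨ h = s.2) → ¬ (h = r.1 ∨ h = r.2) := by
      rintro s hs hhs (rfl | rfl)
      · exact hL.1.2 (mem_ends.2 ⟨s, hs, hhs⟩)
      · exact hL.2.1 (mem_ends.2 ⟨s, hs, hhs⟩)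
    rcases List.mem_cons.1 hp with rfl | hp' <;> rcases List.mem_cons.1 hq with rfl | hq'
    · rfl
    · exact (key q hq' h2 h1).elim
    · exact (key p hp' h1 h2).elim
    · exact ih hL.2.2 hp' hq'

/-- Surviving the removal of any one line means that no cut consists of fewer than two lines. -/
theorem isOnePI_gluing_iff {L : List (HalfEdge n N × HalfEdge n N)} (hn : 0 < n)
    (hL : (ends L).Nodup) (hall : ∀ x, x ∈ ends L) :
    IsOnePI (gluing L) ↔ onePICheck L = true := by
  have hinv := gluing_involutive hL hall
  have hcheck : onePICheck L = true ↔ ∀ f ∈ boolFunctions n,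
      (∃ v : Fin n, f v = true) → (∃ v : Fin n, f v = false) →
        2 ≤ (L.filter (crosses f)).length := by
    simp only [onePICheck, List.all_eq_true, Bool.or_eq_true, Bool.not_eq_true',
      List.any_eq_false, List.mem_range, Nat.ble_eq, Bool.not_eq_true]
    refine forall₂_congr fun f _ => ⟨fun h h1 h2 => ?_, fun h => ?_⟩
    · obtain ⟨v, hv⟩ := h1
      obtain ⟨w, hw⟩ := h2
      rcases h with (h | h) | h
      · rw [h w w.2] at hw; simp at hw
      · rw [h v v.2] at hv; simp at hv
      · exact h
    · by_cases h1 : ∃ v : Fin n, f v = true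
      · by_cases h2 : ∃ v : Fin n, f v = false
        · exact Or.inr (h h1 h2)
        · push Not at h2
          exact Or.inl (Or.inl fun v hv => by simpa using h2 ⟨v, hv⟩)
      · push Not at h1
        exact Or.inl (Or.inr fun v hv => by simpa using h1 ⟨v, hv⟩)
  have hpair : ∀ {f : ℕ → Bool} {a b : Fin n × Fin 4}, f a.1 = true → f b.1 = false →
      gluing L (Sum.inl a) = Sum.inl b → ∃ p ∈ L.filter (crosses f),
        (Sum.inl a = p.1 ∨ Sum.inl a = p.2) ∧ (Sum.inl b = p.1 ∨ Sum.inl b = p.2) := by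
    intro f a b ha hb hab
    rcases exists_pair_of_gluing hL hall hab with h | h
    · exact ⟨_, List.mem_filter.2 ⟨h, crosses_iff.2 ⟨a, b, rfl, by simp [ha, hb]⟩⟩,
        Or.inl rfl, Or.inr rfl⟩
    · exact ⟨_, List.mem_filter.2 ⟨h, crosses_iff.2 ⟨b, a, rfl, by simp [ha, hb]⟩⟩,
        Or.inr rfl, Or.inl rfl⟩
  rw [hcheck]
  constructor
  · rintro ⟨hc, hcut⟩ f - ⟨v, hv⟩ ⟨w, hw⟩
    obtain ⟨a, b, h1, h2, h3, -, -⟩ := exists_crossing_of_connected hinv hc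
      (S := {u | f u = true}) (w := w) hv (by simp [hw])
    obtain ⟨p, hp, hpa, -⟩ := hpair h1 (by simpa using h2) h3
    obtain ⟨c, d, h4, h5, h6, h7, h8⟩ := exists_crossing_of_connected hinv (hcut a b h3)
      (S := {u | f u = true}) (w := w) hv (by simp [hw])
    obtain ⟨q, hq, hqc, hqd⟩ := hpair h4 (by simpa using h5) h6
    -- `q` crosses the same cut after the line of `a` has been removed, so it is a second line.
    have hpq : p ≠ q := by
      rintro rfl
      have : (Sum.inl a : HalfEdge n N) = Sum.inl c ∨ (Sum.inl a : HalfEdge n N) = Sum.inl d := by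
        have hcd : (Sum.inl c : HalfEdge n N) ≠ Sum.inl d := fun h => by
          have h' := Sum.inl.inj h
          rw [h'] at h4
          exact h5 h4
        rcases hpa with h | h <;> rcases hqc with h' | h' <;> rcases hqd with h'' | h'' <;>
          first
          | exact Or.inl (h.trans h'.symm)
          | exact Or.inr (h.trans h''.symm)
          | exact (hcd (h'.trans h''.symm)).elim
      rcases this with h | h
      · exact h7 (Sum.inl.inj h).symm
      · exact h8 (Sum.inl.inj h).symm
    have hnd : [p, q].Nodup := by simpa using hpq
    have hsub : [p, q] ⊆ L.filter (crosses f) := by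
      intro r hr
      rcases List.mem_cons.1 hr with rfl | hr
      · exact hp
      · rw [List.mem_singleton.1 hr]; exact hq
    exact (List.subperm_of_subset hnd hsub).length_le
  · intro h
    -- `D` has at most one element, so it can destroy only one of the two lines of a cut. The cases
    -- `∅` and `{a}` are connectedness and irreducibility.
    have key : ∀ (D : Set (Fin n × Fin 4)), (∀ a ∈ D, ∀ b ∈ D, a = b) →
        (lineGraph (gluing L) D).Connected := by
      intro D hD
      refine connected_of_exists_crossing hn fun S hS hS' => ?_
      classical
      obtain ⟨f, hf, hfS⟩ := exists_mem_boolFunctions n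
        fun k => decide (∃ hk : k < n, (⟨k, hk⟩ : Fin n) ∈ S)
      have hfS' : ∀ v : Fin n, f v = true ↔ v ∈ S := fun v => by
        rw [hfS v v.2]; simp
      obtain ⟨v, hv⟩ := hS
      obtain ⟨w, hw⟩ := hS'
      have h2 := h f hf ⟨v, (hfS' v).2 hv⟩ ⟨w, by
        rw [← Bool.not_eq_true, hfS']; exact hw⟩
      have hnd : (L.filter (crosses f)).Nodup := (nodup_of_nodup_ends hL).filter _
      obtain ⟨p, hp, hpD⟩ : ∃ p ∈ L.filter (crosses f),
          ∀ a ∈ D, Sum.inl a ≠ p.1 ∧ Sum.inl a ≠ p.2 := by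
        by_contra! hcon
        match hl : L.filter (crosses f), h2, hnd, hcon with
        | p :: q :: l, _, hnd, hcon =>
          have hp : p ∈ L := List.mem_of_mem_filter (p := crosses f) (by rw [hl]; simp)
          have hq : q ∈ L := List.mem_of_mem_filter (p := crosses f) (by rw [hl]; simp)
          obtain ⟨a, haD, ha⟩ := hcon p (by simp)
          obtain ⟨b, hbD, hb⟩ := hcon q (by simp)
          have hab := hD a haD b hbD
          subst hab
          have ha' : Sum.inl a = p.1 ∨ Sum.inl a = p.2 := by
            by_cases h' : Sum.inl a = p.1
            · exact Or.inl h'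
            · exact Or.inr (ha h')
          have hb' : Sum.inl a = q.1 ∨ Sum.inl a = q.2 := by
            by_cases h' : Sum.inl a = q.1
            · exact Or.inl h'
            · exact Or.inr (hb h')
          have := eq_of_common_end hL hp hq ha' hb'
          simp [this] at hnd
      obtain ⟨hpL, hpc⟩ := List.mem_filter.1 hp
      obtain ⟨a, b, rfl, hab⟩ := crosses_iff.1 hpc
      have haD : a ∉ D := fun ha => (hpD a ha).1 rfl
      have hbD : b ∉ D := fun hb => (hpD b hb).2 rfl
      obtain ⟨g1, g2⟩ := gluing_apply hL hpL
      by_cases ha : a.1 ∈ S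
      · refine ⟨a, b, ha, fun hb => ?_, g1, haD, hbD⟩
        rw [(hfS' _).2 ha, (hfS' _).2 hb] at hab
        exact hab rfl
      · refine ⟨b, a, ?_, ha, g2, hbD, haD⟩
        rw [← hfS'] at ha ⊢
        rcases h' : f b.1
        · exact (hab (by rw [h']; simpa using ha)).elim
        · rfl
    refine ⟨key ∅ (by simp), fun a b _ => key {a} ?_⟩
    intro x hx y hy
    rw [hx, hy]

end LeafSpec

/-! ### The contribution of a leaf from its checked face labels -/

section LeafValue

variable {n N : ℕ}

theorem rotation_eq_next [NeZero N] (h : HalfEdge n N) : rotation n N h = next h := by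
  rcases h with ⟨v, k⟩ | k
  · exact rotation_inl v k
  · exact rotation_inr k

/-- The value of the internal face with label `l`, and `0` for an external face. -/
def labelSize (N : ℕ) {K : ℕ} (m : Fin K → ℕ × ℕ) (l : ℕ) : ℕ :=
  if h : N < l ∧ l - (N + 1) < K then size (m ⟨l - (N + 1), h.2⟩) else 0

/-- The value of the external face with label `l`, and `0` for an internal face. -/
def labelValue (x : Fin N → ℝ) (l : ℕ) : ℝ :=
  if h : 1 ≤ l ∧ l - 1 < N then x ⟨l - 1, h.2⟩ else 0

/-- The sum, over the values of the `K` internal faces, of the amplitude of a graph that is given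
by the list of its lines. -/
def graphSum (θ : ℝ) (lo hi : ℕ) (B : ℕ → ℝ⟦X⟧) (x : Fin N → ℝ) (K : ℕ) (G : List (ℕ × ℕ)) :
    ℝ⟦X⟧ :=
  ∑ m ∈ Fintype.piFinset fun _ : Fin K => indices lo hi,
    (G.map fun p => lineFactor θ B (labelSize N m p.1) (labelSize N m p.2)
      (labelValue x p.1) (labelValue x p.2)).prod

theorem isBar_iff (h : HalfEdge n N) : IsBar h ↔ Even (position h) := by
  rcases h with ⟨v, k⟩ | k <;> rfl

theorem isContraction_gluing (κ : Model) {L : List (HalfEdge n N × HalfEdge n N)}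
    (hL : (ends L).Nodup) (hall : ∀ x, x ∈ ends L)
    (hpar : ∀ p ∈ L, (position p.1 + position p.2) % 2 = 1)
    (hleg : ∀ p ∈ L, p.1.isLeft = true ∨ p.2.isLeft = true) : IsContraction κ (gluing L) := by
  refine ⟨gluing_involutive hL hall, fun h hh => ?_, fun k l hkl => ?_, fun _ h => ?_⟩
  · rcases exists_pair_of_gluing hL hall hh with h1 | h1 <;>
    · have := hpar _ h1
      simp only at this
      omega
  · rcases exists_pair_of_gluing hL hall hkl with h1 | h1 <;>
    · have := hleg _ h1
      simp at this
  · rw [isBar_iff, isBar_iff]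
    rcases exists_pair_of_gluing hL hall (rfl : gluing L h = _) with h1 | h1 <;>
    · have := hpar _ h1
      simp only at this
      rw [Nat.even_iff, Nat.even_iff]
      omega

theorem leafCheck_iff [NeZero N] {K : ℕ} {labs : List ℕ}
    {L : List (HalfEdge n N × HalfEdge n N)} :
    leafCheck K labs L = true ↔
      ((∀ p ∈ L, label labs (next p.1) = label labs p.2 ∧ label labs (next p.2) = label labs p.1 ∧
        (1 ≤ label labs p.1 ∧ label labs p.1 ≤ N + K ∧ 1 ≤ label labs p.2 ∧
          label labs p.2 ≤ N + K) ∧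
        (position p.1 + position p.2) % 2 = 1 ∧ (p.1.isLeft = true ∨ p.2.isLeft = true)) ∧
      (∀ j < N + K, ∃ p ∈ L, label labs p.1 = j + 1 ∨ label labs p.2 = j + 1) ∧
      ∀ k : Fin N, label labs (Sum.inr k : HalfEdge n N) = k + 1) := by
  simp only [leafCheck, Bool.and_eq_true, Bool.or_eq_true, beq_iff_eq, List.all_eq_true,
    List.any_eq_true, List.mem_range, List.mem_finRange, true_implies, Nat.ble_eq, and_assoc]

-- The computed labels need no proof of correctness for `markFaces`: `leafCheck` shows that they are
-- constant along faces and take all values from 1 to `N + K`, and the genus bound supplies the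
-- rest.
open scoped Classical in
theorem contribution_gluing_of_leafCheck (hN : N = 2 ∨ N = 4) [NeZero N] {K : ℕ}
    (hK : 2 * (N + K) = 2 * n + 2 + N) (hn : 0 < n) (κ : Model) (θ : ℝ) (lo hi : ℕ)
    (B : ℕ → ℝ⟦X⟧) (x : Fin N → ℝ) {labs : List ℕ} {L : List (HalfEdge n N × HalfEdge n N)}
    (hL : (ends L).Nodup) (hall : ∀ x, x ∈ ends L) (hpi : onePICheck L = true)
    (hcheck : leafCheck K labs L = true) :
    contribution κ θ lo hi B x (gluing L) = graphSum θ lo hi B x K (internalLines labs L) := by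
  obtain ⟨h1, h2, h3⟩ := leafCheck_iff.1 hcheck
  set σ := gluing L with hσ
  set ℓ : HalfEdge n N → ℕ := label labs with hℓ
  have hc : IsContraction κ σ := isContraction_gluing κ hL hall (fun p hp => (h1 p hp).2.2.2.1)
    fun p hp => (h1 p hp).2.2.2.2
  have hp : IsOnePI σ := (isOnePI_gluing_iff hn hL hall).2 hpi
  have hrange : ∀ h, 1 ≤ ℓ h ∧ ℓ h ≤ N + K := by
    intro h
    obtain ⟨p, hp, rfl | rfl⟩ := mem_ends.1 (hall h)
    · exact ⟨(h1 p hp).2.2.1.1, (h1 p hp).2.2.1.2.1⟩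
    · exact (h1 p hp).2.2.1.2.2
  have hτ : ∀ h, ℓ ((rotation n N * σ) h) = ℓ h := by
    intro h
    rw [Equiv.Perm.mul_apply, rotation_eq_next]
    obtain ⟨p, hp, rfl | rfl⟩ := mem_ends.1 (hall h)
    · rw [hσ, (gluing_apply hL hp).1]; exact (h1 p hp).2.1
    · rw [hσ, (gluing_apply hL hp).2]; exact (h1 p hp).1
  have hsurj : ∀ j < N + K, ∃ h, ℓ h = j + 1 := by
    intro j hj
    obtain ⟨p, -, h | h⟩ := h2 j hj
    · exact ⟨_, h⟩
    · exact ⟨_, h⟩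
  let f : Face σ → Fin (N + K) := Quotient.lift
    (fun h => (⟨ℓ h - 1, by have := hrange h; omega⟩ : Fin (N + K)))
    fun h h' hh => by
      have := apply_eq_of_sameCycle hτ hh
      simp [this]
  have hf : ∀ h, (f (faceOf σ h) : ℕ) = ℓ h - 1 := fun h => rfl
  have hfs : Function.Surjective f := by
    intro j
    obtain ⟨h, hh⟩ := hsurj j j.2
    refine ⟨faceOf σ h, Fin.ext ?_⟩
    rw [hf, hh, Nat.add_sub_cancel]
  -- `numCycles_le`, from the empty contraction, bounds the number of faces by `n + 1 + N / 2`,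
  -- which is `N + K`. A surjective labelling is therefore injective, and equality in the bound is
  -- planarity.
  have hcard : Nat.card (Face σ) ≤ N + K := by
    have hN0 : 0 < N := by omega
    have hb := numCycles_le hN0 hc hp.1 (2 * n + N / 2) ∅ [] (by simp; omega) (by simp) (by simp)
      (by simp [Extends])
    have hr := numCycles_rotation_le (n := n) hN
    rw [gluing, mul_one] at hb
    have : Nat.card (Face σ) = numCycles (rotation n N * σ) := rfl
    rw [this]
    simp only [Finset.card_empty] at hb
    omega
  have hfb : Function.Bijective f :=
    hfs.bijective_of_nat_card_le (by simpa using hcard)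
  have hcard' : Nat.card (Face σ) = N + K := by
    rw [Nat.card_congr (Equiv.ofBijective f hfb), Nat.card_fin]
  have hmem : σ ∈ contractions κ n N := by
    refine mem_contractions.2 ⟨hc, hp, ?_⟩
    rw [IsPlanarRegular, hcard']
    push_cast
    omega
  have hker : ∀ h h', ℓ h = ℓ h' ↔ faceOf σ h = faceOf σ h' := by
    intro h h'
    rw [← hfb.1.eq_iff, Fin.ext_iff, hf, hf]
    have := hrange h
    have := hrange h'
    omega
  have hsize : ∀ (m : Fin K → ℕ × ℕ) (j : Fin K), labelSize N m (N + 1 + j) = size (m j) := by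
    intro m j
    have hj : N < N + 1 + j ∧ N + 1 + j - (N + 1) < K := ⟨by omega, by omega⟩
    rw [labelSize, dif_pos hj]
    congr 2
    exact Fin.ext (by simp)
  -- The first entries of the pairs choose one end of each line, in place of the lexicographically
  -- smaller one.
  have htrans : IsTransversal σ fun h => ∃ p ∈ L, h = p.1 := by
    intro h _
    obtain ⟨q, hq, hh⟩ := mem_ends.1 (hall h)
    have hne : q.1 ≠ q.2 := fun he => hc.no_fixed_point q.1 (by
      rw [hσ, (gluing_apply hL hq).1]; exact he.symm)
    have hfirst : ∃ p ∈ L, q.1 = p.1 := ⟨q, hq, rfl⟩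
    have hsecond : ¬ ∃ p ∈ L, q.2 = p.1 := by
      rintro ⟨p, hp, he⟩
      have := eq_of_common_end hL hp hq (Or.inl he) (Or.inr rfl)
      rw [this] at he
      exact hne he.symm
    rcases hh with rfl | rfl
    · rw [hσ, (gluing_apply hL hq).1]
      exact ⟨fun h => (hsecond h).elim, fun h => (h hfirst).elim⟩
    · rw [hσ, (gluing_apply hL hq).2]
      exact ⟨fun _ => hsecond, fun _ => hfirst⟩
  rw [contribution, if_pos hmem, sum_amplitude_eq hc θ lo hi B x ℓ hker (J := Fin K)
    (fun j => N + 1 + (j : ℕ)) (fun i j hij => Fin.ext (by simpa using hij)) ?_ ?_ htrans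
    (fun m l => labelSize N m l) hsize ?_ (labelValue x) ?_]
  · rw [graphSum]
    refine Finset.sum_congr rfl fun m _ => ?_
    have hset : ∀ h, (OnLine σ h ∧ ∃ p ∈ L, h = p.1) ↔
        h ∈ ((L.filter fun p => p.1.isLeft && p.2.isLeft).map Prod.fst).toFinset := by
      intro h
      simp only [List.mem_toFinset, List.mem_map, List.mem_filter, Bool.and_eq_true, OnLine]
      constructor
      · rintro ⟨⟨h4, h5⟩, p, hp, rfl⟩
        rw [hσ, (gluing_apply hL hp).1] at h5
        exact ⟨p, ⟨hp, h4, h5⟩, rfl⟩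
      · rintro ⟨p, ⟨hp, h4, h5⟩, rfl⟩
        refine ⟨⟨h4, ?_⟩, p, hp, rfl⟩
        rwa [hσ, (gluing_apply hL hp).1]
    have hnd : ((L.filter fun p => p.1.isLeft && p.2.isLeft).map Prod.fst).Nodup := by
      refine ((nodup_of_nodup_ends hL).filter _).map_on fun p hp q hq hpq => ?_
      exact eq_of_common_end hL (List.mem_of_mem_filter hp) (List.mem_of_mem_filter hq)
        (Or.inl rfl) (Or.inl hpq)
    refine (Finset.prod_congr (s₂ := ((L.filter fun p =>
      p.1.isLeft && p.2.isLeft).map Prod.fst).toFinset) (Finset.ext fun h => ?_)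
        fun _ _ => rfl).trans ?_
    · simp only [Finset.mem_filter, Finset.mem_univ, true_and]
      exact hset h
    rw [List.prod_toFinset _ hnd, internalLines, List.map_map, List.map_map]
    congr 1
    refine List.map_congr_left fun p hp => ?_
    have hp' := List.mem_of_mem_filter hp
    simp only [Function.comp]
    rw [hσ, (gluing_apply hL hp').1]
    rcases le_total (ℓ p.1) (ℓ p.2) with hle | hle
    · rw [min_eq_left hle, max_eq_right hle]
    · rw [min_eq_right hle, max_eq_left hle, lineFactor_comm]
  · intro j
    obtain ⟨h, hh⟩ := hsurj (N + j) (by omega)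
    exact ⟨h, by rw [hh]; ring⟩
  · intro h
    have hh := hrange h
    constructor
    · rintro ⟨j, hj⟩ k hk
      rw [← hj, h3] at hk
      have := k.2
      omega
    · intro hk
      have hgt : N < ℓ h := by
        by_contra hcon
        refine hk ⟨ℓ h - 1, by omega⟩ ?_
        rw [h3]
        simp only
        omega
      refine ⟨⟨ℓ h - (N + 1), by omega⟩, ?_⟩
      simp only
      omega
  · intro m k
    rw [h3, labelSize, dif_neg]
    have := k.2
    omega
  · intro h
    have hh := hrange h
    rw [labelValue]
    split_ifs with hl
    · rw [Finset.sum_eq_single (⟨ℓ h - 1, hl.2⟩ : Fin N)]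
      · rw [if_pos]
        rw [h3]
        simp only
        omega
      · intro k _ hk
        rw [if_neg]
        rw [h3]
        intro he
        exact hk (Fin.ext (by simp only; omega))
      · simp
    · rw [Finset.sum_eq_zero]
      intro k _
      rw [if_neg]
      rw [h3]
      have := k.2
      omega

/-- A list of the form `r.map some` contains no failure, so every surviving leaf passed its check,
and the discarded ones contribute zero. -/
theorem sum_filterMap_eq {α β M : Type*} [AddCommMonoid M] (l : List α)
    (F : α → Option (Option β)) (φ : α → M) (ψ : β → M)
    (h0 : ∀ a ∈ l, F a = none → φ a = 0) (h1 : ∀ a ∈ l, ∀ b, F a = some (some b) → φ a = ψ b) :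
    ∀ r : List β, l.filterMap F = r.map some → (l.map φ).sum = (r.map ψ).sum := by
  induction l with
  | nil => intro r hr; cases r <;> simp_all
  | cons a l ih =>
    intro r hr
    have ih' := ih (fun b hb => h0 b (List.mem_cons_of_mem _ hb))
      (fun b hb => h1 b (List.mem_cons_of_mem _ hb))
    rcases hF : F a with _ | c
    · rw [List.filterMap_cons_none hF] at hr
      rw [List.map_cons, List.sum_cons, h0 a List.mem_cons_self hF, zero_add, ih' r hr]
    · rw [List.filterMap_cons_some hF] at hr
      cases r with
      | nil => simp at hr
      | cons b r =>
        simp only [List.map_cons, List.cons.injEq] at hr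
        rw [hr.1] at hF
        rw [List.map_cons, List.sum_cons, List.map_cons, List.sum_cons,
          h1 a List.mem_cons_self b hF, ih' r hr.2]

open scoped Classical in
/-- The sum over all contractions, for a list of graphs which passes the check. -/
theorem sum_contractions_eq_graphs (hN : N = 2 ∨ N = 4) [NeZero N] {K : ℕ}
    (hK : 2 * (N + K) = 2 * n + 2 + N) (hn : 0 < n) (κ : Model) (θ : ℝ) (lo hi : ℕ)
    (B : ℕ → ℝ⟦X⟧) (x : Fin N → ℝ) {graphs : List (List (ℕ × ℕ))}
    (hg : (leaves n N).filterMap (leafData K) = graphs.map some) :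
    ∑ σ ∈ contractions κ n N,
      ∑ m ∈ Fintype.piFinset fun _ : {F : Face σ // IsInternal σ F} => indices lo hi,
        amplitude θ B σ x m =
      (κ.positions ^ n * n.factorial) • (graphs.map (graphSum θ lo hi B x K)).sum := by
  rw [sum_contractions_eq hN]
  congr 1
  refine sum_filterMap_eq _ _ _ _ (fun L hL hnone => ?_) (fun L hL G hG => ?_) _ hg
  · obtain ⟨hnd, hall⟩ := mem_explore_spec _ _ _ _ (isState_initial hN) L hL
    rw [contribution, if_neg]
    intro hmem
    rw [leafData, (isOnePI_gluing_iff hn hnd hall).1 (mem_contractions.1 hmem).2.1] at hnone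
    simp only [if_true] at hnone
    split_ifs at hnone
  · obtain ⟨hnd, hall⟩ := mem_explore_spec _ _ _ _ (isState_initial hN) L hL
    rw [leafData] at hG
    split_ifs at hG with h1 h2
    · rw [contribution_gluing_of_leafCheck hN hK hn κ θ lo hi B x hnd hall h1 h2]
      rw [Option.some.inj (Option.some.inj hG)]
    · simp at hG

end LeafValue

/-! ### The graphs of low order -/

section Graphs

/-- The lines of the two-point graphs with one vertex, as pairs of faces. The
legs belong to the faces `1, …, 2`. -/
def twoPointGraphs₁ : List (List (ℕ × ℕ)) :=
  [[(1, 3)], [(2, 3)]]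

/-- Euler's formula fixes the number of internal faces: `n` with two legs, `n - 1` with four. The
check includes alternation of charges, so the same list serves both models. -/
theorem filterMap_leaves_1_2 :
    (leaves 1 2).filterMap (leafData 1) = twoPointGraphs₁.map some := by
  decide +kernel

/-- The lines of the two-point graphs with two vertices, as pairs of faces. The
legs belong to the faces `1, …, 2`. -/
def twoPointGraphs₂ : List (List (ℕ × ℕ)) :=
  [[(1, 3), (1, 4), (1, 3)], [(3, 4), (1, 3), (1, 3)], [(3, 4), (2, 3), (1, 4)],
   [(2, 3), (2, 4), (2, 3)], [(3, 4), (2, 3), (2, 3)]]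

theorem filterMap_leaves_2_2 :
    (leaves 2 2).filterMap (leafData 2) = twoPointGraphs₂.map some := by
  decide +kernel

/-- The lines of the two-point graphs with three vertices, as pairs of faces. The
legs belong to the faces `1, …, 2`. -/
def twoPointGraphs₃ : List (List (ℕ × ℕ)) :=
  [[(1, 3), (1, 4), (1, 5), (1, 4), (1, 3)], [(3, 4), (1, 3), (1, 5), (1, 3), (1, 3)],
   [(1, 3), (4, 5), (1, 4), (1, 4), (1, 3)], [(3, 4), (3, 5), (1, 3), (1, 3), (1, 3)],
   [(4, 5), (3, 4), (1, 3), (1, 5), (1, 3)], [(3, 4), (3, 5), (2, 3), (1, 5), (1, 4)],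
   [(4, 5), (3, 4), (2, 3), (1, 4), (1, 4)], [(1, 3), (1, 5), (1, 3), (1, 4), (1, 3)],
   [(3, 5), (1, 3), (1, 3), (1, 4), (1, 3)], [(3, 4), (2, 3), (1, 4), (1, 5), (1, 4)],
   [(3, 4), (3, 5), (3, 4), (1, 3), (1, 3)], [(4, 5), (3, 4), (3, 4), (1, 3), (1, 3)],
   [(3, 4), (2, 3), (2, 5), (2, 3), (1, 4)], [(3, 4), (3, 5), (2, 3), (2, 3), (1, 4)],
   [(4, 5), (3, 4), (2, 3), (2, 5), (1, 4)], [(3, 4), (3, 5), (3, 4), (2, 3), (1, 4)],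
   [(4, 5), (3, 4), (3, 4), (2, 3), (1, 4)], [(2, 3), (2, 4), (2, 5), (2, 4), (2, 3)],
   [(3, 4), (2, 3), (2, 5), (2, 3), (2, 3)], [(2, 3), (4, 5), (2, 4), (2, 4), (2, 3)],
   [(3, 4), (3, 5), (2, 3), (2, 3), (2, 3)], [(4, 5), (3, 5), (2, 3), (2, 4), (2, 3)],
   [(2, 3), (2, 5), (2, 3), (2, 4), (2, 3)], [(3, 5), (2, 3), (2, 3), (2, 4), (2, 3)],
   [(3, 4), (3, 5), (3, 4), (2, 3), (2, 3)], [(4, 5), (3, 4), (3, 4), (2, 3), (2, 3)]]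

theorem filterMap_leaves_3_2 :
    (leaves 3 2).filterMap (leafData 3) = twoPointGraphs₃.map some := by
  decide +kernel

/-- The lines of the four-point graphs with one vertex, as pairs of faces. The
legs belong to the faces `1, …, 4`. -/
def fourPointGraphs₁ : List (List (ℕ × ℕ)) :=
  [[]]

theorem filterMap_leaves_1_4 :
    (leaves 1 4).filterMap (leafData 0) = fourPointGraphs₁.map some := by
  decide +kernel

/-- The lines of the four-point graphs with two vertices, as pairs of faces. The
legs belong to the faces `1, …, 4`. -/
def fourPointGraphs₂ : List (List (ℕ × ℕ)) :=
  [[(3, 5), (1, 5)], [(2, 5), (4, 5)]]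

theorem filterMap_leaves_2_4 :
    (leaves 2 4).filterMap (leafData 1) = fourPointGraphs₂.map some := by
  decide +kernel

/-- The lines of the four-point graphs with three vertices, as pairs of faces. The
legs belong to the faces `1, …, 4`. -/
def fourPointGraphs₃ : List (List (ℕ × ℕ)) :=
  [[(3, 5), (3, 6), (1, 6), (1, 5)], [(5, 6), (3, 5), (1, 5), (1, 5)],
   [(3, 5), (1, 5), (1, 6), (1, 5)], [(5, 6), (3, 5), (4, 6), (1, 5)],
   [(5, 6), (2, 5), (4, 5), (1, 6)], [(3, 5), (3, 6), (3, 5), (1, 5)],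
   [(5, 6), (3, 5), (3, 5), (1, 5)], [(5, 6), (2, 5), (3, 6), (1, 6)],
   [(2, 5), (2, 6), (4, 6), (4, 5)], [(5, 6), (2, 5), (4, 5), (4, 5)],
   [(2, 5), (4, 5), (4, 6), (4, 5)], [(5, 6), (2, 5), (3, 6), (4, 5)],
   [(2, 5), (2, 6), (2, 5), (4, 5)], [(5, 6), (2, 5), (2, 5), (4, 5)]]

theorem filterMap_leaves_3_4 :
    (leaves 3 4).filterMap (leafData 2) = fourPointGraphs₃.map some := by
  decide +kernel

/-- The lines of the four-point graphs with four vertices, as pairs of faces. The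
legs belong to the faces `1, …, 4`. -/
def fourPointGraphs₄ : List (List (ℕ × ℕ)) :=
  [[(3, 5), (3, 6), (3, 7), (1, 7), (1, 6), (1, 5)],
   [(5, 6), (3, 5), (3, 7), (1, 7), (1, 5), (1, 5)],
   [(3, 5), (6, 7), (3, 6), (1, 6), (1, 6), (1, 5)],
   [(5, 6), (5, 7), (3, 5), (1, 5), (1, 5), (1, 5)],
   [(6, 7), (5, 6), (3, 5), (1, 5), (1, 7), (1, 5)],
   [(3, 5), (3, 6), (1, 6), (1, 7), (1, 6), (1, 5)],
   [(5, 6), (3, 5), (1, 5), (1, 7), (1, 5), (1, 5)],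
   [(3, 5), (1, 5), (1, 6), (1, 7), (1, 6), (1, 5)],
   [(3, 5), (1, 5), (6, 7), (1, 6), (1, 6), (1, 5)],
   [(3, 5), (6, 7), (3, 6), (4, 7), (1, 6), (1, 5)],
   [(5, 6), (5, 7), (3, 5), (4, 7), (1, 5), (1, 5)],
   [(6, 7), (5, 6), (3, 5), (4, 6), (1, 7), (1, 5)],
   [(5, 6), (5, 7), (2, 5), (4, 5), (1, 7), (1, 6)],
   [(6, 7), (5, 6), (2, 5), (4, 5), (1, 6), (1, 6)],
   [(3, 5), (3, 6), (3, 7), (3, 6), (1, 6), (1, 5)],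
   [(5, 6), (3, 5), (3, 7), (3, 5), (1, 5), (1, 5)],
   [(3, 5), (6, 7), (3, 6), (3, 6), (1, 6), (1, 5)],
   [(5, 6), (5, 7), (3, 5), (3, 5), (1, 5), (1, 5)],
   [(6, 7), (5, 6), (3, 5), (3, 7), (1, 7), (1, 5)],
   [(5, 6), (5, 7), (2, 5), (3, 7), (1, 7), (1, 6)],
   [(6, 7), (5, 6), (2, 5), (3, 6), (1, 6), (1, 6)],
   [(3, 5), (3, 7), (3, 5), (3, 6), (1, 6), (1, 5)],
   [(5, 7), (3, 5), (3, 5), (3, 6), (1, 6), (1, 5)],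
   [(5, 6), (2, 5), (3, 6), (3, 7), (1, 7), (1, 6)],
   [(5, 6), (5, 7), (5, 6), (3, 5), (1, 5), (1, 5)],
   [(6, 7), (5, 6), (5, 6), (3, 5), (1, 5), (1, 5)],
   [(3, 5), (3, 7), (1, 7), (1, 5), (1, 6), (1, 5)],
   [(5, 7), (3, 5), (1, 5), (1, 5), (1, 6), (1, 5)],
   [(3, 5), (1, 5), (1, 7), (1, 5), (1, 6), (1, 5)],
   [(5, 7), (3, 5), (4, 7), (1, 5), (1, 6), (1, 5)],
   [(5, 6), (2, 5), (4, 5), (1, 6), (1, 7), (1, 6)],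
   [(3, 5), (3, 7), (3, 5), (1, 5), (1, 6), (1, 5)],
   [(5, 7), (3, 5), (3, 5), (1, 5), (1, 6), (1, 5)],
   [(5, 6), (2, 5), (3, 6), (1, 6), (1, 7), (1, 6)],
   [(5, 6), (5, 7), (3, 5), (4, 7), (4, 6), (1, 5)],
   [(6, 7), (5, 6), (3, 5), (4, 6), (4, 6), (1, 5)],
   [(5, 6), (2, 5), (2, 7), (4, 7), (4, 5), (1, 6)],
   [(5, 6), (5, 7), (2, 5), (4, 5), (4, 5), (1, 6)],
   [(6, 7), (5, 6), (2, 5), (4, 5), (4, 7), (1, 6)],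
   [(5, 6), (3, 5), (4, 6), (4, 7), (4, 6), (1, 5)],
   [(5, 6), (2, 5), (4, 5), (4, 7), (4, 5), (1, 6)],
   [(5, 6), (3, 5), (3, 7), (3, 5), (4, 6), (1, 5)],
   [(5, 6), (5, 7), (3, 5), (3, 5), (4, 6), (1, 5)],
   [(6, 7), (5, 6), (3, 5), (3, 7), (4, 6), (1, 5)],
   [(5, 6), (5, 7), (2, 5), (3, 7), (4, 5), (1, 6)],
   [(6, 7), (5, 6), (2, 5), (3, 6), (4, 7), (1, 6)],
   [(5, 6), (5, 7), (5, 6), (3, 5), (4, 6), (1, 5)],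
   [(6, 7), (5, 6), (5, 6), (3, 5), (4, 6), (1, 5)],
   [(5, 6), (2, 5), (2, 7), (2, 5), (4, 5), (1, 6)],
   [(5, 6), (5, 7), (2, 5), (2, 5), (4, 5), (1, 6)],
   [(6, 7), (5, 6), (2, 5), (2, 7), (4, 7), (1, 6)],
   [(5, 6), (5, 7), (5, 6), (2, 5), (4, 5), (1, 6)],
   [(6, 7), (5, 6), (5, 6), (2, 5), (4, 5), (1, 6)],
   [(3, 5), (3, 6), (3, 7), (3, 6), (3, 5), (1, 5)],
   [(5, 6), (3, 5), (3, 7), (3, 5), (3, 5), (1, 5)],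
   [(3, 5), (6, 7), (3, 6), (3, 6), (3, 5), (1, 5)],
   [(5, 6), (5, 7), (3, 5), (3, 5), (3, 5), (1, 5)],
   [(6, 7), (5, 6), (3, 5), (3, 7), (3, 5), (1, 5)],
   [(5, 6), (5, 7), (2, 5), (3, 7), (3, 6), (1, 6)],
   [(6, 7), (5, 6), (2, 5), (3, 6), (3, 6), (1, 6)],
   [(3, 5), (3, 7), (3, 5), (3, 6), (3, 5), (1, 5)],
   [(5, 7), (3, 5), (3, 5), (3, 6), (3, 5), (1, 5)],
   [(5, 6), (2, 5), (3, 6), (3, 7), (3, 6), (1, 6)],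
   [(5, 6), (5, 7), (5, 6), (3, 5), (3, 5), (1, 5)],
   [(6, 7), (5, 6), (5, 6), (3, 5), (3, 5), (1, 5)],
   [(5, 6), (2, 5), (2, 7), (2, 5), (3, 6), (1, 6)],
   [(5, 6), (5, 7), (2, 5), (2, 5), (3, 6), (1, 6)],
   [(6, 7), (5, 6), (2, 5), (2, 7), (3, 6), (1, 6)],
   [(5, 6), (5, 7), (5, 6), (2, 5), (3, 6), (1, 6)],
   [(6, 7), (5, 6), (5, 6), (2, 5), (3, 6), (1, 6)],
   [(2, 5), (2, 6), (2, 7), (4, 7), (4, 6), (4, 5)],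
   [(5, 6), (2, 5), (2, 7), (4, 7), (4, 5), (4, 5)],
   [(2, 5), (6, 7), (2, 6), (4, 6), (4, 6), (4, 5)],
   [(5, 6), (5, 7), (2, 5), (4, 5), (4, 5), (4, 5)],
   [(6, 7), (5, 7), (2, 5), (4, 5), (4, 6), (4, 5)],
   [(2, 5), (2, 6), (4, 6), (4, 7), (4, 6), (4, 5)],
   [(5, 6), (2, 5), (4, 5), (4, 7), (4, 5), (4, 5)],
   [(2, 5), (4, 5), (4, 6), (4, 7), (4, 6), (4, 5)],
   [(2, 5), (4, 5), (6, 7), (4, 6), (4, 6), (4, 5)],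
   [(2, 5), (6, 7), (2, 6), (3, 7), (4, 6), (4, 5)],
   [(5, 6), (5, 7), (2, 5), (3, 7), (4, 5), (4, 5)],
   [(6, 7), (5, 7), (2, 5), (3, 7), (4, 6), (4, 5)],
   [(2, 5), (2, 6), (2, 7), (2, 6), (4, 6), (4, 5)],
   [(5, 6), (2, 5), (2, 7), (2, 5), (4, 5), (4, 5)],
   [(2, 5), (6, 7), (2, 6), (2, 6), (4, 6), (4, 5)],
   [(5, 6), (5, 7), (2, 5), (2, 5), (4, 5), (4, 5)],
   [(6, 7), (5, 7), (2, 5), (2, 6), (4, 6), (4, 5)],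
   [(2, 5), (2, 7), (2, 5), (2, 6), (4, 6), (4, 5)],
   [(5, 7), (2, 5), (2, 5), (2, 6), (4, 6), (4, 5)],
   [(5, 6), (5, 7), (5, 6), (2, 5), (4, 5), (4, 5)],
   [(6, 7), (5, 6), (5, 6), (2, 5), (4, 5), (4, 5)],
   [(2, 5), (2, 7), (4, 7), (4, 5), (4, 6), (4, 5)],
   [(5, 7), (2, 5), (4, 5), (4, 5), (4, 6), (4, 5)],
   [(2, 5), (4, 5), (4, 7), (4, 5), (4, 6), (4, 5)],
   [(5, 7), (2, 5), (3, 7), (4, 5), (4, 6), (4, 5)],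
   [(2, 5), (2, 7), (2, 5), (4, 5), (4, 6), (4, 5)],
   [(5, 7), (2, 5), (2, 5), (4, 5), (4, 6), (4, 5)],
   [(5, 6), (5, 7), (2, 5), (3, 7), (3, 6), (4, 5)],
   [(6, 7), (5, 6), (2, 5), (3, 6), (3, 6), (4, 5)],
   [(5, 6), (2, 5), (3, 6), (3, 7), (3, 6), (4, 5)],
   [(5, 6), (2, 5), (2, 7), (2, 5), (3, 6), (4, 5)],
   [(5, 6), (5, 7), (2, 5), (2, 5), (3, 6), (4, 5)],
   [(6, 7), (5, 6), (2, 5), (2, 7), (3, 6), (4, 5)],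
   [(5, 6), (5, 7), (5, 6), (2, 5), (3, 6), (4, 5)],
   [(6, 7), (5, 6), (5, 6), (2, 5), (3, 6), (4, 5)],
   [(2, 5), (2, 6), (2, 7), (2, 6), (2, 5), (4, 5)],
   [(5, 6), (2, 5), (2, 7), (2, 5), (2, 5), (4, 5)],
   [(2, 5), (6, 7), (2, 6), (2, 6), (2, 5), (4, 5)],
   [(5, 6), (5, 7), (2, 5), (2, 5), (2, 5), (4, 5)],
   [(6, 7), (5, 7), (2, 5), (2, 6), (2, 5), (4, 5)],
   [(2, 5), (2, 7), (2, 5), (2, 6), (2, 5), (4, 5)],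
   [(5, 7), (2, 5), (2, 5), (2, 6), (2, 5), (4, 5)],
   [(5, 6), (5, 7), (5, 6), (2, 5), (2, 5), (4, 5)],
   [(6, 7), (5, 6), (5, 6), (2, 5), (2, 5), (4, 5)]]

theorem filterMap_leaves_4_4 :
    (leaves 4 4).filterMap (leafData 3) = fourPointGraphs₄.map some := by
  decide +kernel

/-- The factor of a vertex, for graphs up to relabeling. -/
def vertexUnit (θ : ℝ) : ℝ⟦X⟧ := -(PowerSeries.C (64 * Real.pi ^ 4 * θ ^ 2) * PowerSeries.X)

/-- The two models become one here: 4 positions with weight 1/4, or 2 positions with weight 1/2. -/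
theorem positions_mul_vertexFactor (κ : Model) (θ : ℝ) :
    PowerSeries.C (κ.positions : ℝ) * vertexFactor κ θ = vertexUnit θ := by
  cases κ <;>
  · simp only [Model.positions, vertexFactor, bareCoupling, vertexUnit, mul_neg, ← mul_assoc,
      ← map_mul]
    congr 3
    push_cast
    ring

/-- The `n!` labellings cancel the exponential weight and the positions are absorbed into the
vertices, so every listed graph has weight one. -/
theorem orderTerm_eq_graphs {n N K : ℕ} (hN : N = 2 ∨ N = 4) [NeZero N]
    (hK : 2 * (N + K) = 2 * n + 2 + N) (hn : 0 < n) (κ : Model) (θ : ℝ) (lo hi : ℕ)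
    (B : ℕ → ℝ⟦X⟧) (x : Fin N → ℝ) {graphs : List (List (ℕ × ℕ))}
    (hg : (leaves n N).filterMap (leafData K) = graphs.map some) :
    orderTerm κ θ lo hi B n N x =
      vertexUnit θ ^ n * (graphs.map (graphSum θ lo hi B x K)).sum := by
  rw [orderTerm, sum_contractions_eq_graphs hN hK hn κ θ lo hi B x hg, nsmul_eq_mul,
    ← positions_mul_vertexFactor κ θ]
  have h1 : PowerSeries.C (1 / (n.factorial : ℝ)) * (n.factorial : ℝ⟦X⟧) = 1 := by
    rw [← map_natCast (PowerSeries.C (R := ℝ)), ← map_mul, one_div,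
      inv_mul_cancel₀ (Nat.cast_ne_zero.2 n.factorial_ne_zero), map_one]
  rw [map_natCast]
  push_cast
  linear_combination ((κ.positions : ℝ⟦X⟧) ^ n * vertexFactor κ θ ^ n *
    (graphs.map (graphSum θ lo hi B x K)).sum) * h1

end Graphs

/-! ### Existence and uniqueness of the subtracted mass parameters -/

section FixedPoint

/-- A map that is contracting in the `X`-adic topology has exactly one fixed point. -/
theorem existsUnique_fixedPoint {ι : Type*} (T : (ι → ℝ⟦X⟧) → ι → ℝ⟦X⟧)
    (hT : ∀ (d : ℕ) (B B' : ι → ℝ⟦X⟧), (∀ j, (PowerSeries.X : ℝ⟦X⟧) ^ d ∣ B j - B' j) →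
      ∀ j, (PowerSeries.X : ℝ⟦X⟧) ^ (d + 1) ∣ T B j - T B' j) :
    ∃! B : ι → ℝ⟦X⟧, ∀ j, B j = T B j := by
  have hzero : ∀ f : ℝ⟦X⟧, (∀ d : ℕ, (PowerSeries.X : ℝ⟦X⟧) ^ d ∣ f) → f = 0 := fun f hf => by
    ext d
    rw [map_zero]
    exact PowerSeries.X_pow_dvd_iff.1 (hf (d + 1)) d (Nat.lt_succ_self d)
  have hstep : ∀ d j, (PowerSeries.X : ℝ⟦X⟧) ^ d ∣ T^[d + 1] 0 j - T^[d] 0 j := by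
    intro d
    induction d with
    | zero => intro j; simp
    | succ d ih =>
      intro j
      have := hT d _ _ ih j
      rwa [← Function.iterate_succ_apply' T, ← Function.iterate_succ_apply' T] at this
  have hle : ∀ d k j, (PowerSeries.X : ℝ⟦X⟧) ^ d ∣ T^[d + k] 0 j - T^[d] 0 j := by
    intro d k j
    induction k with
    | zero => simp
    | succ k ih =>
      have := dvd_add ((pow_dvd_pow _ (Nat.le_add_right d k)).trans (hstep (d + k) j)) ih
      rwa [sub_add_sub_cancel] at this
  -- The coefficient of order `d` no longer changes after the iterate `d + 1`, so this is the X-adic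
  -- limit.
  let L : ι → ℝ⟦X⟧ := fun j => PowerSeries.mk fun d => PowerSeries.coeff d (T^[d + 1] 0 j)
  have hL : ∀ d j, (PowerSeries.X : ℝ⟦X⟧) ^ d ∣ L j - T^[d] 0 j := by
    intro d j
    rw [PowerSeries.X_pow_dvd_iff]
    intro e he
    obtain ⟨k, rfl⟩ : ∃ k, d = e + 1 + k := ⟨d - (e + 1), by omega⟩
    have := PowerSeries.X_pow_dvd_iff.1 (hle (e + 1) k j) e (Nat.lt_succ_self e)
    rw [map_sub, sub_eq_zero] at this
    rw [map_sub, this, PowerSeries.coeff_mk, sub_self]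
  refine ⟨L, fun j => ?_, fun B hB => funext fun j => ?_⟩
  · refine sub_eq_zero.1 (hzero _ fun d => ?_)
    have h1 := hL (d + 1) j
    have h2 := hT d _ _ (hL d) j
    rw [← Function.iterate_succ_apply' T] at h2
    have := (pow_dvd_pow _ (Nat.le_succ d)).trans (dvd_sub h1 h2)
    rwa [sub_sub_sub_cancel_right] at this
  · refine sub_eq_zero.1 (hzero _ fun d => ?_)
    have hall : ∀ d j, (PowerSeries.X : ℝ⟦X⟧) ^ d ∣ B j - L j := by
      intro d
      induction d with
      | zero => intro j; simp
      | succ d ih =>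
        intro j
        have h1 := hL (d + 1) j
        have h2 := hT d _ _ (hL d) j
        rw [← Function.iterate_succ_apply' T] at h2
        have h3 := hT d _ _ ih j
        have := dvd_sub (dvd_add h3 h2) h1
        rw [hB j]
        convert this using 1
        ring
    exact hall d j

end FixedPoint

/-! ### The subtraction conditions are contractions -/

section Contracting

variable {n N : ℕ}

/-- The difference is `-a⁻¹ b⁻¹ (a - b)`; if the common constant term vanishes, both inverses are 0
by convention, so no hypothesis of invertibility is needed. -/
theorem inv_congr {d : ℕ} {a b : ℝ⟦X⟧} (h : (PowerSeries.X : ℝ⟦X⟧) ^ d ∣ a - b) :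
    (PowerSeries.X : ℝ⟦X⟧) ^ d ∣ a⁻¹ - b⁻¹ := by
  rcases Nat.eq_zero_or_pos d with rfl | hd
  · simp
  have h0 : PowerSeries.constantCoeff a = PowerSeries.constantCoeff b := by
    have := PowerSeries.X_pow_dvd_iff.1 h 0 hd
    rwa [PowerSeries.coeff_zero_eq_constantCoeff_apply, map_sub, sub_eq_zero] at this
  by_cases hb : PowerSeries.constantCoeff b = 0
  · rw [PowerSeries.inv_eq_zero.2 hb, PowerSeries.inv_eq_zero.2 (h0.trans hb), sub_zero]
    exact dvd_zero _
  · have h1 := PowerSeries.mul_inv_cancel b hb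
    have h2 := PowerSeries.mul_inv_cancel a (h0.trans_ne hb)
    have : a⁻¹ - b⁻¹ = -(a⁻¹ * b⁻¹) * (a - b) := by
      linear_combination b⁻¹ * h2 - a⁻¹ * h1
    rw [this]
    exact h.mul_left _

theorem prod_congr_dvd {ι : Type*} (s : Finset ι) {P : ℝ⟦X⟧} {f g : ι → ℝ⟦X⟧}
    (h : ∀ i ∈ s, P ∣ f i - g i) : P ∣ ∏ i ∈ s, f i - ∏ i ∈ s, g i := by
  rw [← Ideal.mem_span_singleton, ← Ideal.Quotient.mk_eq_mk_iff_sub_mem, map_prod, map_prod]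
  refine Finset.prod_congr rfl fun i hi => ?_
  rw [Ideal.Quotient.mk_eq_mk_iff_sub_mem, Ideal.mem_span_singleton]
  exact h i hi

theorem amplitude_congr (θ : ℝ) {d : ℕ} {B B' : ℕ → ℝ⟦X⟧}
    (h : ∀ j, (PowerSeries.X : ℝ⟦X⟧) ^ d ∣ B j - B' j) (σ : Equiv.Perm (HalfEdge n N))
    (x : Fin N → ℝ) (m : {F : Face σ // IsInternal σ F} → ℕ × ℕ) :
    (PowerSeries.X : ℝ⟦X⟧) ^ d ∣ amplitude θ B σ x m - amplitude θ B' σ x m := by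
  refine prod_congr_dvd _ fun e _ => ?_
  rcases σ (Sum.inl e) with e' | k
  · dsimp only
    split_ifs
    · rw [propagator, propagator, ← mul_sub]
      refine (inv_congr ?_).mul_left _
      rw [add_sub_add_right_eq_sub]
      exact h _
    · simp
  · simp

theorem X_dvd_vertexFactor (κ : Model) (θ : ℝ) : PowerSeries.X ∣ vertexFactor κ θ := by
  cases κ <;>
  · rw [vertexFactor, bareCoupling, ← mul_assoc, dvd_neg]
    exact dvd_mul_left _ _

/-- Each vertex carries a factor `X`, so a graph with `n` vertices shifts a change of `B` by `n`
orders. -/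
theorem orderTerm_congr (κ : Model) (θ : ℝ) (lo hi : ℕ) {d : ℕ} {B B' : ℕ → ℝ⟦X⟧}
    (h : ∀ j, (PowerSeries.X : ℝ⟦X⟧) ^ d ∣ B j - B' j) (n N : ℕ) (x : Fin N → ℝ) :
    (PowerSeries.X : ℝ⟦X⟧) ^ (d + n) ∣
      orderTerm κ θ lo hi B n N x - orderTerm κ θ lo hi B' n N x := by
  classical
  rw [orderTerm, orderTerm, ← mul_sub, pow_add, mul_comm (PowerSeries.X ^ d : ℝ⟦X⟧)]
  refine mul_dvd_mul ((pow_dvd_pow_of_dvd (X_dvd_vertexFactor κ θ) n).mul_left _) ?_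
  rw [← Finset.sum_sub_distrib]
  refine Finset.dvd_sum fun σ _ => ?_
  rw [← Finset.sum_sub_distrib]
  exact Finset.dvd_sum fun m _ => amplitude_congr θ h σ x m

theorem X_pow_dvd_orderTerm (κ : Model) (θ : ℝ) (lo hi : ℕ) (B : ℕ → ℝ⟦X⟧) (n N : ℕ)
    (x : Fin N → ℝ) : (PowerSeries.X : ℝ⟦X⟧) ^ n ∣ orderTerm κ θ lo hi B n N x := by
  rw [orderTerm, mul_right_comm]
  exact (pow_dvd_pow_of_dvd (X_dvd_vertexFactor κ θ) n).mul_left _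

/-- A connected graph has a vertex. This is why the self-energy gains at least one order on `B`. -/
theorem orderTerm_zero (κ : Model) (θ : ℝ) (lo hi : ℕ) (B : ℕ → ℝ⟦X⟧) (N : ℕ) (x : Fin N → ℝ) :
    orderTerm κ θ lo hi B 0 N x = 0 := by
  classical
  rw [orderTerm, Finset.sum_eq_zero, mul_zero]
  intro σ hσ
  exact ((mem_contractions.1 hσ).2.1.1.nonempty.some).elim0

theorem onePIFunction_congr (κ : Model) (θ : ℝ) (lo hi : ℕ) {d : ℕ} {B B' : ℕ → ℝ⟦X⟧}
    (h : ∀ j, (PowerSeries.X : ℝ⟦X⟧) ^ d ∣ B j - B' j) (N : ℕ) (x : Fin N → ℝ) :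
    (PowerSeries.X : ℝ⟦X⟧) ^ (d + 1) ∣
      onePIFunction κ θ lo hi B N x - onePIFunction κ θ lo hi B' N x := by
  rw [PowerSeries.X_pow_dvd_iff]
  intro e he
  rw [map_sub, onePIFunction, onePIFunction, PowerSeries.coeff_mk, PowerSeries.coeff_mk,
    ← Finset.sum_sub_distrib]
  refine Finset.sum_eq_zero fun n _ => ?_
  rcases Nat.eq_zero_or_pos n with rfl | hn
  · rw [orderTerm_zero, orderTerm_zero, sub_self]
  · rw [← map_sub]
    exact PowerSeries.X_pow_dvd_iff.1 (orderTerm_congr κ θ lo hi h n N x) e (by omega)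

theorem waveFunction_congr (κ : Model) (θ : ℝ) (lo hi : ℕ) {d : ℕ} {B B' : ℕ → ℝ⟦X⟧}
    (h : ∀ j, (PowerSeries.X : ℝ⟦X⟧) ^ d ∣ B j - B' j) :
    (PowerSeries.X : ℝ⟦X⟧) ^ (d + 1) ∣ waveFunction κ θ lo hi B - waveFunction κ θ lo hi B' := by
  have hcoeff : ∀ e < d + 1, (fun m : ℝ => PowerSeries.coeff e (selfEnergy κ θ lo hi B' m 0)) =
      fun m : ℝ => PowerSeries.coeff e (selfEnergy κ θ lo hi B m 0) := by
    intro e he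
    funext m
    have := PowerSeries.X_pow_dvd_iff.1 (onePIFunction_congr κ θ lo hi h 2 ![m, 0]) e he
    rw [map_sub, sub_eq_zero] at this
    rw [selfEnergy, selfEnergy, this]
  rw [waveFunction, waveFunction, sub_sub_sub_cancel_left, ← mul_sub]
  refine Dvd.dvd.mul_left ?_ _
  rw [PowerSeries.X_pow_dvd_iff]
  intro e he
  rw [map_sub, PowerSeries.coeff_mk, PowerSeries.coeff_mk, hcoeff e he, sub_self]

theorem existsUnique_massSubtracted (κ : Model) (θ A : ℝ) (lo hi : ℕ) :
    ∃! B : ℕ → ℝ⟦X⟧, IsMassSubtracted κ θ A lo hi B := by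
  refine existsUnique_fixedPoint (fun B _ => PowerSeries.C A +
    PowerSeries.C (1 / ((4 * Real.pi) ^ 2 * θ)) * selfEnergy κ θ lo hi B 0 0) ?_
  intro d B B' h _
  rw [add_sub_add_left_eq_sub, ← mul_sub]
  exact (onePIFunction_congr κ θ lo hi h 2 _).mul_left _

theorem existsUnique_usefullySubtracted (κ : Model) (θ A : ℝ) (lo hi : ℕ) :
    ∃! B : ℕ → ℝ⟦X⟧, IsUsefullySubtracted κ θ A lo hi B := by
  refine existsUnique_fixedPoint (fun B j =>
    PowerSeries.C A * waveFunction κ θ (max lo (j + 1)) hi B +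
      PowerSeries.C (1 / ((4 * Real.pi) ^ 2 * θ)) * selfEnergy κ θ lo hi B 0 0) ?_
  intro d B B' h j
  rw [add_sub_add_comm, ← mul_sub, ← mul_sub]
  exact dvd_add ((waveFunction_congr κ θ _ hi h).mul_left _)
    ((onePIFunction_congr κ θ lo hi h 2 _).mul_left _)

end Contracting

/-! ### Coefficientwise derivatives -/

section CoeffDeriv

/-- Every coefficient of `f` is differentiable at `0`, with derivative the coefficient of `f'`. -/
def HasCoeffDeriv (f : ℝ → ℝ⟦X⟧) (f' : ℝ⟦X⟧) : Prop :=
  ∀ d, HasDerivAt (fun m => PowerSeries.coeff d (f m)) (PowerSeries.coeff d f') 0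

variable {f g : ℝ → ℝ⟦X⟧} {f' g' : ℝ⟦X⟧}

theorem HasCoeffDeriv.const (a : ℝ⟦X⟧) : HasCoeffDeriv (fun _ => a) 0 := fun d => by
  rw [map_zero]
  exact hasDerivAt_const _ _

theorem HasCoeffDeriv.mul (hf : HasCoeffDeriv f f') (hg : HasCoeffDeriv g g') :
    HasCoeffDeriv (fun m => f m * g m) (f' * g 0 + f 0 * g') := fun d => by
  rw [map_add, PowerSeries.coeff_mul, PowerSeries.coeff_mul, ← Finset.sum_add_distrib]
  simp only [PowerSeries.coeff_mul]
  exact HasDerivAt.fun_sum fun p _ => (hf p.1).mul (hg p.2)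

theorem HasCoeffDeriv.const_mul (a : ℝ⟦X⟧) (hf : HasCoeffDeriv f f') :
    HasCoeffDeriv (fun m => a * f m) (a * f') := by
  simpa using (HasCoeffDeriv.const a).mul hf

theorem HasCoeffDeriv.sum {ι : Type*} (s : Finset ι) {F : ι → ℝ → ℝ⟦X⟧} {F' : ι → ℝ⟦X⟧}
    (h : ∀ i ∈ s, HasCoeffDeriv (F i) (F' i)) :
    HasCoeffDeriv (fun m => ∑ i ∈ s, F i m) (∑ i ∈ s, F' i) := fun d => by
  simp only [map_sum]
  exact HasDerivAt.fun_sum fun i hi => h i hi d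

theorem HasCoeffDeriv.list_sum {ι : Type*} (L : List ι) {F : ι → ℝ → ℝ⟦X⟧} {F' : ι → ℝ⟦X⟧}
    (h : ∀ i ∈ L, HasCoeffDeriv (F i) (F' i)) :
    HasCoeffDeriv (fun m => (L.map fun i => F i m).sum) (L.map F').sum := by
  induction L with
  | nil => simpa using HasCoeffDeriv.const 0
  | cons i L ih =>
    intro d
    simp only [List.map_cons, List.sum_cons, map_add]
    exact (h i List.mem_cons_self d).add (ih (fun j hj => h j (List.mem_cons_of_mem _ hj)) d)

theorem HasCoeffDeriv.unique {f'' : ℝ⟦X⟧} (h : HasCoeffDeriv f f') (h' : HasCoeffDeriv f f'') :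
    f' = f'' :=
  PowerSeries.ext fun d => (h d).unique (h' d)

theorem HasCoeffDeriv.congr (h : HasCoeffDeriv f f') (hfg : g =ᶠ[𝓝 0] f) : HasCoeffDeriv g f' :=
  fun d => (h d).congr_of_eventuallyEq (hfg.mono fun m hm => by simp only [hm])

/-- Differentiability of the coefficients follows from their recursion; the value of the derivative
is then forced by `f * f⁻¹ = 1`, which holds near 0. -/
theorem HasCoeffDeriv.inv (hf : HasCoeffDeriv f f') (h0 : PowerSeries.constantCoeff (f 0) ≠ 0) :
    HasCoeffDeriv (fun m => (f m)⁻¹) (-((f 0)⁻¹ ^ 2 * f')) := by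
  have hc : HasDerivAt (fun m => PowerSeries.constantCoeff (f m))
      (PowerSeries.constantCoeff f') 0 := by
    simpa only [PowerSeries.coeff_zero_eq_constantCoeff_apply] using hf 0
  have hdiff : ∀ d, DifferentiableAt ℝ (fun m => PowerSeries.coeff d (f m)⁻¹) 0 := by
    intro d
    induction d using Nat.strong_induction_on with
    | _ d ih =>
      have hd : (fun m => PowerSeries.coeff d (f m)⁻¹) = fun m => _ :=
        funext fun m => PowerSeries.coeff_inv d (f m)
      rw [hd]
      split_ifs with hd
      · exact (hc.inv h0).differentiableAt
      · refine (hc.inv h0).differentiableAt.neg.mul (DifferentiableAt.fun_sum fun p _ => ?_)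
        split_ifs with hp
        · exact (hf p.1).differentiableAt.mul (ih p.2 hp)
        · exact differentiableAt_const _
  let g' : ℝ⟦X⟧ := PowerSeries.mk fun d => deriv (fun m => PowerSeries.coeff d (f m)⁻¹) 0
  have hg : HasCoeffDeriv (fun m => (f m)⁻¹) g' := fun d => by
    rw [PowerSeries.coeff_mk]
    exact (hdiff d).hasDerivAt
  have hone : HasCoeffDeriv (fun m => f m * (f m)⁻¹) 0 :=
    (HasCoeffDeriv.const 1).congr ((hc.continuousAt.eventually_ne h0).mono fun m hm =>
      PowerSeries.mul_inv_cancel _ hm)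
  have heq := (hf.mul hg).unique hone
  have hmul := PowerSeries.mul_inv_cancel (f 0) h0
  have : g' = -((f 0)⁻¹ ^ 2 * f') := by
    linear_combination (f 0)⁻¹ * heq - g' * hmul
  exact this ▸ hg

/-- Logarithmic derivative of a product. -/
theorem HasCoeffDeriv.list_prod {ι : Type*} (L : List ι) {F : ι → ℝ → ℝ⟦X⟧} {a : ι → ℝ⟦X⟧}
    (h : ∀ i ∈ L, HasCoeffDeriv (F i) (F i 0 * a i)) :
    HasCoeffDeriv (fun m => (L.map fun i => F i m).prod)
      ((L.map fun i => F i 0).prod * (L.map a).sum) := by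
  induction L with
  | nil => simpa using HasCoeffDeriv.const 1
  | cons i L ih =>
    simp only [List.map_cons, List.prod_cons, List.sum_cons]
    have := (h i List.mem_cons_self).mul (ih fun j hj => h j (List.mem_cons_of_mem _ hj))
    convert this using 1
    ring

end CoeffDeriv

/-! ### Values of graphs -/

section GraphValue

/-- The propagator `1 / (B + s + s')` of a line between faces of sizes `s` and `s'`. -/
def kernel (B : ℕ → ℝ⟦X⟧) (s s' : ℕ) : ℝ⟦X⟧ :=
  (B (max s s') + PowerSeries.C ((s : ℝ) + s'))⁻¹

theorem kernel_comm (B : ℕ → ℝ⟦X⟧) (s s' : ℕ) : kernel B s s' = kernel B s' s := by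
  rw [kernel, kernel, max_comm, add_comm (s : ℝ)]

/-- The product of the propagators of a graph, where `w` gives the sizes of the faces. -/
def graphValue (B : ℕ → ℝ⟦X⟧) (w : ℕ → ℕ) (G : List (ℕ × ℕ)) : ℝ⟦X⟧ :=
  (G.map fun p => kernel B (w p.1) (w p.2)).prod

/-- How many sides of a line belong to the first external face. -/
def legSides (p : ℕ × ℕ) : ℕ := (if p.1 = 1 then 1 else 0) + if p.2 = 1 then 1 else 0

/-- Minus the derivative of the value of a graph by the value of the first external face. -/
def graphSlope (B : ℕ → ℝ⟦X⟧) (w : ℕ → ℕ) (G : List (ℕ × ℕ)) : ℝ⟦X⟧ :=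
  graphValue B w G * (G.map fun p => (legSides p : ℝ⟦X⟧) * kernel B (w p.1) (w p.2)).sum

/-- The value of a list of graphs with `K` internal faces, summed over the values of these. -/
def valueSum (lo hi : ℕ) (B : ℕ → ℝ⟦X⟧) (N K : ℕ) (graphs : List (List (ℕ × ℕ))) : ℝ⟦X⟧ :=
  ∑ m ∈ Fintype.piFinset fun _ : Fin K => indices lo hi,
    (graphs.map (graphValue B (labelSize N m))).sum

/-- The slope of a list of graphs with `K` internal faces, summed over the values of these. -/
def slopeSum (lo hi : ℕ) (B : ℕ → ℝ⟦X⟧) (N K : ℕ) (graphs : List (List (ℕ × ℕ))) : ℝ⟦X⟧ :=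
  ∑ m ∈ Fintype.piFinset fun _ : Fin K => indices lo hi,
    (graphs.map (graphSlope B (labelSize N m))).sum

theorem sum_list_map_comm {ι κ M : Type*} [AddCommMonoid M] (s : Finset ι) (L : List κ)
    (f : κ → ι → M) :
    (L.map fun k => ∑ i ∈ s, f k i).sum = ∑ i ∈ s, (L.map fun k => f k i).sum := by
  induction L with
  | nil => simp
  | cons k L ih => simp [ih, Finset.sum_add_distrib]

theorem lineFactor_zero (θ : ℝ) (B : ℕ → ℝ⟦X⟧) (s s' : ℕ) :
    lineFactor θ B s s' 0 0 = PowerSeries.C (1 / ((4 * Real.pi) ^ 2 * θ)) * kernel B s s' := by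
  rw [lineFactor, kernel, add_zero, add_zero]

theorem graphSum_zero (θ : ℝ) (lo hi : ℕ) (B : ℕ → ℝ⟦X⟧) (N K : ℕ) (G : List (ℕ × ℕ)) :
    graphSum θ lo hi B (fun _ : Fin N => 0) K G =
      PowerSeries.C (1 / ((4 * Real.pi) ^ 2 * θ)) ^ G.length *
        ∑ m ∈ Fintype.piFinset fun _ : Fin K => indices lo hi,
          graphValue B (labelSize N m) G := by
  rw [graphSum, Finset.mul_sum]
  refine Finset.sum_congr rfl fun m _ => ?_
  have hz : ∀ l, labelValue (fun _ : Fin N => (0 : ℝ)) l = 0 := fun l => by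
    rw [labelValue]; split_ifs <;> rfl
  simp only [hz, lineFactor_zero, graphValue]
  induction G with
  | nil => simp
  | cons p G ih =>
    rw [List.map_cons, List.prod_cons, List.map_cons, List.prod_cons, ih, List.length_cons]
    ring

theorem sum_graphSum_zero (θ : ℝ) (lo hi : ℕ) (B : ℕ → ℝ⟦X⟧) (N K : ℕ) {l : ℕ}
    {graphs : List (List (ℕ × ℕ))} (hl : ∀ G ∈ graphs, G.length = l) :
    (graphs.map (graphSum θ lo hi B (fun _ : Fin N => 0) K)).sum =
      PowerSeries.C (1 / ((4 * Real.pi) ^ 2 * θ)) ^ l * valueSum lo hi B N K graphs := by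
  rw [valueSum, ← sum_list_map_comm, ← List.sum_map_mul_left]
  refine congrArg List.sum (List.map_congr_left fun G hG => ?_)
  rw [graphSum_zero, hl G hG]

/-- By the logarithmic derivative, each side of a line on the first external face contributes minus
one more copy of the propagator of that line. -/
theorem hasCoeffDeriv_graphSum (θ : ℝ) (lo hi : ℕ) {B : ℕ → ℝ⟦X⟧} {A : ℝ} (hA : 0 < A)
    (hB : ∀ j, PowerSeries.constantCoeff (B j) = A) (K : ℕ) (G : List (ℕ × ℕ)) :
    HasCoeffDeriv (fun m => graphSum θ lo hi B ![m, 0] K G)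
      (-(PowerSeries.C (1 / ((4 * Real.pi) ^ 2 * θ)) ^ G.length *
        ∑ m ∈ Fintype.piFinset fun _ : Fin K => indices lo hi,
          graphSlope B (labelSize 2 m) G)) := by
  rw [Finset.mul_sum, ← Finset.sum_neg_distrib]
  refine HasCoeffDeriv.sum _ fun i _ => ?_
  set w := labelSize 2 i
  -- Only the first external face, with label 1, carries the variable `m`.
  have hlabel : ∀ (m : ℝ) (l : ℕ), labelValue ![m, 0] l = (if l = 1 then 1 else 0) * m := by
    intro m l
    rcases l with _ | _ | _ | l
    · simp [labelValue]
    · simp [labelValue]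
    · simp [labelValue]
    · simp [labelValue]
  have hline : ∀ p ∈ G, HasCoeffDeriv
      (fun m => lineFactor θ B (w p.1) (w p.2) (labelValue ![m, 0] p.1) (labelValue ![m, 0] p.2))
      (lineFactor θ B (w p.1) (w p.2) (labelValue ![0, 0] p.1) (labelValue ![0, 0] p.2) *
        -((legSides p : ℝ⟦X⟧) * kernel B (w p.1) (w p.2))) := by
    intro p _
    have hin : HasCoeffDeriv (fun m => B (max (w p.1) (w p.2)) +
        PowerSeries.C ((w p.1 + labelValue ![m, 0] p.1) + (w p.2 + labelValue ![m, 0] p.2)))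
        (PowerSeries.C (legSides p : ℝ)) := by
      intro d
      simp only [map_add, hlabel]
      have : ∀ m : ℝ, PowerSeries.coeff d (PowerSeries.C ((if p.1 = 1 then 1 else 0) * m)) +
          PowerSeries.coeff d (PowerSeries.C ((if p.2 = 1 then 1 else 0) * m)) =
          PowerSeries.coeff d (PowerSeries.C (legSides p : ℝ)) * m := by
        intro m
        rw [PowerSeries.coeff_C, PowerSeries.coeff_C, PowerSeries.coeff_C, legSides]
        split_ifs <;> push_cast <;> ring
      have h2 : (fun m : ℝ => PowerSeries.coeff d (B (max (w p.1) (w p.2))) +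
          (PowerSeries.coeff d (PowerSeries.C (w p.1 : ℝ)) +
            PowerSeries.coeff d (PowerSeries.C ((if p.1 = 1 then 1 else 0) * m)) +
          (PowerSeries.coeff d (PowerSeries.C (w p.2 : ℝ)) +
            PowerSeries.coeff d (PowerSeries.C ((if p.2 = 1 then 1 else 0) * m))))) =
          fun m => (PowerSeries.coeff d (B (max (w p.1) (w p.2))) +
            PowerSeries.coeff d (PowerSeries.C (w p.1 : ℝ)) +
            PowerSeries.coeff d (PowerSeries.C (w p.2 : ℝ))) +
            PowerSeries.coeff d (PowerSeries.C (legSides p : ℝ)) * m := by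
        funext m
        rw [← this]
        ring
      rw [h2]
      have h3 := ((hasDerivAt_id (0 : ℝ)).const_mul
        (PowerSeries.coeff d (PowerSeries.C (legSides p : ℝ)))).const_add
        (PowerSeries.coeff d (B (max (w p.1) (w p.2))) +
          PowerSeries.coeff d (PowerSeries.C (w p.1 : ℝ)) +
          PowerSeries.coeff d (PowerSeries.C (w p.2 : ℝ)))
      rwa [mul_one] at h3
    have hzero : ∀ l, labelValue ![(0 : ℝ), 0] l = 0 := fun l => by rw [hlabel, mul_zero]
    have h0 : PowerSeries.constantCoeff (B (max (w p.1) (w p.2)) +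
        PowerSeries.C ((w p.1 + labelValue ![(0 : ℝ), 0] p.1) +
          (w p.2 + labelValue ![(0 : ℝ), 0] p.2))) ≠ 0 := by
      rw [map_add, hB, PowerSeries.constantCoeff_C, hzero, hzero]
      positivity
    have := (hin.inv h0).const_mul (PowerSeries.C (1 / ((4 * Real.pi) ^ 2 * θ)))
    convert this using 1
    · rfl
    · rw [lineFactor, kernel, hzero, hzero, add_zero, add_zero, map_natCast]
      ring
  have := HasCoeffDeriv.list_prod G hline
  convert this using 1
  have hzero : ∀ l, labelValue ![(0 : ℝ), 0] l = 0 := fun l => by rw [hlabel, mul_zero]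
  simp only [hzero, lineFactor_zero, graphSlope]
  rw [← mul_assoc, ← mul_neg]
  congr 1
  · rw [graphValue]
    clear this hline
    induction G with
    | nil => simp
    | cons p G ih =>
      rw [List.map_cons, List.prod_cons, List.map_cons, List.prod_cons, ← ih, List.length_cons]
      ring
  · clear this hline
    induction G with
    | nil => simp
    | cons p G ih =>
      rw [List.map_cons, List.sum_cons, List.map_cons, List.sum_cons, ← ih]
      ring

theorem hasCoeffDeriv_sum_graphSum (θ : ℝ) (lo hi : ℕ) {B : ℕ → ℝ⟦X⟧} {A : ℝ} (hA : 0 < A)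
    (hB : ∀ j, PowerSeries.constantCoeff (B j) = A) (K : ℕ) {l : ℕ}
    {graphs : List (List (ℕ × ℕ))} (hl : ∀ G ∈ graphs, G.length = l) :
    HasCoeffDeriv (fun m => (graphs.map (graphSum θ lo hi B ![m, 0] K)).sum)
      (-(PowerSeries.C (1 / ((4 * Real.pi) ^ 2 * θ)) ^ l * slopeSum lo hi B 2 K graphs)) := by
  have h := HasCoeffDeriv.list_sum graphs fun G _ => hasCoeffDeriv_graphSum θ lo hi hA hB K G
  convert h using 1
  rw [slopeSum, ← sum_list_map_comm, ← List.sum_map_mul_left, ← neg_one_mul,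
    ← List.sum_map_mul_left]
  refine congrArg List.sum (List.map_congr_left fun G hG => ?_)
  rw [hl G hG, neg_one_mul]

end GraphValue

/-! ### Expansion in the coupling -/

section Expansion

variable {κ : Model} {θ : ℝ} {lo hi : ℕ} {B : ℕ → ℝ⟦X⟧} {A : ℝ}

/-- The expansion parameter `X / 4`. -/
def quarterX : ℝ⟦X⟧ := PowerSeries.C (1 / 4) * PowerSeries.X

theorem X_dvd_quarterX : PowerSeries.X ∣ quarterX := dvd_mul_left _ _

theorem onePIFunction_sub_sum (κ : Model) (θ : ℝ) (lo hi : ℕ) (B : ℕ → ℝ⟦X⟧) (N : ℕ)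
    (x : Fin N → ℝ) (D : ℕ) : (PowerSeries.X : ℝ⟦X⟧) ^ D ∣
      onePIFunction κ θ lo hi B N x - ∑ n ∈ Finset.range D, orderTerm κ θ lo hi B n N x := by
  rw [PowerSeries.X_pow_dvd_iff]
  intro d hd
  rw [map_sub, map_sum, onePIFunction, PowerSeries.coeff_mk, sub_eq_zero]
  refine Finset.sum_subset (Finset.range_subset_range.2 hd) fun n _ hn => ?_
  exact PowerSeries.X_pow_dvd_iff.1 (X_pow_dvd_orderTerm κ θ lo hi B n N x) d (by simpa using hn)

/-- Each vertex beyond the first brings two further propagators, so the powers of π and θ drop out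
and the natural parameter is `X / 4`. -/
theorem vertexUnit_mul_sq (hθ : 0 < θ) :
    vertexUnit θ * PowerSeries.C (1 / ((4 * Real.pi) ^ 2 * θ)) ^ 2 = -quarterX := by
  have hπ := Real.pi_ne_zero
  rw [vertexUnit, quarterX, ← map_pow, neg_mul, mul_right_comm, ← map_mul]
  congr 3
  field_simp
  norm_num

theorem neg_mul_vertexUnit (hθ : 0 < θ) :
    -(PowerSeries.C (1 / (4 * Real.pi ^ 2 * θ ^ 2)) * vertexUnit θ) = bareCoupling := by
  have hπ := Real.pi_ne_zero
  rw [vertexUnit, bareCoupling, mul_neg, neg_neg, ← mul_assoc, ← map_mul]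
  congr 2
  field_simp
  norm_num

/-- A four-point graph with `n` vertices has `2 * (n - 1)` lines: one vertex factor becomes the bare
coupling and each of the others a factor `-quarterX`. -/
theorem Gamma4_expansion (hθ : 0 < θ) : (PowerSeries.X : ℝ⟦X⟧) ^ 5 ∣
    -(PowerSeries.C (1 / (4 * Real.pi ^ 2 * θ ^ 2)) * Gamma4 κ θ lo hi B) -
      bareCoupling * (1 - quarterX * valueSum lo hi B 4 1 fourPointGraphs₂ +
        quarterX ^ 2 * valueSum lo hi B 4 2 fourPointGraphs₃ -
        quarterX ^ 3 * valueSum lo hi B 4 3 fourPointGraphs₄) := by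
  have h := (onePIFunction_sub_sum κ θ lo hi B 4 (fun _ => 0) 5).mul_left
    (-PowerSeries.C (1 / (4 * Real.pi ^ 2 * θ ^ 2)))
  have h1 : valueSum lo hi B 4 0 fourPointGraphs₁ = 1 := by
    simp [valueSum, fourPointGraphs₁, graphValue]
  have hv := vertexUnit_mul_sq hθ
  have hb := neg_mul_vertexUnit hθ
  set a := PowerSeries.C (1 / ((4 * Real.pi) ^ 2 * θ)) with ha
  set b := PowerSeries.C (1 / (4 * Real.pi ^ 2 * θ ^ 2)) with hb'
  set v := vertexUnit θ
  rw [Finset.sum_range_succ, Finset.sum_range_succ, Finset.sum_range_succ, Finset.sum_range_succ,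
    Finset.sum_range_one, orderTerm_zero,
    orderTerm_eq_graphs (K := 0) (Or.inr rfl) (by norm_num) (by norm_num) κ θ lo hi B _
      filterMap_leaves_1_4,
    orderTerm_eq_graphs (K := 1) (Or.inr rfl) (by norm_num) (by norm_num) κ θ lo hi B _
      filterMap_leaves_2_4,
    orderTerm_eq_graphs (K := 2) (Or.inr rfl) (by norm_num) (by norm_num) κ θ lo hi B _
      filterMap_leaves_3_4,
    orderTerm_eq_graphs (K := 3) (Or.inr rfl) (by norm_num) (by norm_num) κ θ lo hi B _
      filterMap_leaves_4_4,
    sum_graphSum_zero θ lo hi B 4 0 (l := 0) (by decide),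
    sum_graphSum_zero θ lo hi B 4 1 (l := 2) (by decide),
    sum_graphSum_zero θ lo hi B 4 2 (l := 4) (by decide),
    sum_graphSum_zero θ lo hi B 4 3 (l := 6) (by decide), h1, ← ha] at h
  rw [← neg_eq_iff_eq_neg] at hv
  rw [← hv, ← hb]
  convert h using 1
  rw [Gamma4]
  ring

theorem selfEnergy_expansion (hθ : 0 < θ) : (PowerSeries.X : ℝ⟦X⟧) ^ 2 ∣
    PowerSeries.C (1 / ((4 * Real.pi) ^ 2 * θ)) * selfEnergy κ θ lo hi B 0 0 -
      -(quarterX * valueSum lo hi B 2 1 twoPointGraphs₁) := by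
  have h := (onePIFunction_sub_sum κ θ lo hi B 2 (fun _ => 0) 2).mul_left
    (PowerSeries.C (1 / ((4 * Real.pi) ^ 2 * θ)))
  have hv := vertexUnit_mul_sq hθ
  set a := PowerSeries.C (1 / ((4 * Real.pi) ^ 2 * θ)) with ha
  set v := vertexUnit θ
  rw [Finset.sum_range_succ, Finset.sum_range_one, orderTerm_zero,
    orderTerm_eq_graphs (K := 1) (Or.inl rfl) (by norm_num) (by norm_num) κ θ lo hi B _
      filterMap_leaves_1_2,
    sum_graphSum_zero θ lo hi B 2 1 (l := 1) (by decide), ← ha] at h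
  rw [← neg_eq_iff_eq_neg] at hv
  rw [← hv]
  have hx : (![0, 0] : Fin 2 → ℝ) = fun _ => 0 := by
    funext k; fin_cases k <;> rfl
  convert h using 1
  rw [selfEnergy, hx]
  ring

theorem hasCoeffDeriv_orderTerm (hA : 0 < A)
    (hB : ∀ j, PowerSeries.constantCoeff (B j) = A) {n K l : ℕ} (hK : 2 * (2 + K) = 2 * n + 2 + 2)
    (hn : 0 < n) {graphs : List (List (ℕ × ℕ))}
    (hg : (leaves n 2).filterMap (leafData K) = graphs.map some)
    (hl : ∀ G ∈ graphs, G.length = l) :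
    HasCoeffDeriv (fun m => orderTerm κ θ lo hi B n 2 ![m, 0])
      (-(vertexUnit θ ^ n * PowerSeries.C (1 / ((4 * Real.pi) ^ 2 * θ)) ^ l *
        slopeSum lo hi B 2 K graphs)) := by
  have h := (hasCoeffDeriv_sum_graphSum θ lo hi hA hB K hl).const_mul (vertexUnit θ ^ n)
  convert h using 1
  · funext m
    exact orderTerm_eq_graphs (Or.inl rfl) hK hn κ θ lo hi B _ hg
  · ring

/-- A two-point graph with `n` vertices has `2 * n - 1` lines, and the normalization of `Z` supplies
the missing propagator factor. Order 3 is enough, since the bare coupling contributes one more `X`.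
-/
theorem waveFunction_expansion (hθ : 0 < θ) (hA : 0 < A)
    (hB : ∀ j, PowerSeries.constantCoeff (B j) = A) : (PowerSeries.X : ℝ⟦X⟧) ^ 4 ∣
    waveFunction κ θ lo hi B - (1 - quarterX * slopeSum lo hi B 2 1 twoPointGraphs₁ +
      quarterX ^ 2 * slopeSum lo hi B 2 2 twoPointGraphs₂ -
      quarterX ^ 3 * slopeSum lo hi B 2 3 twoPointGraphs₃) := by
  have hv := vertexUnit_mul_sq hθ
  have h1 := hasCoeffDeriv_orderTerm (κ := κ) (θ := θ) (lo := lo) (hi := hi) hA hB (n := 1)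
    (K := 1) (l := 1) (by norm_num) (by norm_num) filterMap_leaves_1_2 (by decide)
  have h2 := hasCoeffDeriv_orderTerm (κ := κ) (θ := θ) (lo := lo) (hi := hi) hA hB (n := 2)
    (K := 2) (l := 3) (by norm_num) (by norm_num) filterMap_leaves_2_2 (by decide)
  have h3 := hasCoeffDeriv_orderTerm (κ := κ) (θ := θ) (lo := lo) (hi := hi) hA hB (n := 3)
    (K := 3) (l := 5) (by norm_num) (by norm_num) filterMap_leaves_3_2 (by decide)
  set a := PowerSeries.C (1 / ((4 * Real.pi) ^ 2 * θ)) with ha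
  set v := vertexUnit θ
  set s1 := slopeSum lo hi B 2 1 twoPointGraphs₁
  set s2 := slopeSum lo hi B 2 2 twoPointGraphs₂
  set s3 := slopeSum lo hi B 2 3 twoPointGraphs₃
  rw [← neg_eq_iff_eq_neg] at hv
  have key : (PowerSeries.X : ℝ⟦X⟧) ^ 4 ∣
      (PowerSeries.mk fun d =>
        deriv (fun m : ℝ => PowerSeries.coeff d (selfEnergy κ θ lo hi B m 0)) 0) -
      (-(v ^ 1 * a ^ 1 * s1) + -(v ^ 2 * a ^ 3 * s2) + -(v ^ 3 * a ^ 5 * s3)) := by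
    rw [PowerSeries.X_pow_dvd_iff]
    intro d hd
    rw [map_sub, PowerSeries.coeff_mk, sub_eq_zero, map_add, map_add]
    refine HasDerivAt.deriv ?_
    have hsum := ((h1 d).add (h2 d)).add (h3 d)
    convert hsum using 1
    funext m
    have := PowerSeries.X_pow_dvd_iff.1 (onePIFunction_sub_sum κ θ lo hi B 2 ![m, 0] 4) d hd
    rw [map_sub, sub_eq_zero, Finset.sum_range_succ, Finset.sum_range_succ, Finset.sum_range_succ,
      Finset.sum_range_one, orderTerm_zero, zero_add, map_add, map_add] at this
    exact this
  have := (key.mul_left (-a))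
  rw [← hv]
  convert this using 1
  rw [waveFunction]
  ring

end Expansion

/-! ### The lattice sums of low order -/

section LatticeSums

theorem sum_piFinset_succ {M : Type*} [AddCommMonoid M] {ι : Type*} (s : Finset ι) {K : ℕ}
    (f : (Fin (K + 1) → ι) → M) :
    ∑ m ∈ Fintype.piFinset fun _ : Fin (K + 1) => s, f m =
      ∑ p ∈ s, ∑ m ∈ Fintype.piFinset fun _ : Fin K => s, f (Fin.cons p m) := by
  rw [← Finset.sum_product']
  refine Finset.sum_bij' (fun m _ => (m 0, Fin.tail m)) (fun x _ => Fin.cons x.1 x.2) ?_ ?_ ?_ ?_ ?_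
  · intro m hm
    simp only [Fintype.mem_piFinset, Finset.mem_product] at hm ⊢
    exact ⟨hm 0, fun k => hm k.succ⟩
  · intro x hx
    simp only [Fintype.mem_piFinset, Finset.mem_product] at hx ⊢
    exact fun k => Fin.cases hx.1 hx.2 k
  · intro m _; exact Fin.cons_self_tail m
  · intro x _; simp
  · intro m _; rw [Fin.cons_self_tail]

theorem sum_piFinset_one {M : Type*} [AddCommMonoid M] {ι : Type*} (s : Finset ι)
    (f : (Fin 1 → ι) → M) :
    ∑ m ∈ Fintype.piFinset fun _ : Fin 1 => s, f m = ∑ p ∈ s, f ![p] := by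
  rw [sum_piFinset_succ]
  refine Finset.sum_congr rfl fun p _ => ?_
  rw [Fintype.piFinset_of_isEmpty, Fintype.sum_unique]
  exact congrArg f (funext fun k => by fin_cases k; rfl)

theorem sum_piFinset_two {M : Type*} [AddCommMonoid M] {ι : Type*} (s : Finset ι)
    (f : (Fin 2 → ι) → M) :
    ∑ m ∈ Fintype.piFinset fun _ : Fin 2 => s, f m = ∑ p ∈ s, ∑ q ∈ s, f ![p, q] := by
  rw [sum_piFinset_succ]
  exact Finset.sum_congr rfl fun p _ => sum_piFinset_one s _

theorem sum_piFinset_three {M : Type*} [AddCommMonoid M] {ι : Type*} (s : Finset ι)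
    (f : (Fin 3 → ι) → M) :
    ∑ m ∈ Fintype.piFinset fun _ : Fin 3 => s, f m =
      ∑ p ∈ s, ∑ q ∈ s, ∑ r ∈ s, f ![p, q, r] := by
  rw [sum_piFinset_succ]
  exact Finset.sum_congr rfl fun p _ => sum_piFinset_two s _

/-- The propagator of a line between an external face and the face with value `p`. -/
def outer (B : ℕ → ℝ⟦X⟧) (p : ℕ × ℕ) : ℝ⟦X⟧ := kernel B 0 (size p)

/-- The propagator of a line between the faces with values `p` and `q`. -/
def inner (B : ℕ → ℝ⟦X⟧) (p q : ℕ × ℕ) : ℝ⟦X⟧ := kernel B (size p) (size q)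

theorem inner_comm (B : ℕ → ℝ⟦X⟧) (p q : ℕ × ℕ) : inner B p q = inner B q p := kernel_comm _ _ _

variable {R : Type*} [CommRing R]

/-- The four-point graphs with four vertices; `a, b, c` are the propagators between the external
face and the three internal ones, and `d, e, f` those between the internal faces. -/
def fourPointPoly (a b c d e f : R) : R :=
    6 * a ^ 4 * b * c + 6 * a ^ 4 * b * e + 6 * a ^ 4 * c * d + 6 * a ^ 4 * d * e +
    6 * a ^ 3 * b ^ 2 * c + 2 * a ^ 3 * b ^ 2 * e + 4 * a ^ 3 * b ^ 2 * f +
    2 * a ^ 3 * b * c ^ 2 + 4 * a ^ 3 * b * c * d + 2 * a ^ 3 * b * c * e +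
    4 * a ^ 3 * b * d * e + 2 * a ^ 3 * b * e * f + 2 * a ^ 3 * c ^ 2 * d +
    2 * a ^ 3 * c * d * e + 2 * a ^ 3 * c * d * f + 4 * a ^ 3 * d ^ 2 * e +
    4 * a ^ 3 * d ^ 2 * f + 4 * a ^ 2 * b ^ 3 * c + 4 * a ^ 2 * b ^ 3 * f +
    2 * a ^ 2 * b ^ 2 * c ^ 2 + 4 * a ^ 2 * b ^ 2 * c * d + 2 * a ^ 2 * b ^ 2 * c * f +
    a ^ 2 * b ^ 2 * d * e + 3 * a ^ 2 * b ^ 2 * d * f + a ^ 2 * b ^ 2 * e * f +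
    a ^ 2 * b * c ^ 2 * d + 4 * a ^ 2 * b * c * d * e + 4 * a ^ 2 * b * c * d * f +
    a ^ 2 * b * c * e * f + 3 * a ^ 2 * b * d ^ 2 * e + 3 * a ^ 2 * b * d ^ 2 * f +
    a ^ 2 * c ^ 2 * d * f + 2 * a * b ^ 3 * c * d + 2 * a * b ^ 3 * d * f +
    a * b ^ 2 * c ^ 2 * d + a * b ^ 2 * c * d * e + 2 * a * b ^ 2 * c * d * f +
    a * b ^ 2 * d ^ 2 * e + a * b ^ 2 * d ^ 2 * f + a * b * c ^ 2 * d * e + a * b * c ^ 2 * d * f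

/-- The slopes of the two-point graphs with three vertices. -/
def slopePoly (a b c d e f : R) : R :=
    3 * a ^ 4 * b * c + 3 * a ^ 4 * b * e + 3 * a ^ 4 * c * d + 3 * a ^ 4 * d * e +
    3 * a ^ 3 * b ^ 2 * c + a ^ 3 * b ^ 2 * e + 2 * a ^ 3 * b ^ 2 * f + a ^ 3 * b * c ^ 2 +
    a ^ 3 * c ^ 2 * d + 2 * a ^ 3 * c * d * f + 2 * a ^ 3 * d ^ 2 * e + 2 * a ^ 3 * d ^ 2 * f +
    2 * a ^ 2 * b ^ 3 * c + 2 * a ^ 2 * b ^ 3 * f + a ^ 2 * b ^ 2 * c ^ 2 +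
    a ^ 2 * b ^ 2 * c * d + a ^ 2 * b ^ 2 * d * e + a ^ 2 * c ^ 2 * d * f +
    2 * a * b ^ 3 * c * d + 2 * a * b ^ 3 * d * f + a * b ^ 2 * c ^ 2 * d +
    a * b ^ 2 * c * d * e + a * b ^ 2 * c * d * f + a * b ^ 2 * d ^ 2 * e +
    a * b ^ 2 * d ^ 2 * f + a * b * c ^ 2 * d * e

variable (lo hi : ℕ) (B : ℕ → ℝ⟦X⟧)

/-- External faces have size 0 and the labels after `N` receive the summation indices, so in this
and the following sums each graph is a monomial in `outer` and `inner`. -/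
theorem valueSum_two_one :
    valueSum lo hi B 2 1 twoPointGraphs₁ = ∑ p ∈ indices lo hi, 2 * outer B p := by
  rw [valueSum, sum_piFinset_one]
  refine Finset.sum_congr rfl fun p _ => ?_
  simp [twoPointGraphs₁, graphValue, labelSize, outer, two_mul]

theorem valueSum_four_one :
    valueSum lo hi B 4 1 fourPointGraphs₂ = ∑ p ∈ indices lo hi, 2 * outer B p ^ 2 := by
  rw [valueSum, sum_piFinset_one]
  refine Finset.sum_congr rfl fun p _ => ?_
  simp [fourPointGraphs₂, graphValue, labelSize, outer]
  ring

theorem valueSum_four_two :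
    valueSum lo hi B 4 2 fourPointGraphs₃ = ∑ p ∈ indices lo hi, ∑ q ∈ indices lo hi,
      (4 * outer B p ^ 3 * outer B q + 4 * outer B p ^ 3 * inner B p q +
        2 * outer B p ^ 2 * outer B q ^ 2 + 3 * outer B p ^ 2 * outer B q * inner B p q +
        outer B p * outer B q ^ 2 * inner B p q) := by
  rw [valueSum, sum_piFinset_two]
  refine Finset.sum_congr rfl fun p _ => Finset.sum_congr rfl fun q _ => ?_
  simp [fourPointGraphs₃, graphValue, labelSize, outer, inner]
  ring

theorem valueSum_four_three :
    valueSum lo hi B 4 3 fourPointGraphs₄ =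
      ∑ p ∈ indices lo hi, ∑ q ∈ indices lo hi, ∑ r ∈ indices lo hi,
        fourPointPoly (outer B p) (outer B q) (outer B r) (inner B p q) (inner B p r)
          (inner B q r) := by
  rw [valueSum, sum_piFinset_three]
  refine Finset.sum_congr rfl fun p _ => Finset.sum_congr rfl fun q _ =>
    Finset.sum_congr rfl fun r _ => ?_
  simp [fourPointGraphs₄, graphValue, labelSize, outer, inner, fourPointPoly]
  ring

theorem slopeSum_one :
    slopeSum lo hi B 2 1 twoPointGraphs₁ = ∑ p ∈ indices lo hi, outer B p ^ 2 := by
  rw [slopeSum, sum_piFinset_one]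
  refine Finset.sum_congr rfl fun p _ => ?_
  simp [twoPointGraphs₁, graphSlope, graphValue, legSides, labelSize, outer]
  ring

theorem slopeSum_two :
    slopeSum lo hi B 2 2 twoPointGraphs₂ = ∑ p ∈ indices lo hi, ∑ q ∈ indices lo hi,
      (2 * outer B p ^ 3 * outer B q + 2 * outer B p ^ 3 * inner B p q +
        outer B p ^ 2 * outer B q ^ 2 + outer B p * outer B q ^ 2 * inner B p q) := by
  rw [slopeSum, sum_piFinset_two]
  refine Finset.sum_congr rfl fun p _ => Finset.sum_congr rfl fun q _ => ?_
  simp [twoPointGraphs₂, graphSlope, graphValue, legSides, labelSize, outer, inner]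
  ring

theorem slopeSum_three :
    slopeSum lo hi B 2 3 twoPointGraphs₃ =
      ∑ p ∈ indices lo hi, ∑ q ∈ indices lo hi, ∑ r ∈ indices lo hi,
        slopePoly (outer B p) (outer B q) (outer B r) (inner B p q) (inner B p r)
          (inner B q r) := by
  rw [slopeSum, sum_piFinset_three]
  refine Finset.sum_congr rfl fun p _ => Finset.sum_congr rfl fun q _ =>
    Finset.sum_congr rfl fun r _ => ?_
  simp [twoPointGraphs₃, graphSlope, graphValue, legSides, labelSize, outer, inner, slopePoly]
  ring

end LatticeSums

/-! ### The coefficients of the effective coupling -/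

section Symmetrization

variable {ι : Type*}

theorem sum_eq_zero_of_swap (s : Finset ι) (f : ι → ι → ℝ)
    (h : ∀ p ∈ s, ∀ q ∈ s, f p q + f q p = 0) : ∑ p ∈ s, ∑ q ∈ s, f p q = 0 := by
  have h1 : ∑ p ∈ s, ∑ q ∈ s, f q p = ∑ p ∈ s, ∑ q ∈ s, f p q := Finset.sum_comm
  have h2 : ∑ p ∈ s, ∑ q ∈ s, (f p q + f q p) = 0 :=
    Finset.sum_eq_zero fun p hp => Finset.sum_eq_zero fun q hq => h p hp q hq
  simp only [Finset.sum_add_distrib, h1] at h2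
  linarith

/-- All three indices range over the same set, so the sum is unchanged by permuting them and may be
averaged over the six orders. -/
theorem sum_eq_zero_of_permutations (s : Finset ι) (f : ι → ι → ι → ℝ)
    (h : ∀ p ∈ s, ∀ q ∈ s, ∀ r ∈ s,
      f p q r + f p r q + f q p r + f q r p + f r p q + f r q p = 0) :
    ∑ p ∈ s, ∑ q ∈ s, ∑ r ∈ s, f p q r = 0 := by
  have h1 : ∀ g : ι → ι → ι → ℝ,
      ∑ p ∈ s, ∑ q ∈ s, ∑ r ∈ s, g p r q = ∑ p ∈ s, ∑ q ∈ s, ∑ r ∈ s, g p q r :=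
    fun g => Finset.sum_congr rfl fun p _ => Finset.sum_comm
  have h2 : ∀ g : ι → ι → ι → ℝ,
      ∑ p ∈ s, ∑ q ∈ s, ∑ r ∈ s, g q p r = ∑ p ∈ s, ∑ q ∈ s, ∑ r ∈ s, g p q r :=
    fun g => Finset.sum_comm
  have h3 : ∑ p ∈ s, ∑ q ∈ s, ∑ r ∈ s,
      (f p q r + f p r q + f q p r + f q r p + f r p q + f r q p) = 0 :=
    Finset.sum_eq_zero fun p hp => Finset.sum_eq_zero fun q hq => Finset.sum_eq_zero fun r hr =>
      h p hp q hq r hr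
  simp only [Finset.sum_add_distrib] at h3
  have e1 := h1 f
  have e2 := h2 f
  have e3 := (h1 fun p q r => f q p r).trans e2
  have e4 := (h2 fun p q r => f p r q).trans e1
  have e5 := (h1 fun p q r => f q r p).trans e4
  linarith

/-- The third-order cancellation as a rational identity in x = A+p, y = A+q, z = A+r, where A+p+q =
x+y-A. The lines of `f` are, in turn, the mass counterterm, the reduced graph polynomial, the
product of the slopes s₁ and s₂, the term s₁ γ₂, and γ₃. -/
theorem permutations_eq_zero {A x y z : ℝ} (hx : x ≠ 0) (hy : y ≠ 0) (hz : z ≠ 0)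
    (hxy : x + y - A ≠ 0) (hxz : x + z - A ≠ 0) (hyz : y + z - A ≠ 0)
    {f : ℝ → ℝ → ℝ → ℝ → ℝ → ℝ → ℝ}
    (hf : f = fun a b c d e f => (8 * a ^ 3 * b * c * d + 4 * a ^ 2 * b ^ 2 * c * d +
        4 * a ^ 2 * b * c * d ^ 2 - 4 * a ^ 3 * b ^ 2 * c - 4 * a ^ 2 * b ^ 3 * c) -
      (4 * a ^ 3 * b * c * d + 4 * a ^ 3 * b * d * e + 2 * a ^ 2 * b ^ 2 * c * d +
        2 * a ^ 2 * b ^ 2 * c * e + 2 * a ^ 2 * b ^ 2 * d * e + 4 * a ^ 2 * b * c * d * e +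
        4 * a ^ 2 * b * c * d * f + 2 * a ^ 2 * b * d ^ 2 * e + 2 * a ^ 2 * b * d ^ 2 * f) +
      2 * c ^ 2 * (2 * a ^ 3 * b + 2 * a ^ 3 * d + a ^ 2 * b ^ 2 + a * b ^ 2 * d) +
      2 * A * c ^ 2 * a ^ 2 * b ^ 2 * d +
      2 * ((2 * A ^ 2 * a ^ 3 * b ^ 2 * d + A ^ 2 * a ^ 2 * b ^ 2 * d ^ 2) * (c * e) -
        A * a ^ 2 * b * d ^ 2 * (c * f))) :
    f x⁻¹ y⁻¹ z⁻¹ (x + y - A)⁻¹ (x + z - A)⁻¹ (y + z - A)⁻¹ +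
      f x⁻¹ z⁻¹ y⁻¹ (x + z - A)⁻¹ (x + y - A)⁻¹ (y + z - A)⁻¹ +
      f y⁻¹ x⁻¹ z⁻¹ (x + y - A)⁻¹ (y + z - A)⁻¹ (x + z - A)⁻¹ +
      f y⁻¹ z⁻¹ x⁻¹ (y + z - A)⁻¹ (x + y - A)⁻¹ (x + z - A)⁻¹ +
      f z⁻¹ x⁻¹ y⁻¹ (x + z - A)⁻¹ (y + z - A)⁻¹ (x + y - A)⁻¹ +
      f z⁻¹ y⁻¹ x⁻¹ (y + z - A)⁻¹ (x + z - A)⁻¹ (x + y - A)⁻¹ = 0 := by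
  subst hf
  field_simp
  ring

/-- Most monomials of the four-point and slope polynomials cancel by symmetry alone, without any
relation between the propagators; nine remain. -/
theorem permutations_poly_eq (a b c d e f : ℝ) {h : ℝ → ℝ → ℝ → ℝ → ℝ → ℝ → ℝ}
    (hh : h = fun a b c d e f => fourPointPoly a b c d e f - 2 * slopePoly a b c d e f -
      (4 * a ^ 3 * b * c * d + 4 * a ^ 3 * b * d * e + 2 * a ^ 2 * b ^ 2 * c * d +
        2 * a ^ 2 * b ^ 2 * c * e + 2 * a ^ 2 * b ^ 2 * d * e + 4 * a ^ 2 * b * c * d * e +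
        4 * a ^ 2 * b * c * d * f + 2 * a ^ 2 * b * d ^ 2 * e + 2 * a ^ 2 * b * d ^ 2 * f)) :
    h a b c d e f + h a c b e d f + h b a c d f e + h b c a f d e + h c a b e f d +
      h c b a f e d = 0 := by
  subst hh
  simp only [fourPointPoly, slopePoly]
  ring

end Symmetrization

/-! ### Order-by-order cancellations in the lattice sums -/

section Coefficients

variable {κ : Model} {θ A : ℝ} {lo hi : ℕ} {B : ℕ → ℝ⟦X⟧}

/-- The summand of `γ₃` for mass parameters with first coefficients
`- ∑ r, (2 / (A + r) + e j r)`, up to the factor `4`. -/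
def gammaThreeSummand (A : ℝ) (e : ℕ → ℕ × ℕ → ℝ) (p q r : ℕ × ℕ) : ℝ :=
  gammaThreeTerm A 0 p q r + 1 / 64 *
    ((e (size p) r + e (size q) r - e (max (size p) (size q)) r) /
        ((A + size p) ^ 2 * (A + size q) ^ 2 * (A + size p + size q)) -
      2 * A * e (size p) r / ((A + size p) ^ 3 * (A + size q) ^ 2 * (A + size p + size q)) -
      2 * A * e (size q) r / ((A + size p) ^ 2 * (A + size q) ^ 3 * (A + size p + size q)) -
      A * e (max (size p) (size q)) r /
        ((A + size p) ^ 2 * (A + size q) ^ 2 * (A + size p + size q) ^ 2))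

theorem constantCoeff_kernel (hB : ∀ j, PowerSeries.constantCoeff (B j) = A) (s s' : ℕ) :
    PowerSeries.constantCoeff (kernel B s s') = (A + s + s')⁻¹ := by
  rw [kernel, PowerSeries.constantCoeff_inv, map_add, hB, PowerSeries.constantCoeff_C, add_assoc]

theorem coeff_one_kernel (hA : 0 < A) (hB : ∀ j, PowerSeries.constantCoeff (B j) = A)
    (s s' : ℕ) : PowerSeries.coeff 1 (kernel B s s') =
      -((A + s + s')⁻¹ ^ 2 * PowerSeries.coeff 1 (B (max s s'))) := by
  have h0 : (A + s + s' : ℝ) ≠ 0 := by positivity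
  have hc : PowerSeries.constantCoeff (B (max s s') + PowerSeries.C ((s : ℝ) + s')) =
      A + s + s' := by
    rw [map_add, hB, PowerSeries.constantCoeff_C, add_assoc]
  have h := congrArg (PowerSeries.coeff 1)
    (PowerSeries.mul_inv_cancel (B (max s s') + PowerSeries.C ((s : ℝ) + s')) (hc.trans_ne h0))
  rw [PowerSeries.coeff_one_mul, hc, PowerSeries.constantCoeff_inv, hc, map_add,
    PowerSeries.coeff_C, if_neg one_ne_zero, add_zero, PowerSeries.coeff_one,
    if_neg one_ne_zero] at h
  rw [kernel]
  field_simp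
  field_simp at h
  linarith

/-- In the notation a, b, d for the three inverses, symmetrization gives 2ab(a+b)d - 2a²b², and
ab(a+b)d = a²b²(1 + Ad) leaves 2A a²b²d. -/
theorem sum_gammaTwoTerm_eq (hA : 0 < A) (s : Finset (ℕ × ℕ)) :
    ∑ p ∈ s, ∑ q ∈ s, (2 * (A + size p)⁻¹ ^ 2 * (A + size q)⁻¹ * (A + size p + size q)⁻¹ -
      (A + size p)⁻¹ ^ 2 * (A + size q)⁻¹ ^ 2) =
      16 * ∑ p ∈ s, ∑ q ∈ s, gammaTwoTerm A p q := by
  simp only [Finset.mul_sum]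
  rw [← sub_eq_zero, ← Finset.sum_sub_distrib]
  simp only [← Finset.sum_sub_distrib]
  refine sum_eq_zero_of_swap s _ fun p _ q _ => ?_
  have h1 : (A + size p : ℝ) ≠ 0 := by positivity
  have h2 : (A + size q : ℝ) ≠ 0 := by positivity
  have h3 : (A + size p + size q : ℝ) ≠ 0 := by positivity
  have h4 : (A + size q + size p : ℝ) ≠ 0 := by positivity
  simp only [gammaTwoTerm]
  rw [show (A + size q + size p : ℝ) = A + size p + size q by ring]
  field_simp
  ring

/-- The part of the third order that comes from the first coefficients `e` of the mass
parameters. -/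
theorem sum_counterterm_eq (hA : 0 < A) (e : ℕ → ℕ × ℕ → ℝ) (s : Finset (ℕ × ℕ)) :
    ∑ p ∈ s, ∑ q ∈ s, ∑ r ∈ s,
      (4 * (A + size p)⁻¹ ^ 3 * (A + size q)⁻¹ * (A + size p + size q)⁻¹ * e (size p) r +
        2 * (A + size p)⁻¹ ^ 2 * (A + size q)⁻¹ ^ 2 * (A + size p + size q)⁻¹ * e (size q) r +
        2 * (A + size p)⁻¹ ^ 2 * (A + size q)⁻¹ * (A + size p + size q)⁻¹ ^ 2 *
          e (max (size p) (size q)) r -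
        2 * (A + size p)⁻¹ ^ 3 * (A + size q)⁻¹ ^ 2 * e (size p) r -
        2 * (A + size p)⁻¹ ^ 2 * (A + size q)⁻¹ ^ 3 * e (size q) r +
        64 * (gammaThreeSummand A e p q r - gammaThreeTerm A 0 p q r)) = 0 := by
  refine (Finset.sum_congr rfl fun p _ => Finset.sum_comm).trans (Finset.sum_comm.trans
    (Finset.sum_eq_zero fun r _ => sum_eq_zero_of_swap s _ fun p _ q _ => ?_))
  have h1 : (A + size p : ℝ) ≠ 0 := by positivity
  have h2 : (A + size q : ℝ) ≠ 0 := by positivity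
  have h3 : (A + size p + size q : ℝ) ≠ 0 := by positivity
  simp only [gammaThreeSummand, max_comm (size q) (size p), add_sub_cancel_left]
  rw [show (A + size q + size p : ℝ) = A + size p + size q by ring]
  generalize e (size p) r = ep
  generalize e (size q) r = eq
  generalize e (max (size p) (size q)) r = em
  field_simp
  ring

/-- The third-order part that is present with mass subtraction alone; the effect of further
counterterms is split off into `sum_counterterm_eq`. -/
theorem sum_triple_eq (hA : 0 < A) (s : Finset (ℕ × ℕ)) :
    ∑ p ∈ s, ∑ q ∈ s, ∑ r ∈ s,
      ((8 * (A + size p)⁻¹ ^ 3 * (A + size q)⁻¹ * (A + size r)⁻¹ * (A + size p + size q)⁻¹ +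
        4 * (A + size p)⁻¹ ^ 2 * (A + size q)⁻¹ ^ 2 * (A + size r)⁻¹ *
          (A + size p + size q)⁻¹ +
        4 * (A + size p)⁻¹ ^ 2 * (A + size q)⁻¹ * (A + size r)⁻¹ *
          (A + size p + size q)⁻¹ ^ 2 -
        4 * (A + size p)⁻¹ ^ 3 * (A + size q)⁻¹ ^ 2 * (A + size r)⁻¹ -
        4 * (A + size p)⁻¹ ^ 2 * (A + size q)⁻¹ ^ 3 * (A + size r)⁻¹) -
      (fourPointPoly (A + size p : ℝ)⁻¹ (A + size q)⁻¹ (A + size r)⁻¹ (A + size p + size q)⁻¹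
          (A + size p + size r)⁻¹ (A + size q + size r)⁻¹ -
        2 * slopePoly (A + size p : ℝ)⁻¹ (A + size q)⁻¹ (A + size r)⁻¹ (A + size p + size q)⁻¹
          (A + size p + size r)⁻¹ (A + size q + size r)⁻¹) +
      2 * (A + size r)⁻¹ ^ 2 * (2 * (A + size p)⁻¹ ^ 3 * (A + size q)⁻¹ +
        2 * (A + size p)⁻¹ ^ 3 * (A + size p + size q)⁻¹ +
        (A + size p)⁻¹ ^ 2 * (A + size q)⁻¹ ^ 2 +
        (A + size p)⁻¹ * (A + size q)⁻¹ ^ 2 * (A + size p + size q)⁻¹) +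
      32 * (A + size r)⁻¹ ^ 2 * gammaTwoTerm A p q + 64 * gammaThreeTerm A 0 p q r) = 0 := by
  refine sum_eq_zero_of_permutations s _ fun p _ q _ r _ => ?_
  have h1 : (A + size p : ℝ) ≠ 0 := by positivity
  have h2 : (A + size q : ℝ) ≠ 0 := by positivity
  have h3 : (A + size r : ℝ) ≠ 0 := by positivity
  have e1 : ∀ p q : ℕ × ℕ, (A + size p + size q : ℝ) = (A + size p) + (A + size q) - A :=
    fun p q => by ring
  have h4 : ∀ p q : ℕ × ℕ, (A + size p : ℝ) + (A + size q) - A ≠ 0 := fun p q => by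
    rw [← e1]; positivity
  -- `k1` uses the relations between the six propagators, `k2` is polynomial. Afterwards the
  -- propagators are generalized, so that only linear algebra on monomials remains.
  have k1 := permutations_eq_zero h1 h2 h3 (h4 p q) (h4 p r) (h4 q r) rfl
  have k2 := permutations_poly_eq (A + size p : ℝ)⁻¹ (A + size q)⁻¹ (A + size r)⁻¹
    ((A + size p) + (A + size q) - A)⁻¹ ((A + size p) + (A + size r) - A)⁻¹
    ((A + size q) + (A + size r) - A)⁻¹ rfl
  simp only [gammaTwoTerm, gammaThreeTerm, e1, div_eq_mul_inv, mul_inv, sub_zero,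
    ← inv_pow] at k1 k2 ⊢
  rw [show (A + size q : ℝ) + (A + size p) = (A + size p) + (A + size q) by ring,
    show (A + size r : ℝ) + (A + size p) = (A + size p) + (A + size r) by ring,
    show (A + size r : ℝ) + (A + size q) = (A + size q) + (A + size r) by ring]
  generalize (A + size p : ℝ)⁻¹ = a at k1 k2 ⊢
  generalize (A + size q : ℝ)⁻¹ = b at k1 k2 ⊢
  generalize (A + size r : ℝ)⁻¹ = c at k1 k2 ⊢
  generalize ((A + size p : ℝ) + (A + size q) - A)⁻¹ = d at k1 k2 ⊢
  generalize ((A + size p : ℝ) + (A + size r) - A)⁻¹ = e at k1 k2 ⊢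
  generalize ((A + size q : ℝ) + (A + size r) - A)⁻¹ = f at k1 k2 ⊢
  simp only [fourPointPoly, slopePoly] at k2 ⊢
  linear_combination k1 - k2

end Coefficients

/-! ### The effective coupling to third order -/

section EffectiveCoupling

variable {κ : Model} {θ A : ℝ} {lo hi : ℕ} {B : ℕ → ℝ⟦X⟧}

theorem constantCoeff_waveFunction (hθ : 0 < θ) (hA : 0 < A)
    (hB : ∀ j, PowerSeries.constantCoeff (B j) = A) :
    PowerSeries.constantCoeff (waveFunction κ θ lo hi B) = 1 := by
  have h := PowerSeries.X_pow_dvd_iff.1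
    (waveFunction_expansion (κ := κ) (lo := lo) (hi := hi) hθ hA hB) 0 (by norm_num)
  rw [PowerSeries.coeff_zero_eq_constantCoeff_apply, map_sub, sub_eq_zero] at h
  rw [h]
  simp [quarterX]

theorem coeff_one_waveFunction (hθ : 0 < θ) (hA : 0 < A)
    (hB : ∀ j, PowerSeries.constantCoeff (B j) = A) :
    4 * PowerSeries.coeff 1 (waveFunction κ θ lo hi B) =
      -∑ r ∈ indices lo hi, (A + size r : ℝ)⁻¹ ^ 2 := by
  have h := PowerSeries.X_pow_dvd_iff.1
    (waveFunction_expansion (κ := κ) (lo := lo) (hi := hi) hθ hA hB) 1 (by norm_num)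
  rw [map_sub, sub_eq_zero] at h
  rw [h, slopeSum_one]
  simp [quarterX, PowerSeries.coeff_one_mul, mul_pow, outer, constantCoeff_kernel hB,
    PowerSeries.coeff_C, PowerSeries.coeff_one_pow, PowerSeries.coeff_one]

theorem constantCoeff_selfEnergy (κ : Model) (θ : ℝ) (lo hi : ℕ) (B : ℕ → ℝ⟦X⟧) (m n : ℝ) :
    PowerSeries.constantCoeff (selfEnergy κ θ lo hi B m n) = 0 := by
  rw [← PowerSeries.coeff_zero_eq_constantCoeff_apply, selfEnergy, onePIFunction,
    PowerSeries.coeff_mk, Finset.sum_range_one, orderTerm_zero, map_zero]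

theorem coeff_one_selfEnergy (hθ : 0 < θ) (hB : ∀ j, PowerSeries.constantCoeff (B j) = A) :
    4 * PowerSeries.coeff 1 (PowerSeries.C (1 / ((4 * Real.pi) ^ 2 * θ)) *
      selfEnergy κ θ lo hi B 0 0) = -∑ r ∈ indices lo hi, 2 * (A + size r : ℝ)⁻¹ := by
  have h := PowerSeries.X_pow_dvd_iff.1
    (selfEnergy_expansion (κ := κ) (lo := lo) (hi := hi) (B := B) hθ) 1 (by norm_num)
  rw [map_sub, sub_eq_zero] at h
  rw [h, valueSum_two_one]
  simp [quarterX, PowerSeries.coeff_one_mul, outer, constantCoeff_kernel hB,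
    PowerSeries.coeff_C, map_ofNat]

/-- The coefficient of x² in the quotient. It is kept as a power series, because its linear term,
through `B`, enters the third order. -/
theorem valueSum_sub_slopeSum (lo hi : ℕ) (B : ℕ → ℝ⟦X⟧) :
    valueSum lo hi B 4 2 fourPointGraphs₃ - slopeSum lo hi B 2 1 twoPointGraphs₁ ^ 2 -
        2 * slopeSum lo hi B 2 2 twoPointGraphs₂ =
      ∑ p ∈ indices lo hi, ∑ q ∈ indices lo hi,
        (2 * outer B p ^ 2 * outer B q * inner B p q - outer B p ^ 2 * outer B q ^ 2) := by
  rw [valueSum_four_two, slopeSum_one, slopeSum_two, sq (∑ p ∈ indices lo hi, outer B p ^ 2),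
    Finset.sum_mul_sum]
  have hswap : ∑ p ∈ indices lo hi, ∑ q ∈ indices lo hi,
      outer B p * outer B q ^ 2 * inner B p q =
      ∑ p ∈ indices lo hi, ∑ q ∈ indices lo hi, outer B p ^ 2 * outer B q * inner B p q := by
    rw [Finset.sum_comm]
    refine Finset.sum_congr rfl fun p _ => Finset.sum_congr rfl fun q _ => ?_
    rw [inner_comm]
    ring
  have h : ∀ p q, 2 * outer B p ^ 2 * outer B q * inner B p q - outer B p ^ 2 * outer B q ^ 2 =
      (4 * outer B p ^ 3 * outer B q + 4 * outer B p ^ 3 * inner B p q +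
        2 * outer B p ^ 2 * outer B q ^ 2 + 3 * outer B p ^ 2 * outer B q * inner B p q +
        outer B p * outer B q ^ 2 * inner B p q) - outer B p ^ 2 * outer B q ^ 2 -
      2 * (2 * outer B p ^ 3 * outer B q + 2 * outer B p ^ 3 * inner B p q +
        outer B p ^ 2 * outer B q ^ 2 + outer B p * outer B q ^ 2 * inner B p q) +
      outer B p * outer B q ^ 2 * inner B p q - outer B p ^ 2 * outer B q * inner B p q := by
    intro p q; ring
  simp only [h, Finset.sum_add_distrib, Finset.sum_sub_distrib, ← Finset.mul_sum] at hswap ⊢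
  linear_combination -hswap

theorem constantCoeff_second_order (hA : 0 < A) (hB : ∀ j, PowerSeries.constantCoeff (B j) = A) :
    PowerSeries.constantCoeff (∑ p ∈ indices lo hi, ∑ q ∈ indices lo hi,
        (2 * outer B p ^ 2 * outer B q * inner B p q - outer B p ^ 2 * outer B q ^ 2)) =
      16 * ∑ p ∈ indices lo hi, ∑ q ∈ indices lo hi, gammaTwoTerm A p q := by
  rw [← sum_gammaTwoTerm_eq hA]
  simp [outer, inner, constantCoeff_kernel hB, map_ofNat]

/-- The propagators depend on `X` through `B` only. The line from an external face to `p` has scale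
|p|, the line between `p` and `q` the larger of the two scales. -/
theorem coeff_one_second_order (hA : 0 < A) (hB : ∀ j, PowerSeries.constantCoeff (B j) = A)
    {e : ℕ → ℕ × ℕ → ℝ} (he : ∀ j, 4 * PowerSeries.coeff 1 (B j) =
      -∑ r ∈ indices lo hi, (2 * (A + size r)⁻¹ + e j r)) :
    4 * PowerSeries.coeff 1 (∑ p ∈ indices lo hi, ∑ q ∈ indices lo hi,
        (2 * outer B p ^ 2 * outer B q * inner B p q - outer B p ^ 2 * outer B q ^ 2)) =
      ∑ p ∈ indices lo hi, ∑ q ∈ indices lo hi, ∑ r ∈ indices lo hi,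
        (4 * (A + size p)⁻¹ ^ 3 * (A + size q)⁻¹ * (A + size p + size q)⁻¹ *
            (2 * (A + size r)⁻¹ + e (size p) r) +
          2 * (A + size p)⁻¹ ^ 2 * (A + size q)⁻¹ ^ 2 * (A + size p + size q)⁻¹ *
            (2 * (A + size r)⁻¹ + e (size q) r) +
          2 * (A + size p)⁻¹ ^ 2 * (A + size q)⁻¹ * (A + size p + size q)⁻¹ ^ 2 *
            (2 * (A + size r)⁻¹ + e (max (size p) (size q)) r) -
          2 * (A + size p)⁻¹ ^ 3 * (A + size q)⁻¹ ^ 2 * (2 * (A + size r)⁻¹ + e (size p) r) -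
          2 * (A + size p)⁻¹ ^ 2 * (A + size q)⁻¹ ^ 3 *
            (2 * (A + size r)⁻¹ + e (size q) r)) := by
  simp only [map_sum, Finset.mul_sum]
  refine Finset.sum_congr rfl fun p _ => Finset.sum_congr rfl fun q _ => ?_
  rw [Finset.sum_sub_distrib, Finset.sum_sub_distrib, Finset.sum_add_distrib,
    Finset.sum_add_distrib, ← Finset.mul_sum, ← Finset.mul_sum, ← Finset.mul_sum,
    ← Finset.mul_sum, ← Finset.mul_sum]
  have hp := he (size p)
  have hq := he (size q)
  have hm := he (max (size p) (size q))
  rw [eq_neg_iff_add_eq_zero, add_comm, ← eq_neg_iff_add_eq_zero] at hp hq hm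
  rw [hp, hq, hm]
  have h2 : PowerSeries.coeff 1 (2 : ℝ⟦X⟧) = 0 := by
    rw [← map_ofNat (PowerSeries.C (R := ℝ)), PowerSeries.coeff_C, if_neg one_ne_zero]
  simp only [map_sub, PowerSeries.coeff_one_mul, PowerSeries.coeff_one_pow, map_mul, map_pow,
    outer, inner, coeff_one_kernel hA hB, constantCoeff_kernel hB, h2, map_ofNat,
    Nat.cast_zero, add_zero, max_eq_right (Nat.zero_le _)]
  push_cast
  ring

/-- The coefficient of x³ in the quotient is -64 γ₃. The first term is multiplied by 4 because X =
4x. -/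
theorem coeff_one_eq (hA : 0 < A) (hB : ∀ j, PowerSeries.constantCoeff (B j) = A)
    {e : ℕ → ℕ × ℕ → ℝ} (he : ∀ j, 4 * PowerSeries.coeff 1 (B j) =
      -∑ r ∈ indices lo hi, (2 * (A + size r)⁻¹ + e j r)) :
    4 * PowerSeries.coeff 1 (∑ p ∈ indices lo hi, ∑ q ∈ indices lo hi,
        (2 * outer B p ^ 2 * outer B q * inner B p q - outer B p ^ 2 * outer B q ^ 2)) -
      PowerSeries.constantCoeff (valueSum lo hi B 4 3 fourPointGraphs₄ -
        2 * slopeSum lo hi B 2 3 twoPointGraphs₃ - 2 * slopeSum lo hi B 2 1 twoPointGraphs₁ *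
          slopeSum lo hi B 2 2 twoPointGraphs₂) +
      32 * (∑ p ∈ indices lo hi, ∑ q ∈ indices lo hi, gammaTwoTerm A p q) *
        PowerSeries.constantCoeff (slopeSum lo hi B 2 1 twoPointGraphs₁) +
      64 * ∑ p ∈ indices lo hi, ∑ q ∈ indices lo hi, ∑ r ∈ indices lo hi,
        gammaThreeSummand A e p q r = 0 := by
  rw [coeff_one_second_order hA hB he, valueSum_four_three, slopeSum_three, slopeSum_one,
    slopeSum_two]
  have h1 := sum_triple_eq hA (indices lo hi)
  have h2 := sum_counterterm_eq hA e (indices lo hi)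
  have hprod : ∀ (f : ℕ × ℕ → ℝ) (g : ℕ × ℕ → ℕ × ℕ → ℝ) (s : Finset (ℕ × ℕ)),
      (∑ r ∈ s, f r) * ∑ p ∈ s, ∑ q ∈ s, g p q = ∑ p ∈ s, ∑ q ∈ s, ∑ r ∈ s, f r * g p q := by
    intro f g s
    simp only [Finset.mul_sum, Finset.sum_mul]
  simp only [map_sub, map_mul, map_ofNat, map_sum, map_add, map_pow, fourPointPoly, slopePoly,
    outer, inner, constantCoeff_kernel hB, Nat.cast_zero, add_zero]
  rw [mul_assoc (2 : ℝ), hprod, mul_assoc (32 : ℝ), mul_comm (∑ p ∈ indices lo hi,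
    ∑ q ∈ indices lo hi, gammaTwoTerm A p q), hprod]
  refine Eq.trans ?_ ((congrArg₂ HAdd.hAdd h1 h2).trans (add_zero (0 : ℝ)))
  simp only [Finset.mul_sum, ← Finset.sum_add_distrib, ← Finset.sum_sub_distrib]
  refine Finset.sum_congr rfl fun p _ => Finset.sum_congr rfl fun q _ =>
    Finset.sum_congr rfl fun r _ => ?_
  simp only [fourPointPoly, slopePoly]
  ring

theorem hasExpansion_effectiveCoupling (hθ : 0 < θ) (hA : 0 < A)
    (hB : ∀ j, PowerSeries.constantCoeff (B j) = A)
    {e : ℕ → ℕ × ℕ → ℝ} (he : ∀ j, 4 * PowerSeries.coeff 1 (B j) =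
      -∑ r ∈ indices lo hi, (2 * (A + size r)⁻¹ + e j r)) :
    HasExpansion (effectiveCoupling κ θ lo hi B)
      (∑ p ∈ indices lo hi, ∑ q ∈ indices lo hi, gammaTwoTerm A p q)
      (∑ p ∈ indices lo hi, ∑ q ∈ indices lo hi, ∑ r ∈ indices lo hi,
        gammaThreeSummand A e p q r) := by
  have hΓ := Gamma4_expansion (κ := κ) (lo := lo) (hi := hi) (B := B) hθ
  have hZ := waveFunction_expansion (κ := κ) (lo := lo) (hi := hi) hθ hA hB
  have h0 := constantCoeff_second_order (lo := lo) (hi := hi) hA hB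
  have h1 := coeff_one_eq hA hB he
  have hW := valueSum_sub_slopeSum lo hi B
  -- The one-loop four-point function equals twice the one-loop slope, with `B` left arbitrary;
  -- hence there is no first-order term.
  have hG2 : valueSum lo hi B 4 1 fourPointGraphs₂ =
      2 * slopeSum lo hi B 2 1 twoPointGraphs₁ := by
    rw [valueSum_four_one, slopeSum_one, Finset.mul_sum]
  have hone : waveFunction κ θ lo hi B ^ 2 * (waveFunction κ θ lo hi B ^ 2)⁻¹ = 1 :=
    PowerSeries.mul_inv_cancel _ (by
      rw [map_pow, constantCoeff_waveFunction hθ hA hB]; norm_num)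
  rw [← hW] at h0 h1
  rw [hG2] at hΓ
  rw [HasExpansion, effectiveCoupling]
  set γ₂ := ∑ p ∈ indices lo hi, ∑ q ∈ indices lo hi, gammaTwoTerm A p q
  set γ₃ := ∑ p ∈ indices lo hi, ∑ q ∈ indices lo hi, ∑ r ∈ indices lo hi,
    gammaThreeSummand A e p q r
  set s1 := slopeSum lo hi B 2 1 twoPointGraphs₁
  set s2 := slopeSum lo hi B 2 2 twoPointGraphs₂
  set s3 := slopeSum lo hi B 2 3 twoPointGraphs₃
  set G3 := valueSum lo hi B 4 2 fourPointGraphs₃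
  set G4 := valueSum lo hi B 4 3 fourPointGraphs₄
  set Z := waveFunction κ θ lo hi B
  set Γ := PowerSeries.C (1 / (4 * Real.pi ^ 2 * θ ^ 2)) * Gamma4 κ θ lo hi B
  set c₂ : ℝ⟦X⟧ := PowerSeries.C γ₂ with hc₂
  set c₃ : ℝ⟦X⟧ := PowerSeries.C γ₃ with hc₃
  have h4 : (PowerSeries.X : ℝ⟦X⟧) = 4 * quarterX := by
    rw [quarterX, ← map_ofNat (PowerSeries.C (R := ℝ)), ← mul_assoc, ← map_mul]
    norm_num
  -- The constant term is `h0` and the linear term is `h1`; multiplied by `quarterX ^ 2` this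
  -- settles the orders 2 and 3.
  have key : (PowerSeries.X : ℝ⟦X⟧) ^ 2 ∣ (G3 - s1 ^ 2 - 2 * s2 - 16 * c₂) -
      quarterX * (G4 - 2 * s3 - 2 * s1 * s2 - 32 * c₂ * s1 - 64 * c₃) := by
    rw [PowerSeries.X_pow_dvd_iff]
    intro d hd
    interval_cases d
    · rw [PowerSeries.coeff_zero_eq_constantCoeff_apply, map_sub, map_sub, h0, map_mul,
        map_mul, quarterX, map_mul, PowerSeries.constantCoeff_X, map_ofNat, hc₂,
        PowerSeries.constantCoeff_C]
      ring
    · have hc : PowerSeries.coeff 1 (16 * c₂) = 0 := by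
        rw [← map_ofNat (PowerSeries.C (R := ℝ)), ← map_mul, PowerSeries.coeff_C,
          if_neg one_ne_zero]
      have hq0 : PowerSeries.constantCoeff quarterX = 0 := by simp [quarterX]
      have hq1 : PowerSeries.coeff 1 quarterX = 1 / 4 := by simp [quarterX]
      rw [map_sub, map_sub, hc, PowerSeries.coeff_one_mul, hq0, hq1]
      simp only [map_sub, map_mul, map_ofNat, hc₂, hc₃, PowerSeries.constantCoeff_C] at h1 ⊢
      linear_combination h1 / 4
  have hg := X_dvd_quarterX
  obtain ⟨w, hw⟩ := key
  obtain ⟨y, hy⟩ := hΓ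
  obtain ⟨z, hz⟩ := hZ
  obtain ⟨t, ht⟩ : (PowerSeries.X : ℝ⟦X⟧) ∣ bareCoupling := dvd_mul_left _ _
  obtain ⟨T, hT⟩ : ∃ T, T = 1 - quarterX * s1 + quarterX ^ 2 * s2 - quarterX ^ 3 * s3 := ⟨_, rfl⟩
  rw [← hT] at hz
  -- The quotient is compared after multiplication by the squared denominator; `hrest` collects the
  -- exact remainder, all of order `quarterX ^ 4`.
  have hlow : (PowerSeries.X : ℝ⟦X⟧) ^ 4 ∣
      (1 - quarterX * (2 * s1) + quarterX ^ 2 * G3 - quarterX ^ 3 * G4) -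
        (1 + c₂ * PowerSeries.X ^ 2 - c₃ * PowerSeries.X ^ 3) * T ^ 2 := by
    have hg4 : (PowerSeries.X : ℝ⟦X⟧) ^ 4 ∣ quarterX ^ 4 := pow_dvd_pow_of_dvd hg 4
    have hg2 : (PowerSeries.X : ℝ⟦X⟧) ^ 4 ∣ quarterX ^ 2 * (PowerSeries.X ^ 2 * w) := by
      rw [← mul_assoc]
      refine Dvd.dvd.mul_right ?_ _
      have := mul_dvd_mul (pow_dvd_pow_of_dvd hg 2) (dvd_refl (PowerSeries.X ^ 2 : ℝ⟦X⟧))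
      rwa [← pow_add] at this
    rw [← hw] at hg2
    have hrest : (PowerSeries.X : ℝ⟦X⟧) ^ 4 ∣
        quarterX ^ 4 * (-(2 * s1 * s3) - (s2 - quarterX * s3) ^ 2 -
        16 * c₂ * ((s1 - quarterX * s2 + quarterX ^ 2 * s3) ^ 2 + 2 * (s2 - quarterX * s3)) +
        64 * c₃ * (-2 * s1 + quarterX *
          ((s1 - quarterX * s2 + quarterX ^ 2 * s3) ^ 2 + 2 * (s2 - quarterX * s3)))) :=
      hg4.mul_right _
    have := dvd_add hg2 hrest
    rw [h4] at this ⊢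
    refine this.trans (dvd_of_eq ?_)
    rw [hT]
    ring
  have : -(Γ * (Z ^ 2)⁻¹) - bareCoupling * (1 + c₂ * PowerSeries.X ^ 2 - c₃ * PowerSeries.X ^ 3) =
      (Z ^ 2)⁻¹ * ((-Γ - bareCoupling *
          (1 - quarterX * (2 * s1) + quarterX ^ 2 * G3 - quarterX ^ 3 * G4)) +
        bareCoupling * (((1 - quarterX * (2 * s1) + quarterX ^ 2 * G3 - quarterX ^ 3 * G4) -
          (1 + c₂ * PowerSeries.X ^ 2 - c₃ * PowerSeries.X ^ 3) * T ^ 2) -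
        (1 + c₂ * PowerSeries.X ^ 2 - c₃ * PowerSeries.X ^ 3) * ((Z - T) * (Z + T)))) := by
    linear_combination (bareCoupling * (1 + c₂ * PowerSeries.X ^ 2 -
      c₃ * PowerSeries.X ^ 3)) * hone
  rw [this, hy]
  refine Dvd.dvd.mul_left (dvd_add (dvd_mul_right _ _) ?_) _
  rw [pow_succ' (PowerSeries.X : ℝ⟦X⟧) 4]
  refine mul_dvd_mul (Dvd.intro t ht.symm) (dvd_sub hlow (Dvd.dvd.mul_left ?_ _))
  rw [hz]
  exact (dvd_mul_right _ _).mul_right _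

end EffectiveCoupling

/-! ### The subtracted mass parameters to first order -/

section FirstOrder

variable {κ : Model} {θ A : ℝ} {lo hi : ℕ} {B : ℕ → ℝ⟦X⟧}

/-- The two tadpoles of the self-energy give the first coefficient `-∑ 2 / (A + r)`, up to the
factor 4, so there is no additional counterterm `e`. -/
theorem hasExpansion_of_isMassSubtracted (hθ : 0 < θ) (hA : 0 < A)
    (h : IsMassSubtracted κ θ A lo hi B) :
    HasExpansion (effectiveCoupling κ θ lo hi B)
      (∑ p ∈ indices lo hi, ∑ q ∈ indices lo hi, gammaTwoTerm A p q)
      (∑ p ∈ indices lo hi, ∑ q ∈ indices lo hi, ∑ r ∈ indices lo hi,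
        gammaThreeTerm A 0 p q r) := by
  have hB : ∀ j, PowerSeries.constantCoeff (B j) = A := fun j => by
    rw [h j, map_add, map_mul, constantCoeff_selfEnergy, mul_zero, add_zero,
      PowerSeries.constantCoeff_C]
  have h1 := hasExpansion_effectiveCoupling (κ := κ) (lo := lo) (hi := hi) hθ hA hB
    (e := fun _ _ => 0) fun j => by
      simp only [add_zero]
      rw [← coeff_one_selfEnergy (κ := κ) hθ hB, h j, map_add, PowerSeries.coeff_C,
        if_neg one_ne_zero, zero_add]
  simpa [gammaThreeSummand] using h1

/-- The first coefficient of the useful wave function counterterm. -/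
def usefulCounterterm (A : ℝ) (j : ℕ) (r : ℕ × ℕ) : ℝ :=
  if j < size r then A / (A + size r) ^ 2 else 0

theorem hasExpansion_of_isUsefullySubtracted (hθ : 0 < θ) (hA : 0 < A)
    (h : IsUsefullySubtracted κ θ A lo hi B) :
    HasExpansion (effectiveCoupling κ θ lo hi B)
      (∑ p ∈ indices lo hi, ∑ q ∈ indices lo hi, gammaTwoTerm A p q)
      (∑ p ∈ indices lo hi, ∑ q ∈ indices lo hi, ∑ r ∈ indices lo hi,
        gammaThreeSummand A (usefulCounterterm A) p q r) := by
  have hwave : ∀ lo' : ℕ, PowerSeries.coeff 0 (waveFunction κ θ lo' hi B) = 1 := by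
    intro lo'
    have hderiv : (fun m : ℝ => PowerSeries.coeff 0 (selfEnergy κ θ lo' hi B m 0)) =
        fun _ => 0 := funext fun m => by
      rw [PowerSeries.coeff_zero_eq_constantCoeff_apply, constantCoeff_selfEnergy]
    rw [waveFunction, map_sub, PowerSeries.coeff_C_mul, PowerSeries.coeff_mk, hderiv]
    simp
  have hB : ∀ j, PowerSeries.constantCoeff (B j) = A := fun j => by
    rw [h j, map_add, map_mul, map_mul, constantCoeff_selfEnergy, mul_zero, add_zero,
      PowerSeries.constantCoeff_C, ← PowerSeries.coeff_zero_eq_constantCoeff_apply, hwave, mul_one]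
  refine hasExpansion_effectiveCoupling hθ hA hB fun j => ?_
  -- Restricting the faces to sizes above `j` amounts to raising the infrared cutoff to `max lo (j +
  -- 1)`.
  have hfilter : ∑ r ∈ indices lo hi, usefulCounterterm A j r =
      A * ∑ r ∈ indices (max lo (j + 1)) hi, (A + size r : ℝ)⁻¹ ^ 2 := by
    simp only [usefulCounterterm]
    rw [← Finset.sum_filter, Finset.mul_sum]
    refine Finset.sum_congr (Finset.ext fun r => ?_) fun r _ => ?_
    · simp only [indices, Finset.mem_filter, Finset.mem_product, Finset.mem_range]
      omega
    · rw [inv_pow, div_eq_mul_inv]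
  rw [Finset.sum_add_distrib, hfilter, h j, map_add, mul_add, coeff_one_selfEnergy hθ hB,
    PowerSeries.coeff_C_mul, mul_left_comm, coeff_one_waveFunction hθ hA hB]
  ring

end FirstOrder

/-! ### Summability -/

section Summability

variable {A : ℝ}

/-- A summand for `γ₃`, with useful wave function subtractions, that is absolutely summable. -/
def gammaThreeUseful (A : ℝ) (p q r : ℕ × ℕ) : ℝ :=
  gammaThreeTerm A (usefulSubtraction A p q r) p q r +
    if size p < size r ∧ size r ≤ size q then
      A / 32 * (1 - 2 * A / (A + size p)) *
        (1 / ((A + size p) ^ 2 * (A + size q) ^ 2 * (A + size p + size q) * (A + size r) ^ 2))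
    else 0

/-- The two summands agree after symmetrization in `p` and `q`; absolute summability is proved for
the second form. -/
theorem sum_gammaThreeUseful (hA : 0 < A) (s : Finset (ℕ × ℕ)) :
    ∑ p ∈ s, ∑ q ∈ s, ∑ r ∈ s, gammaThreeSummand A (usefulCounterterm A) p q r =
      ∑ p ∈ s, ∑ q ∈ s, ∑ r ∈ s, gammaThreeUseful A p q r := by
  rw [← sub_eq_zero]
  simp only [← Finset.sum_sub_distrib]
  refine (Finset.sum_congr rfl fun p _ => Finset.sum_comm).trans (Finset.sum_comm.trans
    (Finset.sum_eq_zero fun r _ => sum_eq_zero_of_swap s _ fun p _ q _ => ?_))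
  have h1 : (A + size p : ℝ) ≠ 0 := by positivity
  have h2 : (A + size q : ℝ) ≠ 0 := by positivity
  have h3 : (A + size r : ℝ) ≠ 0 := by positivity
  have h4 : (A + size p + size q : ℝ) ≠ 0 := by positivity
  have h5 : (A + size p + size r : ℝ) ≠ 0 := by positivity
  have h6 : (A + size q + size r : ℝ) ≠ 0 := by positivity
  simp only [gammaThreeSummand, gammaThreeUseful, gammaThreeTerm, usefulCounterterm,
    usefulSubtraction, max_lt_iff, add_right_comm A (size q : ℝ) (size p : ℝ)]
  -- If `r` exceeds both, the counterterms build the subtraction of the tadpoles; if it exceeds just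
  -- one, the remainder in `gammaThreeUseful`; otherwise they vanish.
  by_cases hp : size p < size r <;> by_cases hq : size q < size r <;>
    simp only [hp, hq, not_lt.1, not_le.2, and_self, and_true, and_false, if_true, if_false,
      not_false_eq_true] <;> field_simp <;> ring

theorem summable_rpow_size (hA : 1 ≤ A) :
    Summable fun p : ℕ × ℕ => (A + size p : ℝ) ^ (-(9 / 4) : ℝ) := by
  have h1 : Summable fun n : ℕ => ((n : ℝ) + 1) ^ (-(9 / 8) : ℝ) := by
    have := (summable_nat_add_iff 1).2 (Real.summable_nat_rpow.2
      (by norm_num : (-(9 / 8) : ℝ) < -1))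
    simpa using this
  have h2 := h1.mul_of_nonneg h1 (fun n => by positivity) (fun n => by positivity)
  refine Summable.of_nonneg_of_le (fun p => by positivity) (fun p => ?_) h2
  have h0 : (0 : ℝ) ≤ p.1 := Nat.cast_nonneg _
  have h0' : (0 : ℝ) ≤ p.2 := Nat.cast_nonneg _
  have hs : (size p : ℝ) = p.1 + p.2 := by simp [size]
  have hpos : (0 : ℝ) < A + size p := by positivity
  rw [← Real.mul_rpow (by positivity) (by positivity)]
  -- This distributes the exponent 9/4 evenly over the two components, each with 9/8 > 1.
  have hle : ((p.1 : ℝ) + 1) * (p.2 + 1) ≤ (A + size p) ^ (2 : ℝ) := by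
    rw [Real.rpow_two, hs]
    nlinarith
  calc (A + size p : ℝ) ^ (-(9 / 4) : ℝ) = ((A + size p : ℝ) ^ (2 : ℝ)) ^ (-(9 / 8) : ℝ) := by
        rw [← Real.rpow_mul hpos.le]; norm_num
    _ ≤ _ := Real.rpow_le_rpow_of_nonpos (by positivity) hle (by norm_num)

/-- The single power of `m` is shared out as a fourth root to each of `a`, `b`, `d`, which turns the
critical exponent 2 into the summable 9/4; one fourth root of `m` is left over. -/
theorem inv_le_rpow_mul {a b d m : ℝ} (ha : 1 ≤ a) (hb : 1 ≤ b) (hd : 1 ≤ d) (ham : a ≤ m)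
    (hbm : b ≤ m) (hdm : d ≤ m) :
    1 / (a ^ 2 * b ^ 2 * d ^ 2 * m) ≤
      a ^ (-(9 / 4) : ℝ) * (b ^ (-(9 / 4) : ℝ) * d ^ (-(9 / 4) : ℝ)) := by
  have hsplit : ∀ x : ℝ, 1 ≤ x → x ^ (-(9 / 4) : ℝ) = 1 / (x ^ 2 * x ^ (1 / 4 : ℝ)) := by
    intro x hx
    rw [Real.rpow_neg (by positivity), one_div, ← Real.rpow_two, ← Real.rpow_add (by positivity)]
    norm_num
  have hm : (1 : ℝ) ≤ m := ha.trans ham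
  have hroot : a ^ (1 / 4 : ℝ) * b ^ (1 / 4 : ℝ) * d ^ (1 / 4 : ℝ) ≤ m := by
    calc a ^ (1 / 4 : ℝ) * b ^ (1 / 4 : ℝ) * d ^ (1 / 4 : ℝ)
        ≤ m ^ (1 / 4 : ℝ) * m ^ (1 / 4 : ℝ) * m ^ (1 / 4 : ℝ) := by gcongr
      _ = m ^ (3 / 4 : ℝ) := by
          rw [← Real.rpow_add (by positivity), ← Real.rpow_add (by positivity)]; norm_num
      _ ≤ m ^ (1 : ℝ) := Real.rpow_le_rpow_of_exponent_le hm (by norm_num)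
      _ = m := Real.rpow_one m
  rw [hsplit a ha, hsplit b hb, hsplit d hd, div_mul_div_comm, div_mul_div_comm, mul_one, mul_one]
  refine one_div_le_one_div_of_le (by positivity) ?_
  calc a ^ 2 * a ^ (1 / 4 : ℝ) * (b ^ 2 * b ^ (1 / 4 : ℝ) * (d ^ 2 * d ^ (1 / 4 : ℝ)))
      = a ^ 2 * b ^ 2 * d ^ 2 * (a ^ (1 / 4 : ℝ) * b ^ (1 / 4 : ℝ) * d ^ (1 / 4 : ℝ)) := by ring
    _ ≤ a ^ 2 * b ^ 2 * d ^ 2 * m := by gcongr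

theorem summable_triple (hA : 1 ≤ A) : Summable fun t : (ℕ × ℕ) × (ℕ × ℕ) × (ℕ × ℕ) =>
    (A + size t.1 : ℝ) ^ (-(9 / 4) : ℝ) * ((A + size t.2.1 : ℝ) ^ (-(9 / 4) : ℝ) *
      (A + size t.2.2 : ℝ) ^ (-(9 / 4) : ℝ)) := by
  have h := summable_rpow_size hA
  have hA0 : 0 < A := by linarith
  exact h.mul_of_nonneg (h.mul_of_nonneg h (fun p => by positivity) (fun p => by positivity))
    (fun p => by positivity) (fun p => by positivity)

theorem summable_gammaTwoTerm (hA : 1 ≤ A) :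
    Summable fun t : (ℕ × ℕ) × (ℕ × ℕ) => gammaTwoTerm A t.1 t.2 := by
  have h := summable_rpow_size hA
  have hA0 : 0 < A := by linarith
  have h2 := (h.mul_of_nonneg h (fun p => by positivity) (fun p => by positivity)).mul_left (A / 16)
  refine Summable.of_nonneg_of_le (fun t => ?_) (fun t => ?_) h2
  · rw [gammaTwoTerm]; positivity
  · rw [gammaTwoTerm]
    have hp : (0 : ℝ) ≤ size t.1 := Nat.cast_nonneg _
    have hq : (0 : ℝ) ≤ size t.2 := Nat.cast_nonneg _
    have := inv_le_rpow_mul (a := A + size t.1) (b := A + size t.2) (d := 1)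
      (m := A + size t.1 + size t.2) (by linarith) (by linarith) le_rfl (by linarith)
      (by linarith) (by linarith)
    rw [one_pow, mul_one, Real.one_rpow, mul_one] at this
    gcongr

/-- The bound for `gammaThreeTerm` with useful subtraction, in terms of `a = A + p`, `b = A + q`,
`d = A + r` and an upper bound `m` of these. -/
theorem abs_gammaThreeTerm_le (hA : 1 ≤ A) (p q r : ℕ × ℕ) :
    |gammaThreeTerm A (usefulSubtraction A p q r) p q r| ≤ A ^ 2 *
      ((A + size p : ℝ) ^ (-(9 / 4) : ℝ) * ((A + size q : ℝ) ^ (-(9 / 4) : ℝ) *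
      (A + size r : ℝ) ^ (-(9 / 4) : ℝ))) := by
  have hp : (0 : ℝ) ≤ size p := Nat.cast_nonneg _
  have hq : (0 : ℝ) ≤ size q := Nat.cast_nonneg _
  have hr : (0 : ℝ) ≤ size r := Nat.cast_nonneg _
  have hA0 : 0 < A := by linarith
  -- The bound `m` is `A + r` where the subtraction acts and `A + p + q` elsewhere.
  suffices ∃ m : ℝ, A + size p ≤ m ∧ A + size q ≤ m ∧ A + size r ≤ m ∧
      |gammaThreeTerm A (usefulSubtraction A p q r) p q r| ≤
        A ^ 2 * (1 / ((A + size p) ^ 2 * (A + size q) ^ 2 * (A + size r) ^ 2 * m)) by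
    obtain ⟨m, h1, h2, h3, h4⟩ := this
    refine h4.trans ?_
    gcongr
    exact inv_le_rpow_mul (by linarith) (by linarith) (by linarith) h1 h2 h3
  have habs : ∀ x y z X Y : ℝ, 0 ≤ x → 0 ≤ y → 0 ≤ z →
      |1 / 32 * ((x + y) * X - z * Y)| ≤ 1 / 32 * (x * |X| + y * |X| + z * |Y|) := by
    intro x y z X Y hx hy hz
    rw [abs_mul, abs_of_pos (by norm_num : (0 : ℝ) < 1 / 32)]
    gcongr
    refine (abs_sub _ _).trans ?_
    rw [abs_mul, abs_mul, abs_of_nonneg (add_nonneg hx hy), abs_of_nonneg hz, add_mul]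
  rw [gammaThreeTerm, usefulSubtraction]
  set a : ℝ := A + size p with ha
  set b : ℝ := A + size q with hb
  set d : ℝ := A + size r with hd
  set c : ℝ := a + size q with hc
  have ha1 : 1 ≤ a := by linarith
  have hb1 : 1 ≤ b := by linarith
  have hd1 : 1 ≤ d := by linarith
  have hca : a ≤ c := by linarith
  have hcb : b ≤ c := by linarith
  have hc1 : 1 ≤ c := by linarith
  split_ifs with h
  · have h1 : (size p : ℝ) ≤ size r := by exact_mod_cast h.1.le
    have h2 : (size q : ℝ) ≤ size r := by exact_mod_cast h.2.le
    refine ⟨d, by linarith, by linarith, le_rfl, (habs _ _ _ _ _ (by positivity) (by positivity)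
      (by positivity)).trans ?_⟩
    -- The subtraction improves the tadpole from `d⁻²` to `d⁻³` at the price of a factor `a` or `b`,
    -- which the prefactors can afford.
    have hsub : ∀ x y : ℝ, 0 ≤ x → x ≤ y → |1 / (d * (d + x)) - 1 / d ^ 2| ≤ y / d ^ 3 := by
      intro x y hx hxy
      have : 1 / (d * (d + x)) - 1 / d ^ 2 = -(x / (d ^ 2 * (d + x))) := by
        field_simp
        ring
      rw [this, abs_neg, abs_of_nonneg (by positivity)]
      have hy : 0 ≤ y := hx.trans hxy
      have : d ^ 3 ≤ d ^ 2 * (d + x) := by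
        rw [pow_succ]; gcongr; linarith
      gcongr
    have e1 := hsub (size p) a hp (by linarith)
    have e2 := hsub (size q) b hq (by linarith)
    rw [show a + size r = d + size p by rw [ha, hd]; ring,
      show b + size r = d + size q by rw [hb, hd]; ring]
    have t1 : 2 * A ^ 2 / (a ^ 3 * b ^ 2 * c) * (a / d ^ 3) ≤
        2 * A ^ 2 * (1 / (a ^ 2 * b ^ 2 * d ^ 2 * d)) := by
      rw [div_mul_div_comm, mul_one_div, div_le_div_iff₀ (by positivity) (by positivity)]
      have : 2 * A ^ 2 * (a ^ 3 * b ^ 2 * d ^ 3) * 1 ≤ 2 * A ^ 2 * (a ^ 3 * b ^ 2 * d ^ 3) * c := by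
        gcongr
      linarith
    have t2 : A ^ 2 / (a ^ 2 * b ^ 2 * c ^ 2) * (a / d ^ 3) ≤
        A ^ 2 * (1 / (a ^ 2 * b ^ 2 * d ^ 2 * d)) := by
      rw [div_mul_div_comm, mul_one_div, div_le_div_iff₀ (by positivity) (by positivity)]
      have : A ^ 2 * (a ^ 2 * b ^ 2 * d ^ 3) * (a * 1) ≤
        A ^ 2 * (a ^ 2 * b ^ 2 * d ^ 3) * (c * c) := by gcongr
      linarith
    have t3 : A / (a ^ 2 * b * c ^ 2) * (b / d ^ 3) ≤
        A ^ 2 * (1 / (a ^ 2 * b ^ 2 * d ^ 2 * d)) := by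
      rw [div_mul_div_comm, mul_one_div, div_le_div_iff₀ (by positivity) (by positivity)]
      have : A * 1 * (a ^ 2 * b * d ^ 3) * (b ^ 2) ≤
        A * A * (a ^ 2 * b * d ^ 3) * (c ^ 2) := by gcongr
      linarith
    have pos : 0 ≤ A ^ 2 * (1 / (a ^ 2 * b ^ 2 * d ^ 2 * d)) := by positivity
    have s1 := mul_le_mul_of_nonneg_left e1
      (by positivity : 0 ≤ 2 * A ^ 2 / (a ^ 3 * b ^ 2 * c))
    have s2 := mul_le_mul_of_nonneg_left e1 (by positivity : 0 ≤ A ^ 2 / (a ^ 2 * b ^ 2 * c ^ 2))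
    have s3 := mul_le_mul_of_nonneg_left e2 (by positivity : 0 ≤ A / (a ^ 2 * b * c ^ 2))
    linarith
  -- Without subtraction `r` does not exceed `p` or does not exceed `q`, and the denominator `c = A
  -- + p + q` already provides the extra power.
  · have hdc : d ≤ c := by
      rcases not_and_or.1 h with h | h
      · have : (size r : ℝ) ≤ size p := by exact_mod_cast not_lt.1 h
        linarith
      · have : (size r : ℝ) ≤ size q := by exact_mod_cast not_lt.1 h
        linarith
    refine ⟨c, hca, hcb, hdc, (habs _ _ _ _ _ (by positivity) (by positivity)
      (by positivity)).trans ?_⟩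
    rw [sub_zero, sub_zero, abs_of_nonneg (by positivity), abs_of_nonneg (by positivity)]
    have k1 : 1 / (d * (a + size r)) ≤ 1 / d ^ 2 := by
      refine one_div_le_one_div_of_le (by positivity) ?_
      rw [sq]; gcongr; linarith
    have k2 : 1 / (d * (b + size r)) ≤ 1 / d ^ 2 := by
      refine one_div_le_one_div_of_le (by positivity) ?_
      rw [sq]; gcongr; linarith
    have t1 : 2 * A ^ 2 / (a ^ 3 * b ^ 2 * c) * (1 / d ^ 2) ≤
        2 * A ^ 2 * (1 / (a ^ 2 * b ^ 2 * d ^ 2 * c)) := by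
      rw [div_mul_div_comm, mul_one_div, div_le_div_iff₀ (by positivity) (by positivity)]
      have : 2 * A ^ 2 * (a ^ 2 * b ^ 2 * d ^ 2 * c) * 1 ≤
        2 * A ^ 2 * (a ^ 2 * b ^ 2 * d ^ 2 * c) * a := by gcongr
      linarith
    have t2 : A ^ 2 / (a ^ 2 * b ^ 2 * c ^ 2) * (1 / d ^ 2) ≤
        A ^ 2 * (1 / (a ^ 2 * b ^ 2 * d ^ 2 * c)) := by
      rw [div_mul_div_comm, mul_one_div, div_le_div_iff₀ (by positivity) (by positivity)]
      have : A ^ 2 * (a ^ 2 * b ^ 2 * d ^ 2 * c) * 1 ≤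
        A ^ 2 * (a ^ 2 * b ^ 2 * d ^ 2 * c) * c := by gcongr
      linarith
    have t3 : A / (a ^ 2 * b * c ^ 2) * (1 / d ^ 2) ≤
        A ^ 2 * (1 / (a ^ 2 * b ^ 2 * d ^ 2 * c)) := by
      rw [div_mul_div_comm, mul_one_div, div_le_div_iff₀ (by positivity) (by positivity)]
      have : A * 1 * (a ^ 2 * b * d ^ 2 * c) * b ≤ A * A * (a ^ 2 * b * d ^ 2 * c) * c := by gcongr
      linarith
    have pos : 0 ≤ A ^ 2 * (1 / (a ^ 2 * b ^ 2 * d ^ 2 * c)) := by positivity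
    have s1 := mul_le_mul_of_nonneg_left k1
      (by positivity : 0 ≤ 2 * A ^ 2 / (a ^ 3 * b ^ 2 * c))
    have s2 := mul_le_mul_of_nonneg_left k1 (by positivity : 0 ≤ A ^ 2 / (a ^ 2 * b ^ 2 * c ^ 2))
    have s3 := mul_le_mul_of_nonneg_left k2 (by positivity : 0 ≤ A / (a ^ 2 * b * c ^ 2))
    linarith

theorem summable_gammaThreeTerm (hA : 1 ≤ A) : Summable fun t : (ℕ × ℕ) × (ℕ × ℕ) × (ℕ × ℕ) =>
    gammaThreeTerm A (usefulSubtraction A t.1 t.2.1 t.2.2) t.1 t.2.1 t.2.2 :=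
  Summable.of_norm_bounded ((summable_triple hA).mul_left (A ^ 2)) fun t =>
    abs_gammaThreeTerm_le hA t.1 t.2.1 t.2.2

/-- In the remainder, where p < r ≤ q, the factor `A + p + q` dominates all three denominators, and
`1 - 2 * A / (A + p)` is at most 1 in modulus. -/
theorem summable_gammaThreeUseful (hA : 1 ≤ A) : Summable fun t : (ℕ × ℕ) × (ℕ × ℕ) × (ℕ × ℕ) =>
    gammaThreeUseful A t.1 t.2.1 t.2.2 := by
  refine (summable_gammaThreeTerm hA).add (Summable.of_norm_bounded
    ((summable_triple hA).mul_left A) fun t => ?_)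
  obtain ⟨p, q, r⟩ := t
  have hA0 : 0 < A := by linarith
  have hp : (0 : ℝ) ≤ size p := Nat.cast_nonneg _
  dsimp only
  split_ifs with h
  · have h1 : (size p : ℝ) ≤ size r := by exact_mod_cast h.1.le
    have h2 : (size r : ℝ) ≤ size q := by exact_mod_cast h.2
    have hfrac : |A / 32 * (1 - 2 * A / (A + size p))| ≤ A := by
      have h3 : 2 * A / (A + size p) ≤ 2 := by
        rw [div_le_iff₀ (by positivity)]; linarith
      have h4 : 0 ≤ 2 * A / (A + size p) := by positivity
      rw [abs_mul, abs_of_pos (by positivity : 0 < A / 32)]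
      have h5 : |1 - 2 * A / (A + size p)| ≤ 1 := abs_le.2 ⟨by linarith, by linarith⟩
      nlinarith
    rw [Real.norm_eq_abs, abs_mul, abs_of_nonneg (by positivity : 0 ≤ 1 / ((A + size p : ℝ) ^ 2 *
      (A + size q) ^ 2 * (A + size p + size q) * (A + size r) ^ 2))]
    refine mul_le_mul hfrac ?_ (by positivity) hA0.le
    have := inv_le_rpow_mul (a := A + size p) (b := A + size q) (d := A + size r)
      (m := A + size p + size q) (by linarith) (by linarith) (by linarith) (by linarith)
      (by linarith) (by linarith)
    rwa [mul_right_comm] at this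
  · rw [norm_zero]
    positivity

end Summability

/-! ### The flow of an absolutely summable family -/

section Flow

variable {T : Type*} {level top : T → ℕ} {S : ℕ → ℕ → Finset T} {F : T → ℝ}

/-- The sum of `F` over the elements of level at least `i`. -/
def tailSum (level : T → ℕ) (F : T → ℝ) (i : ℕ) : ℝ := ∑' t, if i ≤ level t then F t else 0

theorem summable_tail (hF : Summable F) (i : ℕ) :
    Summable fun t => if i ≤ level t then F t else 0 :=
  Summable.of_norm_bounded hF.abs fun t => by
    split_ifs
    · exact le_rfl
    · simp

/-- The sets `S 0 n` exhaust `T`, and the infrared cutoff is a restriction of the summand, so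
unconditional convergence gives the limit. -/
theorem tendsto_sum_tailSum (hS : ∀ i n t, t ∈ S i n ↔ i ≤ level t ∧ top t ≤ n)
    (hF : Summable F) (i : ℕ) :
    Tendsto (fun n => ∑ t ∈ S i n, F t) atTop (𝓝 (tailSum level F i)) := by
  have h1 : Tendsto (fun n => S 0 n) atTop atTop := by
    refine tendsto_atTop_finset_of_monotone (fun m n hmn t ht => ?_) fun t => ⟨top t, ?_⟩
    · rw [hS] at ht ⊢
      exact ⟨ht.1, ht.2.trans hmn⟩
    · rw [hS]
      exact ⟨Nat.zero_le _, le_rfl⟩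
  refine ((summable_tail (level := level) hF i).hasSum.comp h1).congr fun n => ?_
  rw [Function.comp_apply, ← Finset.sum_filter]
  refine Finset.sum_congr (Finset.ext fun t => ?_) fun _ _ => rfl
  rw [Finset.mem_filter, hS, hS]
  exact ⟨fun h => ⟨h.2, h.1.2⟩, fun h => ⟨⟨Nat.zero_le _, h.2⟩, h.1⟩⟩

theorem tendsto_tailSum (hF : Summable F) : Tendsto (tailSum level F) atTop (𝓝 0) := by
  rw [← tsum_zero (α := ℝ) (β := T)]
  refine tendsto_tsum_of_dominated_convergence hF.abs (fun t => ?_)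
    (Eventually.of_forall fun i t => ?_)
  · refine tendsto_const_nhds.congr' ?_
    filter_upwards [eventually_gt_atTop (level t)] with i hi
    rw [if_neg (not_le.2 hi)]
  · split_ifs
    · exact le_rfl
    · simp

theorem abs_tailSum_sub_le (hF : Summable F) {i j : ℕ} (hij : i ≤ j) :
    |tailSum level F i - tailSum level F j| ≤
      tailSum level (fun t => |F t|) i - tailSum level (fun t => |F t|) j := by
  rw [tailSum, tailSum, tailSum, tailSum,
    ← (summable_tail hF i).tsum_sub (summable_tail hF j),
    ← (summable_tail hF.abs i).tsum_sub (summable_tail hF.abs j), ← Real.norm_eq_abs]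
  refine tsum_of_norm_bounded ((summable_tail hF.abs i).sub (summable_tail hF.abs j)).hasSum
    fun t => ?_
  rw [Real.norm_eq_abs]
  by_cases h1 : i ≤ level t <;> by_cases h2 : j ≤ level t
  · simp [h1, h2]
  · simp [h1, h2]
  · exact absurd (hij.trans h2) h1
  · simp [h1, h2]

/-- The increments are dominated by those of the tails of `|F|`, which telescope to at most the
first tail. -/
theorem summable_abs_tailSum_sub (hF : Summable F) {s : ℕ → ℕ} (hs : Monotone s) :
    Summable fun i => |tailSum level F (s i) - tailSum level F (s (i + 1))| := by
  set G := tailSum level fun t => |F t| with hG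
  refine summable_of_sum_range_le (c := G (s 0)) (fun i => abs_nonneg _) fun n => ?_
  calc ∑ i ∈ Finset.range n, |tailSum level F (s i) - tailSum level F (s (i + 1))|
      ≤ ∑ i ∈ Finset.range n, (G (s i) - G (s (i + 1))) :=
        Finset.sum_le_sum fun i _ => abs_tailSum_sub_le hF (hs (Nat.le_succ i))
    _ = G (s 0) - G (s n) := Finset.sum_range_sub' (fun i => G (s i)) n
    _ ≤ G (s 0) := sub_le_self _ (tsum_nonneg fun t => by split_ifs <;> positivity)

theorem hasSum_tailSum_zero (hF : Summable F) : HasSum F (tailSum level F 0) := by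
  simpa [tailSum] using hF.hasSum

end Flow

theorem mem_indices {lo hi : ℕ} {p : ℕ × ℕ} : p ∈ indices lo hi ↔ lo ≤ size p ∧ size p ≤ hi := by
  rw [indices, Finset.mem_filter, Finset.mem_product, Finset.mem_range, Finset.mem_range, size]
  omega

end GrosseWulkenhaar

end

/-! ### The theorem -/

open GrosseWulkenhaar
theorem mainTheorem1 (κ : Model) (θ μ A : ℝ) (hθ : 0 < θ) (hA : A = 2 + μ ^ 2 * θ / 4) :
    -- mass subtraction only
    ((∀ Λ : ℕ, ∃! B : ℕ → ℝ⟦X⟧, IsMassSubtracted κ θ A 0 Λ B) ∧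
      (∀ (Λ : ℕ) (B : ℕ → ℝ⟦X⟧), IsMassSubtracted κ θ A 0 Λ B →
        HasExpansion (effectiveCoupling κ θ 0 Λ B)
          (∑ p ∈ indices 0 Λ, ∑ q ∈ indices 0 Λ, gammaTwoTerm A p q)
          (∑ p ∈ indices 0 Λ, ∑ q ∈ indices 0 Λ, ∑ r ∈ indices 0 Λ, gammaThreeTerm A 0 p q r)) ∧
      Summable fun t : (ℕ × ℕ) × (ℕ × ℕ) × (ℕ × ℕ) =>
        gammaThreeTerm A (usefulSubtraction A t.1 t.2.1 t.2.2) t.1 t.2.1 t.2.2) ∧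
    -- mass and useful wave function subtractions, with infrared cutoff `i`
    ((∀ i Λ : ℕ, ∃! B : ℕ → ℝ⟦X⟧, IsUsefullySubtracted κ θ A i Λ B) ∧
      ∃ (γ₂ γ₃ : ℕ → ℕ → ℝ) (g₂ g₃ : ℕ → ℝ),
        (∀ (i Λ : ℕ) (B : ℕ → ℝ⟦X⟧), IsUsefullySubtracted κ θ A i Λ B →
          HasExpansion (effectiveCoupling κ θ i Λ B) (γ₂ i Λ) (γ₃ i Λ)) ∧
        (∀ i, Tendsto (γ₂ i) atTop (𝓝 (g₂ i))) ∧
        (∀ i, Tendsto (γ₃ i) atTop (𝓝 (g₃ i))) ∧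
        HasSum (fun t : (ℕ × ℕ) × (ℕ × ℕ) => gammaTwoTerm A t.1 t.2) (g₂ 0) ∧
        0 < g₂ 0 ∧
        -- the flow of the effective coupling from slice to slice
        Tendsto g₂ atTop (𝓝 0) ∧ Tendsto g₃ atTop (𝓝 0) ∧
        ∀ s : ℕ → ℕ, StrictMono s →
          Summable (fun i => |g₂ (s i) - g₂ (s (i + 1))|) ∧
          Summable (fun i => |g₃ (s i) - g₃ (s (i + 1))|)) := by
  have hA1 : 1 ≤ A := by rw [hA]; nlinarith [mul_nonneg (sq_nonneg μ) hθ.le]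
  have hA0 : 0 < A := by linarith
  have h2 := summable_gammaTwoTerm hA1
  have h3 := summable_gammaThreeUseful hA1
  -- The infrared cutoff bounds the smallest index from below, the ultraviolet one the largest from
  -- above.
  let level₂ : (ℕ × ℕ) × (ℕ × ℕ) → ℕ := fun t => min (size t.1) (size t.2)
  let level₃ : (ℕ × ℕ) × (ℕ × ℕ) × (ℕ × ℕ) → ℕ := fun t =>
    min (size t.1) (min (size t.2.1) (size t.2.2))
  refine ⟨⟨fun Λ => existsUnique_massSubtracted κ θ A 0 Λ,
      fun Λ B hB => hasExpansion_of_isMassSubtracted hθ hA0 hB, summable_gammaThreeTerm hA1⟩,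
    fun i Λ => existsUnique_usefullySubtracted κ θ A i Λ,
    fun i Λ => ∑ p ∈ indices i Λ, ∑ q ∈ indices i Λ, gammaTwoTerm A p q,
    fun i Λ => ∑ p ∈ indices i Λ, ∑ q ∈ indices i Λ, ∑ r ∈ indices i Λ, gammaThreeUseful A p q r,
    tailSum level₂ fun t => gammaTwoTerm A t.1 t.2,
    tailSum level₃ fun t => gammaThreeUseful A t.1 t.2.1 t.2.2,
    fun i Λ B hB => ?_, fun i => ?_, fun i => ?_, hasSum_tailSum_zero h2, ?_,
    tendsto_tailSum h2, tendsto_tailSum h3, fun s hs =>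
      ⟨summable_abs_tailSum_sub h2 hs.monotone, summable_abs_tailSum_sub h3 hs.monotone⟩⟩
  · dsimp only
    -- At finite cutoffs the symmetrized summand has the same sum as the one produced by the
    -- expansion.
    rw [← sum_gammaThreeUseful hA0]
    exact hasExpansion_of_isUsefullySubtracted hθ hA0 hB
  · refine (tendsto_sum_tailSum (level := level₂) (top := fun t => max (size t.1) (size t.2))
      (S := fun i n => indices i n ×ˢ indices i n) (fun i n t => ?_) h2 i).congr fun n =>
        Finset.sum_product _ _ _
    simp only [Finset.mem_product, mem_indices, level₂]
    omega
  · refine (tendsto_sum_tailSum (level := level₃)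
      (top := fun t => max (size t.1) (max (size t.2.1) (size t.2.2)))
      (S := fun i n => indices i n ×ˢ indices i n ×ˢ indices i n) (fun i n t => ?_) h3 i).congr
        fun n => ?_
    · simp only [Finset.mem_product, mem_indices, level₃]
      omega
    · rw [Finset.sum_product]
      exact Finset.sum_congr rfl fun p _ => Finset.sum_product _ _ _
  · have hpos : ∀ t : (ℕ × ℕ) × (ℕ × ℕ), 0 < gammaTwoTerm A t.1 t.2 := fun t => by
      rw [gammaTwoTerm]; positivity
    have := h2.tsum_pos (fun t => (hpos t).le) (0, 0) (hpos _)
    rwa [(hasSum_tailSum_zero (level := level₂) h2).tsum_eq] at this
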